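/- Let $k$ be a field of prime characteristic $p$, and let $R$ and $S$ be standard graded rings over $k$: each is a noetherian $\mathbb N$-graded ring with degree zero part $k$, generated as a $k$-algebra by its elements of degree one. Assume $\operatorname{depth} R\ge 2$ and $\operatorname{depth} S\ge 2$ (depth with respect to the homogeneous maximal ideal), and let $T=R\# S=\bigoplus_{n\ge 0}[R]_n\otimes_k[S]_n$ be the Segre product. For $U\in\{R,S,T\}$ with homogeneous maximal ideal $\mathfrak m_U$, the graded local cohomology modules $H^j_{\mathfrak m_U}(U)$ carry the Frobenius action $F$ induced by the Frobenius endomorphism of $U$. Such a module $H$ is nilpotent if every element of $H$ is killed by some power of $F$, and it is nilpotent in degree $n$ if every element of $[H]_n$ is killed by some power of $F$. The ring $U$ is weakly $F$-nilpotent if $H^j_{\mathfrak m_U}(U)$ is nilpotent for all $j<\dim U$. Put $$b_j(U)=\sup\{n\in\mathbb Z : H^j_{\mathfrak m_U}(U)\text{ is not nilpotent in degree }n\}\in\mathbb Z\cup\{\pm\infty\},\qquad b(U)=\inf\{j\in\mathbb N : b_j(U)=0\}\in\mathbb N\cup\{\infty\}.$$ If $R$ and $S$ are weakly $F$-nilpotent,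 then $T$ is weakly $F$-nilpotent if and only if $b(R)=b(S)=\infty$; and in that case $b(T)=\infty$ as well. -/

import Mathlib

open scoped TensorProduct

noncomputable section

namespace SegreF

/-! ### Graded rings, depth, Segre products -/

section GradedRings

variable {k A B : Type*} [Field k] [CommRing A] [Algebra k A] [CommRing B] [Algebra k B]

/-- `A = ⨁ₙ 𝒜 n` is a standard graded ring with degree zero part the field `k`: it is noetherian,
`[A]₀ = k`, and `A` is generated by `[A]₁` as a `k`-algebra. -/
structure IsStandardGraded (𝒜 : ℕ → Submodule k A) [GradedAlgebra 𝒜] : Prop where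
  nontrivial : Nontrivial A
  noetherian : IsNoetherianRing A
  degree_zero : 𝒜 0 = 1
  generated : Algebra.adjoin k (𝒜 1 : Set A) = ⊤

/-- The depth of a graded ring: the supremum of the lengths of the regular sequences contained in
the homogeneous maximal ideal `⨁_{n > 0} 𝒜 n`. -/
def depth (𝒜 : ℕ → Submodule k A) [GradedAlgebra 𝒜] : ℕ∞ :=
  ⨆ (rs : List A) (_ : (∀ a ∈ rs, a ∈ HomogeneousIdeal.irrelevant 𝒜) ∧
    RingTheory.Sequence.IsRegular A rs), (rs.length : ℕ∞)

/-- The image of `[A]ₙ ⊗ [B]ₙ` in `A ⊗ B` (`k` is a field, so `[A]ₙ ⊗ [B]ₙ` embeds). -/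
def segrePart (𝒜 : ℕ → Submodule k A) (ℬ : ℕ → Submodule k B) (n : ℕ) : Submodule k (A ⊗[k] B) :=
  LinearMap.range (TensorProduct.map (𝒜 n).subtype (ℬ n).subtype)

lemma tmul_mem_segrePart {𝒜 : ℕ → Submodule k A} {ℬ : ℕ → Submodule k B} {n : ℕ} {a : A} {b : B}
    (ha : a ∈ 𝒜 n) (hb : b ∈ ℬ n) : a ⊗ₜ[k] b ∈ segrePart 𝒜 ℬ n :=
  ⟨(⟨a, ha⟩ : 𝒜 n) ⊗ₜ[k] (⟨b, hb⟩ : ℬ n), by simp⟩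

lemma segrePart_le {𝒜 : ℕ → Submodule k A} {ℬ : ℕ → Submodule k B} {n : ℕ}
    {N : Submodule k (A ⊗[k] B)} (h : ∀ a ∈ 𝒜 n, ∀ b ∈ ℬ n, a ⊗ₜ[k] b ∈ N) :
    segrePart 𝒜 ℬ n ≤ N := by
  rintro _ ⟨t, rfl⟩
  induction t with
  | zero => simp
  | tmul a b => simpa using h a a.2 b b.2
  | add s t hs ht => rw [map_add]; exact N.add_mem hs ht

variable (𝒜 : ℕ → Submodule k A) [GradedAlgebra 𝒜] (ℬ : ℕ → Submodule k B) [GradedAlgebra ℬ]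

lemma one_mem_segrePart : (1 : A ⊗[k] B) ∈ segrePart 𝒜 ℬ 0 :=
  tmul_mem_segrePart SetLike.GradedOne.one_mem SetLike.GradedOne.one_mem

variable {𝒜 ℬ} in
lemma mul_mem_segrePart {m n : ℕ} {s t : A ⊗[k] B} (hs : s ∈ segrePart 𝒜 ℬ m)
    (ht : t ∈ segrePart 𝒜 ℬ n) : s * t ∈ segrePart 𝒜 ℬ (m + n) := by
  have h : segrePart 𝒜 ℬ m ≤ (segrePart 𝒜 ℬ (m + n)).comap (LinearMap.mulRight k t) := by
    refine segrePart_le fun a ha b hb => ?_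
    have h' : segrePart 𝒜 ℬ n ≤
        (segrePart 𝒜 ℬ (m + n)).comap (LinearMap.mulLeft k (a ⊗ₜ[k] b)) := by
      refine segrePart_le fun a' ha' b' hb' => ?_
      simpa using tmul_mem_segrePart (SetLike.mul_mem_graded ha ha') (SetLike.mul_mem_graded hb hb')
    exact h' ht
  exact h hs

/-- The Segre product `A # B = ⨁ₙ [A]ₙ ⊗ [B]ₙ`, as a subalgebra of `A ⊗ B`. -/
def segre : Subalgebra k (A ⊗[k] B) :=
  (⨆ n, segrePart 𝒜 ℬ n).toSubalgebra
    (Submodule.mem_iSup_of_mem 0 (one_mem_segrePart 𝒜 ℬ)) fun s t hs ht => by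
      refine Submodule.iSup_induction _ (motive := fun s => s * t ∈ ⨆ n, segrePart 𝒜 ℬ n) hs
        (fun m s hs => ?_) (by simp) (fun s s' h h' => by rw [add_mul]; exact add_mem h h')
      refine Submodule.iSup_induction _ (motive := fun t => s * t ∈ ⨆ n, segrePart 𝒜 ℬ n) ht
        (fun n t ht => ?_) (by simp) (fun s s' h h' => by rw [mul_add]; exact add_mem h h')
      exact Submodule.mem_iSup_of_mem _ (mul_mem_segrePart hs ht)

/-- The grading of the Segre product: `[A # B]ₙ = [A]ₙ ⊗ [B]ₙ`. -/
def segreGrading (n : ℕ) : Submodule k (segre 𝒜 ℬ) :=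
  (segrePart 𝒜 ℬ n).comap (segre 𝒜 ℬ).val.toLinearMap

/-- The projection of `A ⊗ B` onto `[A]ₙ ⊗ [B]ₙ`. -/
def segreProj (n : ℕ) : A ⊗[k] B →ₗ[k] A ⊗[k] B :=
  TensorProduct.map (GradedAlgebra.proj 𝒜 n) (GradedAlgebra.proj ℬ n)

lemma segreProj_of_mem {m n : ℕ} {t : A ⊗[k] B} (ht : t ∈ segrePart 𝒜 ℬ m) :
    segreProj 𝒜 ℬ n t = if m = n then t else 0 := by
  have h : segrePart 𝒜 ℬ m ≤
      LinearMap.eqLocus (segreProj 𝒜 ℬ n) (if m = n then LinearMap.id else 0) := by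
    refine segrePart_le fun a ha b hb => ?_
    rw [LinearMap.mem_eqLocus]
    split_ifs with hmn
    · subst hmn
      simp [segreProj, GradedAlgebra.proj_apply, DirectSum.decompose_of_mem_same _ ha,
        DirectSum.decompose_of_mem_same _ hb]
    · simp [segreProj, GradedAlgebra.proj_apply, DirectSum.decompose_of_mem_ne _ ha hmn]
  have := h ht
  rw [LinearMap.mem_eqLocus] at this
  rw [this]
  split_ifs <;> rfl

lemma segreGrading_isInternal : DirectSum.IsInternal (segreGrading 𝒜 ℬ) := by
  refine DirectSum.isInternal_submodule_of_iSupIndep_of_iSup_eq_top ?_ ?_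
  · rw [iSupIndep_def]
    intro n
    rw [Submodule.disjoint_def]
    intro t ht ht'
    have h0 : (⨆ (m) (_ : m ≠ n), segreGrading 𝒜 ℬ m) ≤
        LinearMap.ker (segreProj 𝒜 ℬ n ∘ₗ (segre 𝒜 ℬ).val.toLinearMap) := by
      refine iSup₂_le fun m hm s hs => ?_
      have := segreProj_of_mem 𝒜 ℬ (n := n) (show (s : A ⊗[k] B) ∈ segrePart 𝒜 ℬ m from hs)
      rw [if_neg hm] at this
      simpa using this
    have h1 := h0 ht'
    have h2 := segreProj_of_mem 𝒜 ℬ (n := n) (show (t : A ⊗[k] B) ∈ segrePart 𝒜 ℬ n from ht)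
    rw [if_pos rfl] at h2
    have h3 : segreProj 𝒜 ℬ n (t : A ⊗[k] B) = 0 := by simpa using h1
    exact Subtype.ext (h2.symm.trans h3)
  · rw [eq_top_iff]
    rintro ⟨t, ht⟩ -
    have key : ∀ t ∈ ⨆ n, segrePart 𝒜 ℬ n,
        ∃ h : t ∈ segre 𝒜 ℬ, (⟨t, h⟩ : segre 𝒜 ℬ) ∈ ⨆ n, segreGrading 𝒜 ℬ n := by
      intro t ht
      refine Submodule.iSup_induction _ (motive := fun t =>
        ∃ h : t ∈ segre 𝒜 ℬ, (⟨t, h⟩ : segre 𝒜 ℬ) ∈ ⨆ n, segreGrading 𝒜 ℬ n) ht ?_ ?_ ?_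
      · intro n s hs
        exact ⟨Submodule.mem_iSup_of_mem (p := segrePart 𝒜 ℬ) n hs,
          Submodule.mem_iSup_of_mem n hs⟩
      · exact ⟨zero_mem _, zero_mem _⟩
      · rintro s s' ⟨h, h1⟩ ⟨h', h1'⟩
        exact ⟨add_mem h h', add_mem h1 h1'⟩
    exact (key t ht).2

instance : GradedAlgebra (segreGrading 𝒜 ℬ) where
  one_mem := one_mem_segrePart 𝒜 ℬ
  mul_mem _ _ _ _ hs ht := mul_mem_segrePart hs ht
  __ := (segreGrading_isInternal 𝒜 ℬ).chooseDecomposition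

end GradedRings

/-! ### Modules with a Frobenius action

`(M, ρ)` is a module with an additive endomorphism `ρ`, and `ℳ n = [M]ₙ` is its degree `n` part. -/

section FrobeniusActions

variable {k M : Type*} [Field k] [AddCommGroup M] [Module k M]

/-- `M` is nilpotent: every element is killed by a power of `ρ`. -/
def IsNilp (ρ : M → M) : Prop := ∀ m : M, ∃ e : ℕ, ρ^[e] m = 0

/-- `M` is nilpotent in degree `n`: `[M]ₙ = ⋃ₑ ker (ρ^e : [M]ₙ → [M]_{n p^e})`. -/
def IsNilpInDegree (ρ : M → M) (ℳ : ℤ → Submodule k M) (n : ℤ) : Prop :=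
  ∀ m ∈ ℳ n, ∃ e : ℕ, ρ^[e] m = 0

/-- The base-nilpotent index `b(M) = sup {n | M is not nilpotent in degree n} ∈ ℤ ∪ {±∞}`. -/
def baseNilIndex (ρ : M → M) (ℳ : ℤ → Submodule k M) : WithBot (WithTop ℤ) :=
  sSup ((fun n : ℤ => ((n : WithTop ℤ) : WithBot (WithTop ℤ))) '' {n | ¬ IsNilpInDegree ρ ℳ n})

end FrobeniusActions

/-! ### Graded local cohomology and its Frobenius action, through the Čech complex -/

section Frobenius

variable (k : Type*) [Field k] (p : ℕ) [Fact p.Prime] [CharP k p]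

/-- The Frobenius endomorphism `a ↦ a ^ p` of a `k`-algebra (possibly zero), `char k = p`. -/
def frob (A : Type*) [CommRing A] [Algebra k A] : A →+* A where
  toFun a := a ^ p
  map_one' := one_pow p
  map_mul' a b := mul_pow a b p
  map_zero' := zero_pow (Fact.out : p.Prime).ne_zero
  map_add' a b := by
    have h0 : (p : A) = 0 := by
      rw [← map_natCast (algebraMap k A), CharP.cast_eq_zero, map_zero]
    rw [(Commute.all a b).add_pow_prime_eq Fact.out, h0]
    ring

end Frobenius

section Cech

variable {A : Type*} [CommRing A] {r : ℕ} (x : Fin r → A)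

/-- `A_{x_I}`, the localization of `A` at `x_I = ∏_{i ∈ I} xᵢ`. -/
abbrev CechLoc (I : Finset (Fin r)) : Type _ := Localization.Away (∏ i ∈ I, x i)

/-- The localization map `A_{x_I} → A_{x_J}` for `I ⊆ J`. -/
def cechRes {I J : Finset (Fin r)} (h : I ⊆ J) : CechLoc x I →ₐ[A] CechLoc x J :=
  IsLocalization.Away.liftAlgHom (∏ i ∈ I, x i) (f := Algebra.ofId A (CechLoc x J))
    (isUnit_of_dvd_unit (map_dvd _ (Finset.prod_dvd_prod_of_subset I J x h))
      (IsLocalization.Away.algebraMap_isUnit (∏ i ∈ J, x i)))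

/-- The Čech cochains `C^j = ⨁_{|I| = j} A_{x_I}`; in particular `C^0 = A`. -/
abbrev CechC (j : ℕ) : Type _ := ∀ I : {I : Finset (Fin r) // I.card = j}, CechLoc x I.1

/-- The Čech differential: the component at `J` of `d c` is
`∑_{i ∈ J} (-1)^{#{l ∈ J | l < i}} c_{J \ i}`. -/
def cechD (j : ℕ) : CechC x j →ₗ[A] CechC x (j + 1) :=
  LinearMap.pi fun J => ∑ i ∈ J.1.attach, ((-1 : A) ^ (J.1.filter (· < i.1)).card) •
    ((cechRes x (J.1.erase_subset i.1)).toLinearMap ∘ₗ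
      LinearMap.proj (⟨J.1.erase i.1, by rw [Finset.card_erase_of_mem i.2, J.2]; rfl⟩ :
        {I : Finset (Fin r) // I.card = j}))

/-- The coboundaries in `C^j`. -/
def cechB : (j : ℕ) → Submodule A (CechC x j)
  | 0 => ⊥
  | j + 1 => LinearMap.range (cechD x j)

/-- The `j`-th local cohomology module `H^j_J(A)`, `J = (x₁, …, x_r)`, for `A` noetherian: the
cohomology of the Čech complex `0 → A → ⨁ᵢ A_{xᵢ} → ⨁_{i < l} A_{xᵢ x_l} → ⋯`. -/
abbrev LocCoh (j : ℕ) : Type _ :=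
  LinearMap.ker (cechD x j) ⧸ (cechB x j).submoduleOf (LinearMap.ker (cechD x j))

section Frobenius

variable (k : Type*) [Field k] (p : ℕ) [Fact p.Prime] [CharP k p] [Algebra k A]

/-- The Frobenius endomorphism, applied to each component of a Čech cochain. -/
def cechFrob (j : ℕ) : CechC x j →ₛₗ[frob k p A] CechC x j where
  toFun c I := frob k p (CechLoc x I.1) (c I)
  map_add' c c' := by ext I; simp
  map_smul' a c := by ext I; exact smul_pow a (c I) p

lemma cechFrob_cechD (j : ℕ) (c : CechC x j) :
    cechFrob x k p (j + 1) (cechD x j c) = cechD x j (cechFrob x k p j c) := by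
  ext J
  simp only [cechFrob, cechD, LinearMap.coe_mk, AddHom.coe_mk, LinearMap.pi_apply,
    LinearMap.sum_apply, map_sum, LinearMap.smul_apply, LinearMap.comp_apply, LinearMap.proj_apply]
  refine Finset.sum_congr rfl fun i _ => ?_
  have h : frob k p A ((-1) ^ (J.1.filter (· < i.1)).card) =
      (-1) ^ (J.1.filter (· < i.1)).card := by
    rw [map_pow, map_neg, map_one]
  refine (smul_pow _ _ p).trans ?_
  refine congrArg₂ (· • ·) h ?_
  simp [frob]

lemma cechFrob_mem_ker (j : ℕ) (c : CechC x j) (hc : c ∈ LinearMap.ker (cechD x j)) :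
    cechFrob x k p j c ∈ LinearMap.ker (cechD x j) := by
  rw [LinearMap.mem_ker] at hc ⊢
  rw [← cechFrob_cechD, hc, map_zero]

lemma cechFrob_mem_cechB (j : ℕ) (c : CechC x j) (hc : c ∈ cechB x j) :
    cechFrob x k p j c ∈ cechB x j := by
  cases j with
  | zero => rw [cechB, Submodule.mem_bot] at hc ⊢; rw [hc, map_zero]
  | succ j =>
    obtain ⟨b, rfl⟩ := hc
    exact ⟨cechFrob x k p j b, (cechFrob_cechD x k p j b).symm⟩

/-- The canonical Frobenius action on `H^j_J(A)`. -/
def locCohFrob (j : ℕ) : LocCoh x j →ₛₗ[frob k p A] LocCoh x j :=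
  Submodule.mapQ _ _ ((cechFrob x k p j).restrict (cechFrob_mem_ker x k p j))
    fun c hc => cechFrob_mem_cechB x k p j c.1 hc

end Frobenius

section Grading

variable {k : Type*} [Field k] [Algebra k A] (𝒜 : ℕ → Submodule k A)

/-- `[A_{x_I}]ₙ`, spanned by the fractions `a / s` with `a ∈ [A]_l`, `s ∈ [A]_m` a power of `x_I`,
and `l - m = n`. -/
def cechLocDeg (I : Finset (Fin r)) (n : ℤ) : Submodule k (CechLoc x I) :=
  Submodule.span k {ξ | ∃ (l m : ℕ) (a : A) (s : Submonoid.powers (∏ i ∈ I, x i)),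
    a ∈ 𝒜 l ∧ (s : A) ∈ 𝒜 m ∧ (l : ℤ) - m = n ∧ ξ = Localization.mk a s}

/-- `[C^j]ₙ`. -/
def cechDeg (j : ℕ) (n : ℤ) : Submodule k (CechC x j) :=
  Submodule.pi Set.univ fun I => cechLocDeg x 𝒜 I.1 n

/-- `[H^j_J(A)]ₙ`: the classes of the cocycles that are homogeneous of degree `n`. -/
def locCohDeg (j : ℕ) (n : ℤ) : Submodule k (LocCoh x j) :=
  ((cechDeg x 𝒜 j n).comap ((LinearMap.ker (cechD x j)).subtype.restrictScalars k)).map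
    (((cechB x j).submoduleOf (LinearMap.ker (cechD x j))).mkQ.restrictScalars k)

variable (p : ℕ) [Fact p.Prime] [CharP k p]

/-- `x₁, …, x_r` are generators of degree one of the homogeneous maximal ideal of `A`. -/
def IsLinearGenerators [GradedAlgebra 𝒜] : Prop :=
  (∀ i, x i ∈ 𝒜 1) ∧ Ideal.span (Set.range x) = (HomogeneousIdeal.irrelevant 𝒜).toIdeal

variable (k) in
/-- `A` is weakly `F`-nilpotent: `H^j_𝔪(A)` is nilpotent for `j < dim A`, where `𝔪 = (x)`. -/
def IsWeaklyFNilpotent : Prop :=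
  ∀ j : ℕ, (j : WithBot ℕ∞) < ringKrullDim A → IsNilp (locCohFrob x k p j)

/-- `b_j(A) = b(H^j_𝔪(A))`, where `𝔪 = (x)`. -/
def bIndex (j : ℕ) : WithBot (WithTop ℤ) :=
  baseNilIndex (locCohFrob x k p j) (locCohDeg x 𝒜 j)

/-- `b(A) = inf {j | b_j(A) = 0} ∈ ℕ ∪ {∞}`, where `𝔪 = (x)`. -/
def bInv : ℕ∞ := sInf ((fun j : ℕ => (j : ℕ∞)) '' {j | bIndex x 𝒜 p j = 0})

end Grading

end Cech

end SegreF

end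

section
open scoped TensorProduct
noncomputable section

set_option linter.unusedSectionVars false

namespace SegreF

/-! ### Cubes of localizations -/

section Cube

variable {A : Type*} [CommRing A] {ι : Type*} [DecidableEq ι]

/-- The localization of `A` at `∏ i ∈ K, w i`. -/
abbrev CubeLoc (w : ι → A) (K : Finset ι) : Type _ := Localization.Away (∏ i ∈ K, w i)

/-- The localization map `A_{w_I} → A_{w_J}` for `I ⊆ J`. -/
def cubeRes (w : ι → A) {I J : Finset ι} (h : I ⊆ J) : CubeLoc w I →ₐ[A] CubeLoc w J :=
  IsLocalization.Away.liftAlgHom (∏ i ∈ I, w i) (f := Algebra.ofId A (CubeLoc w J))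
    (isUnit_of_dvd_unit (map_dvd _ (Finset.prod_dvd_prod_of_subset I J w h))
      (IsLocalization.Away.algebraMap_isUnit (∏ i ∈ J, w i)))

/-- Cochains of the Čech complex in all degrees at once. -/
abbrev Cube (w : ι → A) : Type _ := ∀ K : Finset ι, CubeLoc w K

lemma cubeLoc_algHom_ext {w : ι → A} {K : Finset ι} {Q : Type*} [CommRing Q] [Algebra A Q]
    (f g : CubeLoc w K →ₐ[A] Q) : f = g :=
  IsLocalization.algHom_ext (Submonoid.powers (∏ i ∈ K, w i)) (Subsingleton.elim _ _)

lemma cubeRes_refl {w : ι → A} {K : Finset ι} (h : K ⊆ K) (m : CubeLoc w K) :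
    cubeRes w h m = m :=
  DFunLike.congr_fun (cubeLoc_algHom_ext (cubeRes w h) (AlgHom.id A _)) m

lemma cubeRes_cubeRes {w : ι → A} {I J K : Finset ι} (h : I ⊆ J) (h' : J ⊆ K) (m : CubeLoc w I) :
    cubeRes w h' (cubeRes w h m) = cubeRes w (h.trans h') m :=
  DFunLike.congr_fun (cubeLoc_algHom_ext ((cubeRes w h').comp (cubeRes w h)) _) m

/-- The sign of `i` in `J`. -/
def cubeSign (A : Type*) [CommRing A] (rk : ι → ℕ) (i : ι) (J : Finset ι) : A :=
  (-1) ^ (J.filter fun l => rk l < rk i).card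

lemma cubeSign_mul_self (rk : ι → ℕ) (i : ι) (J : Finset ι) :
    cubeSign A rk i J * cubeSign A rk i J = 1 := by
  rw [cubeSign, ← mul_pow]; simp

lemma cubeSign_erase_of_lt {rk : ι → ℕ} {i l : ι} {J : Finset ι} (hl : l ∈ J) (h : rk l < rk i) :
    cubeSign A rk i J = - cubeSign A rk i (J.erase l) := by
  unfold cubeSign
  have : (J.filter fun a => rk a < rk i).card
      = ((J.erase l).filter fun a => rk a < rk i).card + 1 := by
    rw [Finset.filter_erase, Finset.card_erase_add_one]
    simp [hl, h]
  rw [this, pow_succ]; ring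

lemma cubeSign_erase_of_not_lt {rk : ι → ℕ} {i l : ι} {J : Finset ι} (h : ¬ rk l < rk i) :
    cubeSign A rk i J = cubeSign A rk i (J.erase l) := by
  unfold cubeSign
  rw [Finset.filter_erase, Finset.erase_eq_of_notMem]
  simp [h]

/-- The Čech differential. -/
def cubeD (w : ι → A) (rk : ι → ℕ) : Cube w →ₗ[A] Cube w :=
  LinearMap.pi fun J => ∑ i ∈ J, cubeSign A rk i J •
    ((cubeRes w (J.erase_subset i)).toLinearMap ∘ₗ LinearMap.proj (J.erase i))

variable {w : ι → A} {rk : ι → ℕ}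

lemma cubeD_apply (c : Cube w) (J : Finset ι) :
    cubeD w rk c J = ∑ i ∈ J, cubeSign A rk i J • cubeRes w (J.erase_subset i) (c (J.erase i)) := by
  simp [cubeD]

lemma cubeD_cubeD (hrk : Function.Injective rk) (c : Cube w) :
    cubeD w rk (cubeD w rk c) = 0 := by
  funext J
  let t : Finset ι → CubeLoc w J := fun K => if h : K ⊆ J then cubeRes w h (c K) else 0
  have ht : ∀ (i l : ι), cubeRes w (J.erase_subset i)
      (cubeRes w ((J.erase i).erase_subset l) (c ((J.erase i).erase l))) =
        t ((J.erase i).erase l) := fun i l => by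
    rw [cubeRes_cubeRes]
    simp only [t]
    rw [dif_pos (((J.erase i).erase_subset l).trans (J.erase_subset i))]
  rw [cubeD_apply]
  simp only [cubeD_apply, map_sum, map_smul, ht, Finset.smul_sum, smul_smul]
  rw [Finset.sum_sigma']
  refine Finset.sum_involution (fun a _ => ⟨a.2, a.1⟩) ?_ ?_ ?_ ?_
  · rintro ⟨i, l⟩ h
    simp only [Finset.mem_sigma, Finset.mem_erase] at h
    obtain ⟨hi, hne, hl⟩ := h
    simp only
    rw [Finset.erase_right_comm, ← add_smul]
    have hne' : rk l ≠ rk i := fun h => hne (hrk h)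
    have : cubeSign A rk i J * cubeSign A rk l (J.erase i) +
        cubeSign A rk l J * cubeSign A rk i (J.erase l) = 0 := by
      rcases lt_or_gt_of_ne hne' with h | h
      · rw [cubeSign_erase_of_lt hl h, ← cubeSign_erase_of_not_lt (i := l) (l := i) (by omega)]
        ring
      · rw [cubeSign_erase_of_lt hi h, ← cubeSign_erase_of_not_lt (i := i) (l := l) (by omega)]
        ring
    rw [this, zero_smul]
  · rintro ⟨i, l⟩ h _ heq
    simp only [Finset.mem_sigma, Finset.mem_erase] at h
    simp only [Sigma.mk.injEq] at heq
    exact h.2.1 heq.1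
  · rintro ⟨i, l⟩ h
    simp only [Finset.mem_sigma, Finset.mem_erase] at h ⊢
    exact ⟨h.2.2, h.2.1.symm, h.1⟩
  · rintro ⟨i, l⟩ h
    rfl

/-- The projection of the cochains onto those supported on a family of sets. -/
def cubeRestr (w : ι → A) (U : Set (Finset ι)) : Cube w →ₗ[A] Cube w :=
  open Classical in LinearMap.pi fun K => if K ∈ U then LinearMap.proj K else 0

lemma cubeRestr_apply_of_mem {U : Set (Finset ι)} {K : Finset ι} (h : K ∈ U) (c : Cube w) :
    cubeRestr w U c K = c K := by simp [cubeRestr, h]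

lemma cubeRestr_apply_of_notMem {U : Set (Finset ι)} {K : Finset ι} (h : K ∉ U) (c : Cube w) :
    cubeRestr w U c K = 0 := by simp [cubeRestr, h]

/-- The cochain `c` is supported on the family `U`. -/
def CubeSupp (U : Set (Finset ι)) (c : Cube w) : Prop := ∀ K ∉ U, c K = 0

lemma cubeSupp_restr (U : Set (Finset ι)) (c : Cube w) : CubeSupp U (cubeRestr w U c) :=
  fun _ h => cubeRestr_apply_of_notMem h c

lemma CubeSupp.restr_eq {U : Set (Finset ι)} {c : Cube w} (h : CubeSupp U c) :
    cubeRestr w U c = c := by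
  funext K
  by_cases hK : K ∈ U
  · exact cubeRestr_apply_of_mem hK c
  · rw [cubeRestr_apply_of_notMem hK, h K hK]

lemma CubeSupp.mono {U V : Set (Finset ι)} {c : Cube w} (h : CubeSupp U c) (hUV : U ⊆ V) :
    CubeSupp V c := fun K hK => h K fun hK' => hK (hUV hK')

lemma CubeSupp.add {U : Set (Finset ι)} {c c' : Cube w} (h : CubeSupp U c) (h' : CubeSupp U c') :
    CubeSupp U (c + c') := fun K hK => by rw [Pi.add_apply, h K hK, h' K hK, add_zero]

lemma CubeSupp.sub {U : Set (Finset ι)} {c c' : Cube w} (h : CubeSupp U c) (h' : CubeSupp U c') :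
    CubeSupp U (c - c') := fun K hK => by rw [Pi.sub_apply, h K hK, h' K hK, sub_zero]

lemma CubeSupp.smul {U : Set (Finset ι)} {c : Cube w} (h : CubeSupp U c) (a : A) :
    CubeSupp U (a • c) := fun K hK => by rw [Pi.smul_apply, h K hK, smul_zero]

lemma cubeRestr_restr (U V : Set (Finset ι)) (c : Cube w) :
    cubeRestr w U (cubeRestr w V c) = cubeRestr w (U ∩ V) c := by
  funext K
  by_cases hU : K ∈ U <;> by_cases hV : K ∈ V <;> simp [cubeRestr, hU, hV]

/-- `d c` at `J` only depends on `c` at the sets `J \ i`. -/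
lemma cubeD_apply_congr {c c' : Cube w} {J : Finset ι}
    (h : ∀ i ∈ J, c (J.erase i) = c' (J.erase i)) : cubeD w rk c J = cubeD w rk c' J := by
  rw [cubeD_apply, cubeD_apply]
  exact Finset.sum_congr rfl fun i hi => by rw [h i hi]

lemma cubeD_apply_eq_zero {c : Cube w} {J : Finset ι}
    (h : ∀ i ∈ J, c (J.erase i) = 0) : cubeD w rk c J = 0 := by
  rw [cubeD_apply_congr (c' := 0) h, map_zero, Pi.zero_apply]

lemma CubeSupp.cubeD_apply_eq_zero {U : Set (Finset ι)} (hU : U.OrdConnected) {c : Cube w}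
    (hc : CubeSupp U c) {K J : Finset ι} (hK : K ∉ U) (hKJ : K ⊆ J) (hJ : J ∈ U) :
    cubeD w rk c K = 0 :=
  SegreF.cubeD_apply_eq_zero fun i _ => hc _ fun h =>
    hK (hU.out h hJ ⟨K.erase_subset i, hKJ⟩)

lemma cubeD_restr_cubeD_apply {U : Set (Finset ι)} (hU : U.OrdConnected)
    (hrk : Function.Injective rk) {c : Cube w}
    (hc : CubeSupp U c) {J : Finset ι} (hJ : J ∈ U) :
    cubeD w rk (cubeRestr w U (cubeD w rk c)) J = 0 := by
  rw [cubeD_apply_congr (c' := cubeD w rk c), cubeD_cubeD hrk, Pi.zero_apply]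
  intro i _
  by_cases h : J.erase i ∈ U
  · rw [cubeRestr_apply_of_mem h]
  · rw [cubeRestr_apply_of_notMem h, hc.cubeD_apply_eq_zero hU h (J.erase_subset i) hJ]

/-! #### Torsion -/

lemma mem_map_away_iff {s : A} {Q : Type*} [CommRing Q] [Algebra A Q] [IsLocalization.Away s Q]
    {I : Ideal A} {m : Q} {n : ℕ} {a : A} (h : m * algebraMap A Q s ^ n = algebraMap A Q a) :
    m ∈ I.map (algebraMap A Q) ↔ ∃ l : ℕ, s ^ l * a ∈ I := by
  have hu : IsUnit (algebraMap A Q s) := IsLocalization.Away.algebraMap_isUnit s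
  have h1 : m ∈ I.map (algebraMap A Q) ↔ algebraMap A Q a ∈ I.map (algebraMap A Q) := by
    rw [← h]
    exact (Ideal.mul_unit_mem_iff_mem _ (hu.pow n)).symm
  rw [h1, IsLocalization.algebraMap_mem_map_algebraMap_iff (Submonoid.powers s)]
  constructor
  · rintro ⟨_, ⟨l, rfl⟩, hl⟩
    exact ⟨l, hl⟩
  · rintro ⟨l, hl⟩
    exact ⟨_, ⟨l, rfl⟩, hl⟩

lemma exists_cubeRes_eq_smul {K J : Finset ι} (h : K ⊆ J) {i : ι} (hJ : insert i K = J)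
    (m : CubeLoc w J) :
    ∃ n : ℕ, ∀ n' ≥ n, ∃ m₀ : CubeLoc w K, cubeRes w h m₀ = w i ^ n' • m := by
  by_cases hi : i ∈ K
  · obtain rfl : K = J := by rw [← hJ, Finset.insert_eq_of_mem hi]
    exact ⟨0, fun n' _ => ⟨w i ^ n' • m, cubeRes_refl _ _⟩⟩
  have hprod : ∏ l ∈ J, w l = w i * ∏ l ∈ K, w l := by rw [← hJ, Finset.prod_insert hi]
  have hprod' := (congrArg (algebraMap A (CubeLoc w J)) hprod).trans (map_mul _ _ _)
  obtain ⟨n, a, ha⟩ := IsLocalization.Away.surj (∏ l ∈ J, w l) m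
  refine ⟨n, fun n' hn => ?_⟩
  have hu : IsUnit (algebraMap A (CubeLoc w K) (∏ l ∈ K, w l)) :=
    IsLocalization.Away.algebraMap_isUnit _
  have hu' : IsUnit (algebraMap A (CubeLoc w J) (∏ l ∈ K, w l)) := by
    have := hu.map (cubeRes w h)
    rwa [AlgHom.commutes] at this
  obtain ⟨v, hv⟩ := (hu.pow n).exists_right_inv
  refine ⟨w i ^ (n' - n) • (algebraMap A _ a * v), ?_⟩
  apply (hu'.pow n).mul_left_injective
  have hv' : cubeRes w h v * algebraMap A (CubeLoc w J) (∏ l ∈ K, w l) ^ n = 1 := by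
    have := congrArg (cubeRes w h) hv
    rw [map_mul, map_pow, AlgHom.commutes, map_one, mul_comm] at this
    exact this
  simp only [map_smul, map_mul, AlgHom.commutes]
  rw [Algebra.smul_def, mul_assoc, mul_assoc, hv', mul_one, ← ha, hprod', Algebra.smul_def]
  obtain ⟨q, rfl⟩ := Nat.exists_eq_add_of_le hn
  simp only [map_pow, Nat.add_sub_cancel_left]
  ring

lemma exists_smul_mem_of_cubeRes_mem {K J : Finset ι} (h : K ⊆ J) {i : ι} (hJ : insert i K = J)
    {I : Ideal A} {m : CubeLoc w K}
    (hm : cubeRes w h m ∈ I.map (algebraMap A (CubeLoc w J))) :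
    ∃ n : ℕ, ∀ n' ≥ n, w i ^ n' • m ∈ I.map (algebraMap A (CubeLoc w K)) := by
  suffices H : ∃ n : ℕ, w i ^ n • m ∈ I.map (algebraMap A (CubeLoc w K)) by
    obtain ⟨n, hn⟩ := H
    refine ⟨n, fun n' hn' => ?_⟩
    obtain ⟨q, rfl⟩ := Nat.exists_eq_add_of_le hn'
    rw [pow_add, mul_comm, mul_smul]
    exact Submodule.smul_of_tower_mem _ _ hn
  by_cases hi : i ∈ K
  · obtain rfl : K = J := by rw [← hJ, Finset.insert_eq_of_mem hi]
    rw [cubeRes_refl] at hm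
    exact ⟨0, by simpa using hm⟩
  have hprod : ∏ l ∈ J, w l = w i * ∏ l ∈ K, w l := by rw [← hJ, Finset.prod_insert hi]
  have hprod' := (congrArg (algebraMap A (CubeLoc w J)) hprod).trans (map_mul _ _ _)
  obtain ⟨n, a, ha⟩ := IsLocalization.Away.surj (∏ l ∈ K, w l) m
  have h1 : cubeRes w h (m * algebraMap A _ (w i) ^ n) * algebraMap A _ (∏ l ∈ J, w l) ^ n =
      algebraMap A _ (w i ^ n * a * w i ^ n) := by
    have := congrArg (cubeRes w h) ha
    simp only [map_mul, map_pow, AlgHom.commutes] at this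
    rw [hprod']
    simp only [map_mul, map_pow, AlgHom.commutes, mul_pow, ← this]
    ring
  have h2 : cubeRes w h (m * algebraMap A _ (w i) ^ n) ∈ I.map (algebraMap A (CubeLoc w J)) := by
    rw [map_mul]
    exact Ideal.mul_mem_right _ _ hm
  obtain ⟨l, hl⟩ := (mem_map_away_iff h1).1 h2
  refine ⟨n + n + l, ?_⟩
  have h3 : (w i ^ (n + n + l) • m) * algebraMap A (CubeLoc w K) (∏ l ∈ K, w l) ^ n =
      algebraMap A _ (w i ^ (n + n + l) * a) := by
    rw [smul_mul_assoc, ha, Algebra.smul_def, map_mul]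
  rw [mem_map_away_iff h3]
  refine ⟨l, ?_⟩
  convert hl using 1
  rw [hprod]
  ring

/-- A relative cocycle on a family of sets stable under toggling `i` is killed by a power of `w i`
modulo coboundaries. -/
lemma exists_smul_sub_cubeD_mem [Fintype ι] (hrk : Function.Injective rk) {U : Set (Finset ι)}
    (hU : U.OrdConnected) {i : ι} (hi : ∀ K, K ∈ U ↔ insert i K ∈ U) (I : Ideal A)
    {c : Cube w} (hc : CubeSupp U c)
    (hdc : ∀ K ∈ U, cubeD w rk c K ∈ I.map (algebraMap A (CubeLoc w K))) :
    ∃ n : ℕ, ∃ b : Cube w, CubeSupp U b ∧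
      ∀ K ∈ U, w i ^ n • c K - cubeD w rk b K ∈ I.map (algebraMap A (CubeLoc w K)) := by
  classical
  have hi' : ∀ K, i ∈ K → (K.erase i ∈ U ↔ K ∈ U) := fun K h => by
    rw [hi (K.erase i), Finset.insert_erase h]
  -- a common exponent
  choose N hN using fun K : Finset ι =>
    exists_cubeRes_eq_smul (w := w) (Finset.subset_insert i K) rfl (c (insert i K))
  let n := Finset.univ.sup N
  choose m hm using fun K : Finset ι => hN K n (Finset.le_sup (f := N) (Finset.mem_univ K))
  have hm' : ∀ J, i ∈ J →
      cubeRes w (J.erase_subset i) (m (J.erase i)) = w i ^ n • c J := by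
    intro J hJ
    have key : ∀ (K J : Finset ι) (h : K ⊆ J), insert i K = J →
        cubeRes w h (m K) = w i ^ n • c J := by
      rintro K _ h rfl
      exact hm K
    exact key _ _ _ (Finset.insert_erase hJ)
  let b : Cube w := fun K => if i ∉ K ∧ K ∈ U then cubeSign A rk i (insert i K) • m K else 0
  have hb : CubeSupp U b := fun K hK => if_neg fun h => hK h.2
  have hdb : ∀ J ∈ U, i ∈ J → cubeD w rk b J = w i ^ n • c J := by
    intro J hJ hiJ
    rw [cubeD_apply, Finset.sum_eq_single i]
    · have : b (J.erase i) = cubeSign A rk i J • m (J.erase i) := by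
        simp only [b]
        rw [if_pos ⟨Finset.notMem_erase i J, (hi' J hiJ).2 hJ⟩, Finset.insert_erase hiJ]
      rw [this, map_smul, smul_smul, cubeSign_mul_self, one_smul, hm' J hiJ]
    · intro l _ hl
      have : b (J.erase l) = 0 := if_neg fun h => h.1 (Finset.mem_erase.2 ⟨hl.symm, hiJ⟩)
      rw [this, map_zero, smul_zero]
    · exact fun h => absurd hiJ h
  let e : Cube w := cubeRestr w U (w i ^ n • c - cubeD w rk b)
  have he : ∀ J ∈ U, e J = w i ^ n • c J - cubeD w rk b J := fun J hJ =>
    cubeRestr_apply_of_mem hJ _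
  have hei : ∀ J, i ∈ J → e J = 0 := by
    intro J hJ
    by_cases h : J ∈ U
    · rw [he J h, hdb J h hJ, sub_self]
    · exact cubeRestr_apply_of_notMem h _
  have hde : ∀ J ∈ U, cubeD w rk e J = w i ^ n • cubeD w rk c J := by
    intro J hJ
    have h1 : e = w i ^ n • c - cubeRestr w U (cubeD w rk b) := by
      simp only [e]
      rw [map_sub, (hc.smul _).restr_eq]
    rw [h1, map_sub, Pi.sub_apply, cubeD_restr_cubeD_apply hU hrk hb hJ, sub_zero, map_smul,
      Pi.smul_apply]
  have hres : ∀ J ∈ U, i ∉ J → cubeRes w (Finset.subset_insert i J) (e J) ∈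
      I.map (algebraMap A (CubeLoc w (insert i J))) := by
    intro J hJ hiJ
    have hJ' := (hi J).1 hJ
    have h1 := hde _ hJ'
    rw [cubeD_apply, Finset.sum_eq_single i] at h1
    · have h2 : cubeSign A rk i (insert i J) • cubeRes w (Finset.subset_insert i J) (e J) =
          w i ^ n • cubeD w rk c (insert i J) := by
        rw [← h1]
        congr 1
        have key : ∀ (K : Finset ι) (h : K ⊆ insert i J), K = J →
          cubeRes w (Finset.subset_insert i J) (e J) = cubeRes w h (e K) := by
          rintro K h rfl
          rfl
        exact key _ _ (Finset.erase_insert hiJ)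
      have h3 : cubeRes w (Finset.subset_insert i J) (e J) =
          cubeSign A rk i (insert i J) • w i ^ n • cubeD w rk c (insert i J) := by
        rw [← h2, smul_smul, cubeSign_mul_self, one_smul]
      rw [h3]
      exact Submodule.smul_of_tower_mem (I.map (algebraMap A (CubeLoc w (insert i J)))) _
        (Submodule.smul_of_tower_mem _ _ (hdc _ hJ'))
    · intro l _ hl
      rw [hei _ (Finset.mem_erase.2 ⟨hl.symm, Finset.mem_insert_self i J⟩), map_zero, smul_zero]
    · exact fun h => absurd (Finset.mem_insert_self i J) h
  have hex : ∀ J : Finset ι, ∃ l : ℕ, ∀ l' ≥ l, J ∈ U →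
      w i ^ l' • e J ∈ I.map (algebraMap A (CubeLoc w J)) := by
    intro J
    by_cases hJ : J ∈ U
    · by_cases hiJ : i ∈ J
      · exact ⟨0, fun l' _ _ => by rw [hei J hiJ, smul_zero]; exact zero_mem _⟩
      · obtain ⟨l, hl⟩ := exists_smul_mem_of_cubeRes_mem _ rfl (hres J hJ hiJ)
        exact ⟨l, fun l' h _ => hl l' h⟩
    · exact ⟨0, fun _ _ h => absurd h hJ⟩
  choose L hL using hex
  let l := Finset.univ.sup L
  refine ⟨l + n, w i ^ l • b, hb.smul _, fun J hJ => ?_⟩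
  have := hL J l (Finset.le_sup (f := L) (Finset.mem_univ J)) hJ
  rw [he J hJ, smul_sub, smul_smul, ← pow_add] at this
  rw [map_smul, Pi.smul_apply]
  exact this

end Cube

end SegreF

end

end

section
open scoped TensorProduct
noncomputable section

set_option linter.unusedSectionVars false

namespace SegreF

section Cube

variable {A : Type*} [CommRing A] {ι : Type*} [DecidableEq ι]
variable {w : ι → A} {rk : ι → ℕ}

/-! #### Cohomology of families -/

/-- `c` is a cocycle of the Čech complex of the family `U`. -/
def IsCubeCocycle (rk : ι → ℕ) (U : Set (Finset ι)) (c : Cube w) : Prop :=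
  ∀ K ∈ U, cubeD w rk c K = 0

/-- `c` is a coboundary of the Čech complex of the family `U`. -/
def IsCubeCobound (rk : ι → ℕ) (U : Set (Finset ι)) (c : Cube w) : Prop :=
  ∃ b : Cube w, CubeSupp U b ∧ ∀ K ∈ U, cubeD w rk b K = c K

/-- The Čech complex of the family `U` is exact. -/
def IsCubeAcyclic (w : ι → A) (rk : ι → ℕ) (U : Set (Finset ι)) : Prop :=
  ∀ c : Cube w, CubeSupp U c → IsCubeCocycle rk U c → IsCubeCobound rk U c

/-- `U` is the disjoint union of `Q` and `S`, where `S` is closed under supersets in `U`. -/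
structure IsCubeSplit (U Q S : Set (Finset ι)) : Prop where
  ordConnected : U.OrdConnected
  union_eq : Q ∪ S = U
  disjoint : ∀ K ∈ Q, K ∉ S
  upper : ∀ K ∈ S, ∀ L ∈ U, K ⊆ L → L ∈ S

section Split

variable {U Q S : Set (Finset ι)}

lemma IsCubeSplit.left_subset (h : IsCubeSplit U Q S) : Q ⊆ U :=
  h.union_eq ▸ Set.subset_union_left

lemma IsCubeSplit.right_subset (h : IsCubeSplit U Q S) : S ⊆ U :=
  h.union_eq ▸ Set.subset_union_right

lemma IsCubeSplit.ordConnected_left (h : IsCubeSplit U Q S) : Q.OrdConnected := by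
  refine ⟨fun K hK L hL M hM => ?_⟩
  have hMU := h.ordConnected.out (h.left_subset hK) (h.left_subset hL) hM
  rw [← h.union_eq] at hMU
  rcases hMU with h' | h'
  · exact h'
  · exact absurd (h.upper M h' L (h.left_subset hL) hM.2) (h.disjoint L hL)

lemma IsCubeSplit.ordConnected_right (h : IsCubeSplit U Q S) : S.OrdConnected :=
  ⟨fun K hK _ hL _ hM => h.upper K hK _
    (h.ordConnected.out (h.right_subset hK) (h.right_subset hL) hM) hM.1⟩

/-- A cochain supported on `S` has zero differential on `Q`. -/
lemma IsCubeSplit.cubeD_apply_eq_zero (h : IsCubeSplit U Q S) {b : Cube w} (hb : CubeSupp S b)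
    {K : Finset ι} (hK : K ∈ Q) : cubeD w rk b K = 0 :=
  SegreF.cubeD_apply_eq_zero fun i _ => hb _ fun hS =>
    h.disjoint K hK (h.upper _ hS K (h.left_subset hK) (K.erase_subset i))

lemma IsCubeSplit.restr_add_restr (h : IsCubeSplit U Q S) (c : Cube w) :
    cubeRestr w Q c + cubeRestr w S c = cubeRestr w U c := by
  funext K
  rw [Pi.add_apply]
  by_cases hQ : K ∈ Q
  · rw [cubeRestr_apply_of_mem hQ, cubeRestr_apply_of_notMem (h.disjoint K hQ),
      cubeRestr_apply_of_mem (h.left_subset hQ), add_zero]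
  · rw [cubeRestr_apply_of_notMem hQ, zero_add]
    by_cases hS : K ∈ S
    · rw [cubeRestr_apply_of_mem hS, cubeRestr_apply_of_mem (h.right_subset hS)]
    · rw [cubeRestr_apply_of_notMem hS, cubeRestr_apply_of_notMem]
      rw [← h.union_eq]
      exact fun h' => h'.elim hQ hS

/-- The connecting map from the cohomology of `Q` to that of `S`. -/
lemma IsCubeSplit.isCubeCocycle_conn (h : IsCubeSplit U Q S) (hrk : Function.Injective rk)
    {u : Cube w} (hu : CubeSupp Q u) (hu' : IsCubeCocycle rk Q u) :
    IsCubeCocycle rk S (cubeRestr w S (cubeD w rk u)) := by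
  intro K hK
  have h1 : cubeRestr w S (cubeD w rk u) = cubeRestr w U (cubeD w rk u) := by
    rw [← h.restr_add_restr]
    refine (add_eq_right.2 ?_).symm
    funext L
    by_cases hL : L ∈ Q
    · rw [cubeRestr_apply_of_mem hL, hu' L hL, Pi.zero_apply]
    · rw [cubeRestr_apply_of_notMem hL, Pi.zero_apply]
  rw [h1]
  exact cubeD_restr_cubeD_apply h.ordConnected hrk (hu.mono h.left_subset) (h.right_subset hK)

lemma IsCubeSplit.isCubeCobound_of_conn (h : IsCubeSplit U Q S) (hac : IsCubeAcyclic w rk U)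
    {u : Cube w} (hu : CubeSupp Q u) (hu' : IsCubeCocycle rk Q u)
    (hc : IsCubeCobound rk S (cubeRestr w S (cubeD w rk u))) : IsCubeCobound rk Q u := by
  obtain ⟨b, hb, hdb⟩ := hc
  obtain ⟨e, he, hde⟩ := hac (u - b) ((hu.mono h.left_subset).sub (hb.mono h.right_subset)) (by
    intro K hK
    rw [map_sub, Pi.sub_apply]
    rw [← h.union_eq] at hK
    rcases hK with hK | hK
    · rw [hu' K hK, h.cubeD_apply_eq_zero hb hK, sub_zero]
    · rw [hdb K hK, cubeRestr_apply_of_mem hK, sub_self])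
  refine ⟨cubeRestr w Q e, cubeSupp_restr Q e, fun K hK => ?_⟩
  have h1 := hde K (h.left_subset hK)
  rw [Pi.sub_apply, hb K (h.disjoint K hK), sub_zero] at h1
  rw [← h1]
  conv_rhs => rw [← he.restr_eq, ← h.restr_add_restr, map_add, Pi.add_apply,
    h.cubeD_apply_eq_zero (cubeSupp_restr S e) hK, add_zero]

lemma IsCubeSplit.exists_conn (h : IsCubeSplit U Q S) (hac : IsCubeAcyclic w rk U)
    {v : Cube w} (hv : CubeSupp S v) (hv' : IsCubeCocycle rk S v) :
    ∃ u : Cube w, CubeSupp Q u ∧ IsCubeCocycle rk Q u ∧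
      IsCubeCobound rk S (v - cubeRestr w S (cubeD w rk u)) := by
  obtain ⟨e, he, hde⟩ := hac v (hv.mono h.right_subset) (by
    intro K hK
    rw [← h.union_eq] at hK
    rcases hK with hK | hK
    · exact h.cubeD_apply_eq_zero hv hK
    · exact hv' K hK)
  refine ⟨cubeRestr w Q e, cubeSupp_restr Q e, fun K hK => ?_, cubeRestr w S e,
    cubeSupp_restr S e, fun K hK => ?_⟩
  · have h1 := hde K (h.left_subset hK)
    rwa [hv K (h.disjoint K hK), ← he.restr_eq, ← h.restr_add_restr, map_add, Pi.add_apply,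
      h.cubeD_apply_eq_zero (cubeSupp_restr S e) hK, add_zero] at h1
  · have h1 : cubeD w rk e K =
        cubeD w rk (cubeRestr w Q e) K + cubeD w rk (cubeRestr w S e) K := by
      conv_lhs => rw [← he.restr_eq, ← h.restr_add_restr, map_add, Pi.add_apply]
    rw [Pi.sub_apply, cubeRestr_apply_of_mem hK, ← hde K (h.right_subset hK), h1,
      add_sub_cancel_left]

lemma IsCubeSplit.isCubeCobound_conn (h : IsCubeSplit U Q S) (hrk : Function.Injective rk)
    {u : Cube w} (hu : CubeSupp Q u) (hc : IsCubeCobound rk Q u) :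
    IsCubeCobound rk S (cubeRestr w S (cubeD w rk u)) := by
  obtain ⟨b, hb, hdb⟩ := hc
  refine ⟨- cubeRestr w S (cubeD w rk b), ?_, fun K hK => ?_⟩
  · rw [← neg_one_smul A]
    exact (cubeSupp_restr _ _).smul _
  have h1 : cubeRestr w Q (cubeD w rk b) = u := by
    funext K
    by_cases hQ : K ∈ Q
    · rw [cubeRestr_apply_of_mem hQ, hdb K hQ]
    · rw [cubeRestr_apply_of_notMem hQ, hu K hQ]
  have h2 := cubeD_restr_cubeD_apply h.ordConnected hrk (hb.mono h.left_subset)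
    (h.right_subset hK)
  rw [← h.restr_add_restr, h1, map_add, Pi.add_apply] at h2
  rw [map_neg, Pi.neg_apply, cubeRestr_apply_of_mem hK]
  exact (eq_neg_of_add_eq_zero_left h2).symm

/-- An extension of exact families is exact. -/
lemma IsCubeSplit.isCubeAcyclic (h : IsCubeSplit U Q S) (hrk : Function.Injective rk)
    (hQ : IsCubeAcyclic w rk Q) (hS : IsCubeAcyclic w rk S) : IsCubeAcyclic w rk U := by
  intro c hc hc'
  obtain ⟨b, hb, hdb⟩ := hQ (cubeRestr w Q c) (cubeSupp_restr _ _) (by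
    intro K hK
    have := hc' K (h.left_subset hK)
    rwa [← hc.restr_eq, ← h.restr_add_restr, map_add, Pi.add_apply,
      h.cubeD_apply_eq_zero (cubeSupp_restr S c) hK, add_zero] at this)
  have hdb' : ∀ K ∈ Q, cubeD w rk b K = c K := fun K hK => by
    rw [hdb K hK, cubeRestr_apply_of_mem hK]
  have hbU := hb.mono h.left_subset
  let c₁ := c - cubeRestr w U (cubeD w rk b)
  have hc₁ : CubeSupp S c₁ := by
    intro K hK
    simp only [c₁, Pi.sub_apply]
    by_cases hKQ : K ∈ Q
    · rw [cubeRestr_apply_of_mem (h.left_subset hKQ), hdb' K hKQ, sub_self]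
    · have hKU : K ∉ U := by
        rw [← h.union_eq]
        exact fun h' => h'.elim hKQ hK
      rw [cubeRestr_apply_of_notMem hKU, hc K hKU, sub_self]
  obtain ⟨b₁, hb₁, hdb₁⟩ := hS c₁ hc₁ (by
    intro K hK
    simp only [c₁]
    rw [map_sub, Pi.sub_apply, hc' K (h.right_subset hK),
      cubeD_restr_cubeD_apply h.ordConnected hrk hbU (h.right_subset hK), sub_zero])
  refine ⟨b + b₁, hbU.add (hb₁.mono h.right_subset), fun K hK => ?_⟩
  rw [map_add, Pi.add_apply]
  have hK' := hK
  rw [← h.union_eq] at hK'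
  rcases hK' with hK' | hK'
  · rw [h.cubeD_apply_eq_zero hb₁ hK', add_zero, hdb' K hK']
  · rw [hdb₁ K hK']
    simp only [c₁, Pi.sub_apply]
    rw [cubeRestr_apply_of_mem hK]
    abel

end Split

/-- A family is exact if it is a product of a subset of the power set of `ι \ X` and the power set
of `X`, and the elements indexed by `X` generate the unit ideal in all the localizations. -/
lemma isCubeAcyclic_of_mem_radical [Fintype ι] (hrk : Function.Injective rk) (X : Finset ι)
    {U : Set (Finset ι)} (hU : U.OrdConnected) (hX : ∀ i ∈ X, ∀ K, K ∈ U ↔ insert i K ∈ U)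
    (hrad : ∀ K ∈ U, ∏ i ∈ K \ X, w i ∈ (Ideal.span (w '' X)).radical) :
    IsCubeAcyclic w rk U := by
  suffices H : ∀ (P : Finset ι) (U : Set (Finset ι)), U.OrdConnected →
      (∀ i ∈ X, ∀ K, K ∈ U ↔ insert i K ∈ U) →
      (∀ K ∈ U, ∏ i ∈ K \ X, w i ∈ (Ideal.span (w '' X)).radical) →
      (∀ K ∈ U, ∀ L ∈ U, ∀ q, q ∉ X → q ∉ P → (q ∈ K ↔ q ∈ L)) → IsCubeAcyclic w rk U from
    H Finset.univ U hU hX hrad fun K _ L _ q _ hq => absurd (Finset.mem_univ q) hq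
  intro P
  induction P using Finset.induction_on with
  | empty =>
    intro U hU hX hrad hag c hc hc'
    rcases U.eq_empty_or_nonempty with rfl | ⟨K₁, hK₁⟩
    · exact ⟨0, fun _ _ => rfl, fun K hK => absurd hK (Set.notMem_empty K)⟩
    set s := ∏ i ∈ K₁ \ X, w i with hs
    have hu : ∀ K ∈ U, IsUnit (algebraMap A (CubeLoc w K) s) := by
      intro K hK
      refine isUnit_of_dvd_unit (map_dvd _ (Finset.prod_dvd_prod_of_subset _ _ w ?_))
        (IsLocalization.Away.algebraMap_isUnit (∏ i ∈ K, w i))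
      intro q hq
      rw [Finset.mem_sdiff] at hq
      exact (hag K₁ hK₁ K hK q hq.2 (Finset.notMem_empty q)).1 hq.1
    let 𝔞 : Ideal A :=
      { carrier := {a | ∃ b : Cube w, CubeSupp U b ∧ ∀ K ∈ U, cubeD w rk b K = a • c K}
        add_mem' := by
          rintro a a' ⟨b, hb, h⟩ ⟨b', hb', h'⟩
          exact ⟨b + b', hb.add hb', fun K hK => by
            rw [map_add, Pi.add_apply, h K hK, h' K hK, add_smul]⟩
        zero_mem' := ⟨0, fun _ _ => rfl, fun K _ => by simp⟩
        smul_mem' := by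
          rintro a a' ⟨b, hb, h⟩
          exact ⟨a • b, hb.smul a, fun K hK => by
            rw [map_smul, Pi.smul_apply, h K hK, smul_eq_mul, mul_smul]⟩ }
    have h1 : ∀ i ∈ X, w i ∈ 𝔞.radical := by
      intro i hi
      obtain ⟨n, b, hb, h⟩ := exists_smul_sub_cubeD_mem hrk hU (hX i hi) ⊥ hc (fun K hK => by
        rw [hc' K hK]; exact zero_mem _)
      refine ⟨n, b, hb, fun K hK => ?_⟩
      have := h K hK
      rw [Ideal.map_bot, Ideal.mem_bot] at this
      exact (sub_eq_zero.1 this).symm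
    have h2 : s ∈ 𝔞.radical := by
      have h3 : Ideal.span (w '' X) ≤ 𝔞.radical := by
        rw [Ideal.span_le]
        rintro _ ⟨i, hi, rfl⟩
        exact h1 i hi
      have := Ideal.radical_mono h3 (hrad K₁ hK₁)
      rwa [Ideal.radical_idem] at this
    obtain ⟨M, b, hb, h⟩ := h2
    have h4 : ∀ K : Finset ι, ∃ m : CubeLoc w K, K ∉ U ∧ m = 0 ∨ K ∈ U ∧ s ^ M • m = b K := by
      intro K
      by_cases hK : K ∈ U
      · obtain ⟨v, hv⟩ := ((hu K hK).pow M).exists_right_inv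
        refine ⟨v * b K, Or.inr ⟨hK, ?_⟩⟩
        rw [Algebra.smul_def, map_pow, ← mul_assoc, hv, one_mul]
      · exact ⟨0, Or.inl ⟨hK, rfl⟩⟩
    choose b' hb' using h4
    have hb's : CubeSupp U b' := fun K hK => by
      rcases hb' K with h | h
      · exact h.2
      · exact absurd h.1 hK
    have hb'b : s ^ M • b' = b := by
      funext K
      rcases hb' K with h | h
      · rw [Pi.smul_apply, h.2, smul_zero, hb K h.1]
      · exact h.2
    refine ⟨b', hb's, fun K hK => ?_⟩
    have h5 := h K hK
    rw [← hb'b, map_smul, Pi.smul_apply, Algebra.smul_def, Algebra.smul_def, map_pow] at h5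
    exact ((hu K hK).pow M).mul_left_cancel h5
  | insert p P _ ih =>
    intro U hU hX hrad hag
    by_cases hp : p ∈ X
    · refine ih U hU hX hrad fun K hK L hL q hq hqP => hag K hK L hL q hq ?_
      rw [Finset.mem_insert]
      rintro (rfl | h)
      · exact hq hp
      · exact hqP h
    have hsplit : IsCubeSplit U (U ∩ {K | p ∉ K}) (U ∩ {K | p ∈ K}) :=
      ⟨hU, by ext K; by_cases h : p ∈ K <;> simp [h], fun K hK hK' => hK.2 hK'.2,
        fun K hK L hL hKL => ⟨hL, hKL hK.2⟩⟩
    have hne : ∀ i ∈ X, p ≠ i := fun i hi h => hp (h ▸ hi)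
    refine hsplit.isCubeAcyclic hrk (ih _ hsplit.ordConnected_left ?_ ?_ ?_)
      (ih _ hsplit.ordConnected_right ?_ ?_ ?_)
    · intro i hi K
      simp [← hX i hi K, hne i hi]
    · exact fun K hK => hrad K hK.1
    · intro K hK L hL q hq hqP
      by_cases hqp : q = p
      · subst hqp
        exact iff_of_false hK.2 hL.2
      · exact hag K hK.1 L hL.1 q hq (by simp [hqp, hqP])
    · intro i hi K
      simp [← hX i hi K, hne i hi]
    · exact fun K hK => hrad K hK.1
    · intro K hK L hL q hq hqP
      by_cases hqp : q = p
      · subst hqp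
        exact iff_of_true hK.2 hL.2
      · exact hag K hK.1 L hL.1 q hq (by simp [hqp, hqP])

/-! #### Natural operators and degrees -/

/-- A family of additive endomorphisms of the localizations which commutes with the localization
maps. -/
structure CubeOp (w : ι → A) where
  /-- the components -/
  app : ∀ K : Finset ι, CubeLoc w K →+ CubeLoc w K
  res : ∀ {I J : Finset ι} (h : I ⊆ J) (m : CubeLoc w I),
    app J (cubeRes w h m) = cubeRes w h (app I m)

/-- The action of a natural operator on cochains. -/
def CubeOp.map (φ : CubeOp w) (c : Cube w) : Cube w := fun K => φ.app K (c K)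

lemma map_neg_one_pow_smul {A' M N : Type*} [CommRing A'] [AddCommGroup M] [AddCommGroup N]
    [Module A M] [Module A' N] (φ : M →+ N) (n : ℕ) (m : M) :
    φ ((-1 : A) ^ n • m) = (-1 : A') ^ n • φ m := by
  rcases neg_one_pow_eq_or ℤ n with h | h
  · have h1 : (-1 : A) ^ n = 1 := by exact_mod_cast congrArg (Int.cast : ℤ → A) h
    have h2 : (-1 : A') ^ n = 1 := by exact_mod_cast congrArg (Int.cast : ℤ → A') h
    rw [h1, h2, one_smul, one_smul]
  · have h1 : (-1 : A) ^ n = -1 := by exact_mod_cast congrArg (Int.cast : ℤ → A) h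
    have h2 : (-1 : A') ^ n = -1 := by exact_mod_cast congrArg (Int.cast : ℤ → A') h
    rw [h1, h2, neg_one_smul, neg_one_smul, map_neg]

lemma CubeOp.map_cubeD (φ : CubeOp w) (c : Cube w) :
    φ.map (cubeD w rk c) = cubeD w rk (φ.map c) := by
  funext J
  rw [CubeOp.map, cubeD_apply, cubeD_apply, map_sum]
  refine Finset.sum_congr rfl fun i _ => ?_
  rw [cubeSign, map_neg_one_pow_smul (A' := A), φ.res]
  rfl

lemma CubeOp.map_add (φ : CubeOp w) (c c' : Cube w) : φ.map (c + c') = φ.map c + φ.map c' :=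
  funext fun _ => (φ.app _).map_add _ _

lemma CubeOp.map_sub (φ : CubeOp w) (c c' : Cube w) : φ.map (c - c') = φ.map c - φ.map c' :=
  funext fun _ => (φ.app _).map_sub _ _

lemma CubeOp.map_zero (φ : CubeOp w) : φ.map 0 = 0 := funext fun _ => (φ.app _).map_zero

lemma CubeOp.map_restr (φ : CubeOp w) (U : Set (Finset ι)) (c : Cube w) :
    φ.map (cubeRestr w U c) = cubeRestr w U (φ.map c) := by
  funext K
  by_cases h : K ∈ U
  · rw [CubeOp.map, cubeRestr_apply_of_mem h, cubeRestr_apply_of_mem h, CubeOp.map]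
  · rw [CubeOp.map, cubeRestr_apply_of_notMem h, cubeRestr_apply_of_notMem h, AddMonoidHom.map_zero]

lemma CubeSupp.map (φ : CubeOp w) {U : Set (Finset ι)} {c : Cube w} (h : CubeSupp U c) :
    CubeSupp U (φ.map c) := fun K hK => by rw [CubeOp.map, h K hK, AddMonoidHom.map_zero]

lemma IsCubeCocycle.map (φ : CubeOp w) {U : Set (Finset ι)} {c : Cube w}
    (h : IsCubeCocycle rk U c) : IsCubeCocycle rk U (φ.map c) := fun K hK => by
  rw [← φ.map_cubeD, CubeOp.map, h K hK, AddMonoidHom.map_zero]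

lemma IsCubeCobound.map (φ : CubeOp w) {U : Set (Finset ι)} {c : Cube w}
    (h : IsCubeCobound rk U c) : IsCubeCobound rk U (φ.map c) := by
  obtain ⟨b, hb, hdb⟩ := h
  exact ⟨φ.map b, hb.map φ, fun K hK => by
    rw [← φ.map_cubeD, CubeOp.map, hdb K hK, CubeOp.map]⟩

lemma IsCubeCobound.add {U : Set (Finset ι)} {c c' : Cube w}
    (h : IsCubeCobound rk U c) (h' : IsCubeCobound rk U c') : IsCubeCobound rk U (c + c') := by
  obtain ⟨b, hb, hdb⟩ := h
  obtain ⟨b', hb', hdb'⟩ := h'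
  exact ⟨b + b', hb.add hb', fun K hK => by
    rw [_root_.map_add, Pi.add_apply, hdb K hK, hdb' K hK, Pi.add_apply]⟩

lemma IsCubeCobound.neg {U : Set (Finset ι)} {c : Cube w}
    (h : IsCubeCobound rk U c) : IsCubeCobound rk U (-c) := by
  obtain ⟨b, hb, hdb⟩ := h
  refine ⟨-b, fun K hK => by rw [Pi.neg_apply, hb K hK, neg_zero], fun K hK => by
    rw [map_neg, Pi.neg_apply, hdb K hK, Pi.neg_apply]⟩

lemma IsCubeCobound.sub {U : Set (Finset ι)} {c c' : Cube w}
    (h : IsCubeCobound rk U c) (h' : IsCubeCobound rk U c') : IsCubeCobound rk U (c - c') := by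
  rw [sub_eq_add_neg]
  exact h.add h'.neg

/-- The sets with `j` elements. -/
def cardSet (ι : Type*) (j : ℕ) : Set (Finset ι) := {K | K.card = j}

lemma cubeRestr_cubeD_card (j : ℕ) (c : Cube w) :
    cubeRestr w (cardSet ι (j + 1)) (cubeD w rk c) =
      cubeD w rk (cubeRestr w (cardSet ι j) c) := by
  funext K
  by_cases h : K ∈ cardSet ι (j + 1)
  · rw [cubeRestr_apply_of_mem h]
    refine cubeD_apply_congr fun i hi => (cubeRestr_apply_of_mem ?_ c).symm
    change (K.erase i).card = j
    rw [Finset.card_erase_of_mem hi, show K.card = j + 1 from h, Nat.add_sub_cancel]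
  · rw [cubeRestr_apply_of_notMem h]
    refine (cubeD_apply_eq_zero fun i hi => cubeRestr_apply_of_notMem (fun h' => h ?_) c).symm
    have : (K.erase i).card = j := h'
    rw [Finset.card_erase_of_mem hi] at this
    have := Finset.card_pos.2 ⟨i, hi⟩
    change K.card = j + 1
    omega

lemma CubeSupp.cubeD_card {j : ℕ} {c : Cube w} (hc : CubeSupp (cardSet ι j) c) :
    CubeSupp (cardSet ι (j + 1)) (cubeD w rk c) := by
  rw [← hc.restr_eq, ← cubeRestr_cubeD_card]
  exact cubeSupp_restr _ _

lemma IsCubeCobound.card {U : Set (Finset ι)} {j : ℕ} {c : Cube w}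
    (h : IsCubeCobound rk U c) (hc : CubeSupp (cardSet ι (j + 1)) c) :
    ∃ b : Cube w, CubeSupp (cardSet ι j) b ∧ CubeSupp U b ∧ ∀ K ∈ U, cubeD w rk b K = c K := by
  obtain ⟨b, hb, hdb⟩ := h
  refine ⟨cubeRestr w (cardSet ι j) b, cubeSupp_restr _ _, fun K hK => ?_, fun K hK => ?_⟩
  · by_cases h : K ∈ cardSet ι j
    · rw [cubeRestr_apply_of_mem h, hb K hK]
    · rw [cubeRestr_apply_of_notMem h]
  · rw [← cubeRestr_cubeD_card]
    by_cases h : K ∈ cardSet ι (j + 1)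
    · rw [cubeRestr_apply_of_mem h, hdb K hK]
    · rw [cubeRestr_apply_of_notMem h, hc K h]

end Cube

end SegreF

end

end

section
open scoped TensorProduct
noncomputable section

set_option linter.unusedSectionVars false

namespace SegreF

open scoped LaurentPolynomial

/-! ### Gradings as coactions -/

section Coaction

variable {A : Type*} [CommRing A]

/-- The elements of degree `n` for the coaction `ρ` of the multiplicative group. -/
def homog (ρ : A →+* A[T;T⁻¹]) (n : ℤ) : AddSubgroup A where
  carrier := {a | ρ a = AddMonoidAlgebra.single n a}
  add_mem' {a b} ha hb := by
    change ρ _ = _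
    rw [map_add, show ρ a = _ from ha, show ρ b = _ from hb, AddMonoidAlgebra.single_add]
  zero_mem' := by simp
  neg_mem' {a} ha := by
    change ρ _ = _
    rw [map_neg, show ρ a = _ from ha, AddMonoidAlgebra.single_neg]

lemma mem_homog {ρ : A →+* A[T;T⁻¹]} {n : ℤ} {a : A} :
    a ∈ homog ρ n ↔ ρ a = AddMonoidAlgebra.single n a := Iff.rfl

/-- Every element is a sum of homogeneous elements. -/
def IsGradedBy (ρ : A →+* A[T;T⁻¹]) : Prop := ∀ a, a ∈ ⨆ n, homog ρ n

/-- The component of degree `n`. -/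
def homogProj (ρ : A →+* A[T;T⁻¹]) (n : ℤ) : A →+ A where
  toFun a := (ρ a).coeff n
  map_zero' := by simp
  map_add' a b := by simp

variable {ρ : A →+* A[T;T⁻¹]}

lemma homogProj_apply (n : ℤ) (a : A) : homogProj ρ n a = (ρ a).coeff n := rfl

lemma homogProj_of_mem {m n : ℤ} {a : A} (ha : a ∈ homog ρ m) :
    homogProj ρ n a = if m = n then a else 0 := by
  classical
  rw [homogProj_apply, mem_homog.1 ha, AddMonoidAlgebra.coeff_single, Finsupp.single_apply]

lemma IsGradedBy.induction_on (hρ : IsGradedBy ρ) {P : A → Prop} (a : A)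
    (h : ∀ n, ∀ a ∈ homog ρ n, P a) (hadd : ∀ a b, P a → P b → P (a + b)) : P a :=
  AddSubgroup.iSup_induction (C := P) _ (hρ a) h (h 0 0 (zero_mem _)) hadd

lemma IsGradedBy.homogProj_mem (hρ : IsGradedBy ρ) (n : ℤ) (a : A) :
    homogProj ρ n a ∈ homog ρ n := by
  induction a using hρ.induction_on with
  | h m a ha =>
    rw [homogProj_of_mem ha]
    split_ifs with h
    · exact h ▸ ha
    · exact zero_mem _
  | hadd a b ha hb => rw [map_add]; exact add_mem ha hb

lemma IsGradedBy.exists_sum_eq (hρ : IsGradedBy ρ) (a : A) :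
    ∃ s : Finset ℤ, ∀ s' ⊇ s, a = ∑ n ∈ s', homogProj ρ n a := by
  classical
  induction a using hρ.induction_on with
  | h m a ha =>
    refine ⟨{m}, fun s' hs => ?_⟩
    simp_rw [homogProj_of_mem ha]
    rw [Finset.sum_ite_eq, if_pos (hs (Finset.mem_singleton_self m))]
  | hadd a b ha hb =>
    obtain ⟨s, hs⟩ := ha
    obtain ⟨t, ht⟩ := hb
    refine ⟨s ∪ t, fun s' h => ?_⟩
    simp_rw [map_add]
    rw [Finset.sum_add_distrib, ← hs _ (Finset.union_subset_left h),
      ← ht _ (Finset.union_subset_right h)]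

lemma homog_mul_mem {m n : ℤ} {a b : A} (ha : a ∈ homog ρ m) (hb : b ∈ homog ρ n) :
    a * b ∈ homog ρ (m + n) := by
  rw [mem_homog] at *
  rw [map_mul, ha, hb, AddMonoidAlgebra.single_mul_single]

lemma one_mem_homog : (1 : A) ∈ homog ρ 0 := by
  rw [mem_homog, map_one]; rfl

lemma homog_pow_mem {m : ℤ} {a : A} (ha : a ∈ homog ρ m) (n : ℕ) :
    a ^ n ∈ homog ρ (n * m) := by
  induction n with
  | zero => simpa using one_mem_homog
  | succ n ih =>
    rw [pow_succ]
    convert homog_mul_mem ih ha using 2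
    push_cast; ring

lemma homog_prod_mem {ι : Type*} {w : ι → A} {δ : ι → ℤ} (hw : ∀ i, w i ∈ homog ρ (δ i))
    (K : Finset ι) : ∏ i ∈ K, w i ∈ homog ρ (∑ i ∈ K, δ i) := by
  classical
  induction K using Finset.induction_on with
  | empty => simpa using one_mem_homog
  | insert i K hi ih =>
    rw [Finset.prod_insert hi, Finset.sum_insert hi]
    exact homog_mul_mem (hw i) ih

lemma homog_inv_mem {m : ℤ} {s v : A} (hs : s ∈ homog ρ m) (hsv : s * v = 1) :
    v ∈ homog ρ (-m) := by
  rw [mem_homog] at *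
  have h1 : AddMonoidAlgebra.single m s * ρ v = 1 := by rw [← hs, ← map_mul, hsv, map_one]
  have h2 : AddMonoidAlgebra.single (-m) v * AddMonoidAlgebra.single m s = (1 : A[T;T⁻¹]) := by
    rw [AddMonoidAlgebra.single_mul_single, mul_comm v, hsv, neg_add_cancel]; rfl
  calc ρ v = AddMonoidAlgebra.single (-m) v * AddMonoidAlgebra.single m s * ρ v := by
        rw [h2, one_mul]
    _ = _ := by rw [mul_assoc, h1, mul_one]

variable {A' : Type*} [CommRing A'] {ρ' : A' →+* A'[T;T⁻¹]}

lemma homogProj_map {f : A →+* A'} (hf : (AddMonoidAlgebra.mapRingHom ℤ f).comp ρ = ρ'.comp f)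
    (n : ℤ) (a : A) : homogProj ρ' n (f a) = f (homogProj ρ n a) := by
  rw [homogProj_apply, homogProj_apply, ← AddMonoidAlgebra.coeff_mapRingHom]
  exact congrArg (fun b => AddMonoidAlgebra.coeff b n) (DFunLike.congr_fun hf a).symm

lemma map_mem_homog {f : A →+* A'} (hf : (AddMonoidAlgebra.mapRingHom ℤ f).comp ρ = ρ'.comp f)
    {n : ℤ} {a : A} (ha : a ∈ homog ρ n) : f a ∈ homog ρ' n := by
  rw [mem_homog]
  refine (DFunLike.congr_fun hf a).symm.trans ?_
  rw [RingHom.comp_apply, mem_homog.1 ha, AddMonoidAlgebra.mapRingHom_single]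

/-- The extension of a coaction to the localization at a homogeneous element. -/
def locCoaction (ρ : A →+* A[T;T⁻¹]) {s : A} {m : ℤ} (hs : s ∈ homog ρ m) :
    Localization.Away s →+* (Localization.Away s)[T;T⁻¹] :=
  IsLocalization.Away.lift s
    (g := (AddMonoidAlgebra.mapRingHom ℤ (algebraMap A (Localization.Away s))).comp ρ) (by
      rw [RingHom.comp_apply, mem_homog.1 hs, AddMonoidAlgebra.mapRingHom_single]
      obtain ⟨v, hv⟩ := (IsLocalization.Away.algebraMap_isUnit
        (S := Localization.Away s) s).exists_right_inv
      refine IsUnit.of_mul_eq_one (AddMonoidAlgebra.single (-m) v) ?_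
      rw [AddMonoidAlgebra.single_mul_single, hv, add_neg_cancel]
      rfl)

lemma locCoaction_comp {s : A} {m : ℤ} (hs : s ∈ homog ρ m) :
    (AddMonoidAlgebra.mapRingHom ℤ (algebraMap A (Localization.Away s))).comp ρ =
      (locCoaction ρ hs).comp (algebraMap A (Localization.Away s)) :=
  (IsLocalization.Away.lift_comp s _).symm

lemma mem_homog_locCoaction {s : A} {m : ℤ} (hs : s ∈ homog ρ m) {ξ : Localization.Away s}
    {N : ℕ} {a : A} (h : ξ * algebraMap A _ s ^ N = algebraMap A _ a) {n : ℤ}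
    (ha : a ∈ homog ρ (n + N * m)) : ξ ∈ homog (locCoaction ρ hs) n := by
  have h1 := homog_pow_mem (map_mem_homog (locCoaction_comp hs) hs) N
  have h2 := map_mem_homog (locCoaction_comp hs) ha
  obtain ⟨v, hv⟩ := ((IsLocalization.Away.algebraMap_isUnit
    (S := Localization.Away s) s).pow N).exists_right_inv
  have h3 : ξ = algebraMap A _ a * v := by rw [← h, mul_assoc, hv, mul_one]
  rw [h3]
  convert homog_mul_mem h2 (homog_inv_mem h1 hv) using 2
  ring

lemma exists_of_mem_homog_locCoaction (hρ : IsGradedBy ρ) {s : A} {m : ℤ} (hs : s ∈ homog ρ m)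
    {ξ : Localization.Away s} {n : ℤ} (hξ : ξ ∈ homog (locCoaction ρ hs) n) :
    ∃ (N : ℕ) (a : A), a ∈ homog ρ (n + N * m) ∧
      ξ * algebraMap A _ s ^ N = algebraMap A _ a := by
  obtain ⟨N, a, ha⟩ := IsLocalization.Away.surj s ξ
  refine ⟨N, homogProj ρ (n + N * m) a, hρ.homogProj_mem _ _, ?_⟩
  rw [← homogProj_map (locCoaction_comp hs), ← ha]
  have h1 := homog_pow_mem (map_mem_homog (locCoaction_comp hs) hs) N
  rw [homogProj_of_mem (homog_mul_mem hξ h1), if_pos rfl]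

lemma IsGradedBy.locCoaction (hρ : IsGradedBy ρ) {s : A} {m : ℤ} (hs : s ∈ homog ρ m) :
    IsGradedBy (locCoaction ρ hs) := by
  intro ξ
  obtain ⟨N, a, ha⟩ := IsLocalization.Away.surj s ξ
  have h1 := homog_pow_mem (map_mem_homog (locCoaction_comp hs) hs) N
  obtain ⟨v, hv⟩ := ((IsLocalization.Away.algebraMap_isUnit
    (S := Localization.Away s) s).pow N).exists_right_inv
  have h3 : ξ = algebraMap A _ a * v := by rw [← ha, mul_assoc, hv, mul_one]
  rw [h3]
  clear h3 ha
  induction a using hρ.induction_on with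
  | h n a ha =>
    exact AddSubgroup.mem_iSup_of_mem _ (homog_mul_mem (map_mem_homog (locCoaction_comp hs) ha)
      (homog_inv_mem h1 hv))
  | hadd a b ha hb => rw [map_add, add_mul]; exact add_mem ha hb

lemma locCoaction_naturality {s : A} {m : ℤ} (hs : s ∈ homog ρ m) {s' : A'} {m' : ℤ}
    (hs' : s' ∈ homog ρ' m') {f : A →+* A'}
    (hf : (AddMonoidAlgebra.mapRingHom ℤ f).comp ρ = ρ'.comp f)
    {g : Localization.Away s →+* Localization.Away s'}
    (hg : g.comp (algebraMap A _) = (algebraMap A' _).comp f) :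
    (AddMonoidAlgebra.mapRingHom ℤ g).comp (locCoaction ρ hs) = (locCoaction ρ' hs').comp g := by
  refine IsLocalization.ringHom_ext (Submonoid.powers s) ?_
  ext1 a
  have h1 := DFunLike.congr_fun (locCoaction_comp hs) a
  have h2 := DFunLike.congr_fun (locCoaction_comp hs') (f a)
  have h3 := DFunLike.congr_fun hf a
  have h4 := DFunLike.congr_fun hg a
  simp only [RingHom.comp_apply] at h1 h2 h3 h4 ⊢
  rw [h4, ← h1, ← h2, ← h3, ← RingHom.comp_apply (AddMonoidAlgebra.mapRingHom ℤ g),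
    ← RingHom.comp_apply (AddMonoidAlgebra.mapRingHom ℤ (algebraMap A' _)),
    ← AddMonoidAlgebra.mapRingHom_comp, ← AddMonoidAlgebra.mapRingHom_comp, hg]

section Cube

variable {ι : Type*} [DecidableEq ι] {w : ι → A} {δ : ι → ℤ}

/-- The coaction on the terms of a Čech complex. -/
abbrev cubeCoaction (ρ : A →+* A[T;T⁻¹]) (hw : ∀ i, w i ∈ homog ρ (δ i)) (K : Finset ι) :
    CubeLoc w K →+* (CubeLoc w K)[T;T⁻¹] :=
  locCoaction ρ (homog_prod_mem hw K)

/-- The projection of the cochains onto their components of degree `n`, as a natural operator. -/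
def cubeProj (hw : ∀ i, w i ∈ homog ρ (δ i)) (n : ℤ) : CubeOp w where
  app K := homogProj (cubeCoaction ρ hw K) n
  res {I J} h m := by
    refine homogProj_map (f := (cubeRes w h).toRingHom) ?_ n m
    refine locCoaction_naturality (f := RingHom.id A) _ _ ?_ ?_
    · rw [AddMonoidAlgebra.mapRingHom_id]; rfl
    · ext a
      simp

/-- The cochain `c` is homogeneous of degree `n`. -/
def CubeHomog (hw : ∀ i, w i ∈ homog ρ (δ i)) (n : ℤ) (c : Cube w) : Prop :=
  ∀ K, c K ∈ homog (cubeCoaction ρ hw K) n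

lemma cubeHomog_cubeProj (hρ : IsGradedBy ρ) (hw : ∀ i, w i ∈ homog ρ (δ i)) (n : ℤ)
    (c : Cube w) : CubeHomog hw n ((cubeProj hw n).map c) := fun K =>
  (hρ.locCoaction (homog_prod_mem hw K)).homogProj_mem n (c K)

lemma CubeHomog.cubeProj_eq {hw : ∀ i, w i ∈ homog ρ (δ i)} {n : ℤ} {c : Cube w}
    (hc : CubeHomog hw n c) : (cubeProj hw n).map c = c := funext fun K => by
  change homogProj _ n (c K) = c K
  rw [homogProj_of_mem (hc K), if_pos rfl]

lemma exists_sum_cubeProj_eq [Fintype ι] (hρ : IsGradedBy ρ) (hw : ∀ i, w i ∈ homog ρ (δ i))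
    (c : Cube w) : ∃ s : Finset ℤ, c = ∑ n ∈ s, (cubeProj hw n).map c := by
  classical
  choose s hs using fun K => (hρ.locCoaction (homog_prod_mem hw K)).exists_sum_eq (c K)
  refine ⟨Finset.univ.biUnion s, funext fun K => ?_⟩
  rw [Finset.sum_apply]
  exact hs K _ (Finset.subset_biUnion_of_mem s (Finset.mem_univ K))

end Cube

end Coaction

section GradedAlgebra

variable {k A : Type*} [Field k] [CommRing A] [Algebra k A] (𝒜 : ℕ → Submodule k A)
  [GradedAlgebra 𝒜]

/-- The coaction on a graded algebra. -/
def gradedCoaction : A →+* A[T;T⁻¹] :=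
  (DirectSum.toSemiring (fun n : ℕ =>
      (AddMonoidAlgebra.singleAddHom (n : ℤ)).comp (𝒜 n).subtype.toAddMonoidHom) rfl (by
    intro i j a b
    refine Eq.trans ?_ (AddMonoidAlgebra.single_mul_single (i : ℤ) (j : ℤ) (a : A) (b : A)).symm
    rw [← Nat.cast_add]
    rfl)).comp (DirectSum.decomposeRingEquiv 𝒜).toRingHom

variable {𝒜}

lemma mem_homog_gradedCoaction {n : ℕ} {a : A} (ha : a ∈ 𝒜 n) :
    a ∈ homog (gradedCoaction 𝒜) n := by
  rw [mem_homog, gradedCoaction, RingHom.comp_apply]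
  have : (DirectSum.decomposeRingEquiv 𝒜).toRingHom a = DirectSum.of (fun i => 𝒜 i) n ⟨a, ha⟩ :=
    DirectSum.decompose_of_mem 𝒜 ha
  rw [this]
  exact DirectSum.toSemiring_of (A := fun i => 𝒜 i) (fun n : ℕ =>
    (AddMonoidAlgebra.singleAddHom (n : ℤ)).comp (𝒜 n).subtype.toAddMonoidHom) _ _ n ⟨a, ha⟩

lemma isGradedBy_gradedCoaction : IsGradedBy (gradedCoaction 𝒜) := by
  classical
  intro a
  rw [← DirectSum.sum_support_decompose 𝒜 a]
  exact sum_mem fun n _ => AddSubgroup.mem_iSup_of_mem (n : ℤ)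
    (mem_homog_gradedCoaction (SetLike.coe_mem _))

lemma homogProj_gradedCoaction_natCast (n : ℕ) (a : A) :
    homogProj (gradedCoaction 𝒜) n a = DirectSum.decompose 𝒜 a n := by
  classical
  induction a using DirectSum.Decomposition.inductionOn 𝒜 with
  | zero => simp
  | @homogeneous i m =>
    rw [homogProj_of_mem (mem_homog_gradedCoaction m.2)]
    by_cases h : i = n
    · subst h
      rw [if_pos rfl, DirectSum.decompose_of_mem_same 𝒜 m.2]
    · rw [if_neg (by exact_mod_cast h), DirectSum.decompose_of_mem_ne 𝒜 m.2 h]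
  | add a b ha hb => simp [ha, hb]

lemma mem_of_mem_homog_gradedCoaction {n : ℕ} {a : A}
    (ha : a ∈ homog (gradedCoaction 𝒜) n) : a ∈ 𝒜 n := by
  have := homogProj_of_mem (n := (n : ℤ)) ha
  rw [if_pos rfl, homogProj_gradedCoaction_natCast] at this
  rw [← this]
  exact SetLike.coe_mem _

lemma eq_zero_of_mem_homog_gradedCoaction {n : ℤ} (hn : n < 0) {a : A}
    (ha : a ∈ homog (gradedCoaction 𝒜) n) : a = 0 := by
  classical
  rw [← DirectSum.sum_support_decompose 𝒜 a]
  refine Finset.sum_eq_zero fun m _ => ?_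
  rw [← homogProj_gradedCoaction_natCast, homogProj_of_mem ha, if_neg (by omega)]

end GradedAlgebra

end SegreF

end

end

section
open scoped TensorProduct
noncomputable section

set_option linter.unusedSectionVars false

namespace SegreF

/-! ### Local cohomology in terms of cubes -/

section Frob

variable (k : Type*) [Field k] (p : ℕ) [Fact p.Prime] [CharP k p]
variable {A : Type*} [CommRing A] [Algebra k A] {ι : Type*} [DecidableEq ι]

/-- The Frobenius endomorphism of the cochains, as a natural operator. -/
def frobOp (w : ι → A) : CubeOp w where
  app K := (frob k p (CubeLoc w K)).toAddMonoidHom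
  res h m := (map_pow (cubeRes w h) m p).symm

/-- The class of `c` in the cohomology of the family `U` is killed by a power of Frobenius. -/
def IsFrobNilp {w : ι → A} (rk : ι → ℕ) (U : Set (Finset ι)) (c : Cube w) : Prop :=
  ∃ e : ℕ, IsCubeCobound rk U ((frobOp k p w).map^[e] c)

variable {k p} {w : ι → A} {rk : ι → ℕ} {U : Set (Finset ι)}

lemma iterate_frobOp_apply (e : ℕ) (c : Cube w) (K : Finset ι) :
    ((frobOp k p w).map^[e] c) K = c K ^ p ^ e := by
  induction e with
  | zero => simp
  | succ e ih =>
    rw [Function.iterate_succ_apply', CubeOp.map, ih, pow_succ, pow_mul]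
    rfl

lemma iterate_frobOp_add (e : ℕ) (c c' : Cube w) :
    (frobOp k p w).map^[e] (c + c') = (frobOp k p w).map^[e] c + (frobOp k p w).map^[e] c' := by
  induction e with
  | zero => rfl
  | succ e ih =>
    rw [Function.iterate_succ_apply', ih, CubeOp.map_add, Function.iterate_succ_apply',
      Function.iterate_succ_apply']

lemma IsCubeCobound.iterate (φ : CubeOp w) {c : Cube w} (h : IsCubeCobound rk U c) (e : ℕ) :
    IsCubeCobound rk U (φ.map^[e] c) := by
  induction e with
  | zero => exact h
  | succ e ih => rw [Function.iterate_succ_apply']; exact ih.map φ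

lemma IsCubeCobound.iterate_le (φ : CubeOp w) {c : Cube w} {e e' : ℕ}
    (h : IsCubeCobound rk U (φ.map^[e] c)) (he : e ≤ e') :
    IsCubeCobound rk U (φ.map^[e'] c) := by
  obtain ⟨q, rfl⟩ := Nat.exists_eq_add_of_le he
  rw [add_comm, Function.iterate_add_apply]
  exact h.iterate φ q

lemma IsFrobNilp.add {c c' : Cube w} (h : IsFrobNilp k p rk U c) (h' : IsFrobNilp k p rk U c') :
    IsFrobNilp k p rk U (c + c') := by
  obtain ⟨e, he⟩ := h
  obtain ⟨e', he'⟩ := h'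
  refine ⟨max e e', ?_⟩
  rw [iterate_frobOp_add]
  exact (he.iterate_le _ (le_max_left e e')).add (he'.iterate_le _ (le_max_right e e'))

lemma isFrobNilp_of_isCubeCobound {c : Cube w} (h : IsCubeCobound rk U c) :
    IsFrobNilp k p rk U c := ⟨0, h⟩

lemma isFrobNilp_zero : IsFrobNilp k p rk U (0 : Cube w) :=
  isFrobNilp_of_isCubeCobound ⟨0, fun _ _ => rfl, fun K _ => by rw [map_zero]⟩

lemma isFrobNilp_sum {α : Type*} {s : Finset α} {f : α → Cube w}
    (h : ∀ a ∈ s, IsFrobNilp k p rk U (f a)) : IsFrobNilp k p rk U (∑ a ∈ s, f a) := by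
  classical
  induction s using Finset.induction_on with
  | empty => rw [Finset.sum_empty]; exact isFrobNilp_zero
  | insert a s ha ih =>
    rw [Finset.sum_insert ha]
    exact (h a (Finset.mem_insert_self a s)).add
      (ih fun b hb => h b (Finset.mem_insert_of_mem hb))

lemma CubeSupp.iterate (φ : CubeOp w) {c : Cube w} (h : CubeSupp U c) (e : ℕ) :
    CubeSupp U (φ.map^[e] c) := by
  induction e with
  | zero => exact h
  | succ e ih => rw [Function.iterate_succ_apply']; exact ih.map φ

lemma IsCubeCocycle.iterate (φ : CubeOp w) {c : Cube w} (h : IsCubeCocycle rk U c) (e : ℕ) :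
    IsCubeCocycle rk U (φ.map^[e] c) := by
  induction e with
  | zero => exact h
  | succ e ih => rw [Function.iterate_succ_apply']; exact ih.map φ

end Frob

section Bridge

variable {A : Type*} [CommRing A] {r : ℕ} {x : Fin r → A}

/-- A Čech cochain of degree `j` as a cochain supported on the sets with `j` elements. -/
def toCube {j : ℕ} (c : CechC x j) : Cube x := fun K => if h : K.card = j then c ⟨K, h⟩ else 0

lemma toCube_apply {j : ℕ} (c : CechC x j) {K : Finset (Fin r)} (h : K.card = j) :
    toCube c K = c ⟨K, h⟩ := dif_pos h

lemma cubeSupp_toCube {j : ℕ} (c : CechC x j) : CubeSupp (cardSet _ j) (toCube c) :=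
  fun _ h => dif_neg h

lemma toCube_injective {j : ℕ} : Function.Injective (toCube : CechC x j → Cube x) := by
  intro c c' h
  funext K
  have := congrFun h K.1
  rwa [toCube_apply c K.2, toCube_apply c' K.2] at this

lemma CubeSupp.exists_toCube_eq {j : ℕ} {c : Cube x} (h : CubeSupp (cardSet _ j) c) :
    ∃ c' : CechC x j, toCube c' = c := by
  refine ⟨fun K => c K.1, funext fun K => ?_⟩
  by_cases hK : K.card = j
  · rw [toCube_apply _ hK]
  · rw [h K hK]
    exact dif_neg hK

lemma toCube_cechD {j : ℕ} (c : CechC x j) :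
    toCube (cechD x j c) = cubeD x Fin.val (toCube c) := by
  funext J
  by_cases hJ : J.card = j + 1
  · rw [toCube_apply _ hJ, cubeD_apply, ← Finset.sum_attach]
    simp only [cechD, LinearMap.pi_apply, LinearMap.sum_apply, LinearMap.smul_apply,
      LinearMap.comp_apply, LinearMap.proj_apply]
    refine Finset.sum_congr rfl fun i _ => ?_
    rw [toCube_apply c (K := J.erase i.1) (by rw [Finset.card_erase_of_mem i.2, hJ]; rfl)]
    rfl
  · rw [(cubeSupp_toCube c).cubeD_card J hJ]
    exact dif_neg hJ

lemma mem_cechB_iff {j : ℕ} (c : CechC x j) :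
    c ∈ cechB x j ↔ IsCubeCobound Fin.val Set.univ (toCube c) := by
  cases j with
  | zero =>
    rw [cechB, Submodule.mem_bot]
    constructor
    · rintro rfl
      refine ⟨0, fun _ _ => rfl, fun K _ => ?_⟩
      rw [map_zero]
      by_cases h : K.card = 0
      · rw [toCube_apply _ h]; rfl
      · rw [cubeSupp_toCube _ K h]; rfl
    · rintro ⟨b, -, hb⟩
      refine toCube_injective (funext fun K => ?_)
      by_cases h : K.card = 0
      · obtain rfl := Finset.card_eq_zero.1 h
        rw [← hb ∅ (Set.mem_univ _), cubeD_apply, Finset.sum_empty, toCube_apply _ h]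
        rfl
      · rw [cubeSupp_toCube _ K h, cubeSupp_toCube _ K h]
  | succ j =>
    constructor
    · rintro ⟨b, rfl⟩
      exact ⟨toCube b, fun K hK => absurd (Set.mem_univ K) hK, fun K _ => by rw [toCube_cechD]⟩
    · intro h
      obtain ⟨b, hb, -, hdb⟩ := h.card (cubeSupp_toCube c)
      obtain ⟨b, rfl⟩ := hb.exists_toCube_eq
      refine ⟨b, toCube_injective (funext fun K => ?_)⟩
      rw [toCube_cechD, hdb K (Set.mem_univ K)]

lemma mem_ker_cechD_iff {j : ℕ} (c : CechC x j) :
    c ∈ LinearMap.ker (cechD x j) ↔ cubeD x Fin.val (toCube c) = 0 := by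
  rw [LinearMap.mem_ker, ← toCube_cechD]
  constructor
  · intro h
    rw [h]
    funext K
    by_cases h : K.card = j + 1
    · rw [toCube_apply _ h]; rfl
    · exact dif_neg h
  · intro h
    funext K
    have := congrFun h K.1
    rwa [toCube_apply _ K.2] at this

variable {k : Type*} [Field k] (p : ℕ) [Fact p.Prime] [CharP k p] [Algebra k A]

lemma toCube_cechFrob {j : ℕ} (c : CechC x j) :
    toCube (cechFrob x k p j c) = (frobOp k p x).map (toCube c) := by
  funext K
  by_cases h : K.card = j
  · rw [toCube_apply _ h, CubeOp.map, toCube_apply _ h]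
    rfl
  · rw [(cubeSupp_toCube c).map (frobOp k p x) K h]
    exact dif_neg h

lemma iterate_locCohFrob_mk_eq_zero_iff {j : ℕ} (c : LinearMap.ker (cechD x j)) (e : ℕ) :
    (locCohFrob x k p j)^[e] (Submodule.Quotient.mk c) = 0 ↔
      IsCubeCobound Fin.val Set.univ ((frobOp k p x).map^[e] (toCube c.1)) := by
  have h : ∃ c' : LinearMap.ker (cechD x j),
      (locCohFrob x k p j)^[e] (Submodule.Quotient.mk c) = Submodule.Quotient.mk c' ∧
        toCube c'.1 = (frobOp k p x).map^[e] (toCube c.1) := by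
    induction e with
    | zero => exact ⟨c, rfl, rfl⟩
    | succ e ih =>
      obtain ⟨c', h1, h2⟩ := ih
      refine ⟨⟨cechFrob x k p j c'.1, cechFrob_mem_ker x k p j _ c'.2⟩, ?_, ?_⟩
      · rw [Function.iterate_succ_apply', h1]
        rfl
      · rw [Function.iterate_succ_apply', ← h2, toCube_cechFrob]
  obtain ⟨c', h1, h2⟩ := h
  rw [h1, ← h2, Submodule.Quotient.mk_eq_zero]
  exact mem_cechB_iff c'.1

lemma isNilp_locCohFrob_iff {j : ℕ} :
    IsNilp (locCohFrob x k p j) ↔ ∀ c : Cube x, CubeSupp (cardSet _ j) c →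
      cubeD x Fin.val c = 0 → IsFrobNilp k p Fin.val Set.univ c := by
  constructor
  · intro h c hc hdc
    obtain ⟨c, rfl⟩ := hc.exists_toCube_eq
    obtain ⟨e, he⟩ := h (Submodule.Quotient.mk ⟨c, (mem_ker_cechD_iff c).2 hdc⟩)
    exact ⟨e, (iterate_locCohFrob_mk_eq_zero_iff p _ e).1 he⟩
  · intro h m
    obtain ⟨c, rfl⟩ := Submodule.Quotient.mk_surjective _ m
    obtain ⟨e, he⟩ := h (toCube c.1) (cubeSupp_toCube _) ((mem_ker_cechD_iff c.1).1 c.2)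
    exact ⟨e, (iterate_locCohFrob_mk_eq_zero_iff p _ e).2 he⟩

section Graded

variable {𝒜 : ℕ → Submodule k A} [GradedAlgebra 𝒜]

lemma mem_homog_of_linear (hx : ∀ i, x i ∈ 𝒜 1) (i : Fin r) :
    x i ∈ homog (gradedCoaction 𝒜) ((fun _ => 1 : Fin r → ℤ) i) :=
  mem_homog_gradedCoaction (hx i)

lemma prod_linear_mem (hx : ∀ i, x i ∈ 𝒜 1) (K : Finset (Fin r)) :
    ∏ i ∈ K, x i ∈ 𝒜 K.card := by
  have := homog_prod_mem (mem_homog_of_linear hx) K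
  rw [Finset.sum_const, nsmul_one] at this
  exact mem_of_mem_homog_gradedCoaction this

lemma mem_cechLocDeg_iff (hx : ∀ i, x i ∈ 𝒜 1) {K : Finset (Fin r)} {n : ℤ} (ξ : CechLoc x K) :
    ξ ∈ cechLocDeg x 𝒜 K n ↔
      ξ ∈ homog (cubeCoaction (gradedCoaction 𝒜) (mem_homog_of_linear hx) K) n := by
  have hcomp := locCoaction_comp (homog_prod_mem (mem_homog_of_linear hx) K)
  constructor
  · intro h
    induction h using Submodule.span_induction with
    | mem ξ h =>
      obtain ⟨l, m, a, s, ha, hs, hlm, rfl⟩ := h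
      obtain ⟨v, hv⟩ := (IsLocalization.map_units (CechLoc x K) s).exists_right_inv
      have h1 := map_mem_homog hcomp (mem_homog_gradedCoaction ha)
      have h2 := homog_inv_mem (map_mem_homog hcomp (mem_homog_gradedCoaction hs)) hv
      have h3 : Localization.mk a s = algebraMap A _ a * v := by
        have h4 : Localization.mk a s * algebraMap A (CechLoc x K) s = algebraMap A _ a := by
          rw [Localization.mk_eq_mk', IsLocalization.mk'_spec]
        rw [← h4, mul_assoc, hv, mul_one]
      rw [h3, ← hlm]
      exact homog_mul_mem h1 h2
    | zero => exact zero_mem _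
    | add a b _ _ ha hb => exact add_mem ha hb
    | smul c a _ ha =>
      have h1 : algebraMap k A c ∈ 𝒜 0 := SetLike.algebraMap_mem_graded 𝒜 c
      have h2 := homog_mul_mem (map_mem_homog hcomp (mem_homog_gradedCoaction h1)) ha
      rw [Nat.cast_zero, zero_add, ← IsScalarTower.algebraMap_apply, ← Algebra.smul_def] at h2
      exact h2
  · intro h
    obtain ⟨N, a, ha, hξ⟩ := exists_of_mem_homog_locCoaction isGradedBy_gradedCoaction
      (homog_prod_mem (mem_homog_of_linear hx) K) h
    have hpow : (∏ i ∈ K, x i) ^ N ∈ 𝒜 (N * K.card) := by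
      have := SetLike.pow_mem_graded N (prod_linear_mem hx K)
      rwa [smul_eq_mul] at this
    have h3 : ξ = Localization.mk a (⟨_, N, rfl⟩ : Submonoid.powers (∏ i ∈ K, x i)) := by
      rw [Localization.mk_eq_mk', IsLocalization.eq_mk'_iff_mul_eq]
      simp only [map_pow]
      exact hξ
    rw [Finset.sum_const, nsmul_one] at ha
    by_cases hn : n + N * K.card < 0
    · rw [eq_zero_of_mem_homog_gradedCoaction hn ha] at h3
      rw [h3, Localization.mk_zero]
      exact zero_mem _
    · obtain ⟨l, hl⟩ := Int.eq_ofNat_of_zero_le (not_lt.1 hn)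
      rw [hl] at ha
      refine Submodule.subset_span ⟨l, N * K.card, a, ⟨_, N, rfl⟩,
        mem_of_mem_homog_gradedCoaction ha, hpow, ?_, h3⟩
      push_cast
      omega

lemma isNilpInDegree_locCohFrob_iff (hx : ∀ i, x i ∈ 𝒜 1) {j : ℕ} {n : ℤ} :
    IsNilpInDegree (locCohFrob x k p j) (locCohDeg x 𝒜 j) n ↔
      ∀ c : Cube x, CubeSupp (cardSet _ j) c → CubeHomog (mem_homog_of_linear hx) n c →
      cubeD x Fin.val c = 0 → IsFrobNilp k p Fin.val Set.univ c := by
  constructor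
  · intro h c hc hcn hdc
    obtain ⟨c, rfl⟩ := hc.exists_toCube_eq
    obtain ⟨e, he⟩ := h (Submodule.Quotient.mk ⟨c, (mem_ker_cechD_iff c).2 hdc⟩)
      ⟨⟨c, (mem_ker_cechD_iff c).2 hdc⟩, fun K _ => by
        have := (mem_cechLocDeg_iff hx _).2 (hcn K.1)
        rwa [toCube_apply _ K.2] at this, rfl⟩
    exact ⟨e, (iterate_locCohFrob_mk_eq_zero_iff p _ e).1 he⟩
  · rintro h _ ⟨c, hcn, rfl⟩
    obtain ⟨e, he⟩ := h (toCube c.1) (cubeSupp_toCube _) (fun K => by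
      by_cases hK : K.card = j
      · rw [toCube_apply _ hK]
        exact (mem_cechLocDeg_iff hx _).1 (hcn ⟨K, hK⟩ (Set.mem_univ _))
      · rw [cubeSupp_toCube c.1 K hK]
        exact zero_mem _) ((mem_ker_cechD_iff c.1).1 c.2)
    exact ⟨e, (iterate_locCohFrob_mk_eq_zero_iff p _ e).2 he⟩

lemma not_isNilpInDegree_zero_of_bIndex_eq_zero {j : ℕ} (h : bIndex x 𝒜 p j = 0) :
    ¬ IsNilpInDegree (locCohFrob x k p j) (locCohDeg x 𝒜 j) 0 := by
  intro h0
  have h1 : bIndex x 𝒜 p j ≤ (((-1 : ℤ) : WithTop ℤ) : WithBot (WithTop ℤ)) := by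
    refine sSup_le ?_
    rintro _ ⟨n, hn, rfl⟩
    have h2 : (((n : ℤ) : WithTop ℤ) : WithBot (WithTop ℤ)) ≤ ((0 : ℤ) : WithTop ℤ) :=
      (le_sSup (Set.mem_image_of_mem _ hn)).trans_eq h
    have h3 : n ≤ 0 := WithTop.coe_le_coe.1 (WithBot.coe_le_coe.1 h2)
    have h4 : n ≠ 0 := fun h => hn (h ▸ h0)
    have : n ≤ -1 := by omega
    exact WithBot.coe_le_coe.2 (WithTop.coe_le_coe.2 this)
  rw [h] at h1
  have : (0 : ℤ) ≤ -1 := WithTop.coe_le_coe.1 (WithBot.coe_le_coe.1 h1)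
  omega

lemma bIndex_eq_zero {j : ℕ} (h : ¬ IsNilpInDegree (locCohFrob x k p j) (locCohDeg x 𝒜 j) 0)
    (hpos : ∀ n > 0, IsNilpInDegree (locCohFrob x k p j) (locCohDeg x 𝒜 j) n) :
    bIndex x 𝒜 p j = 0 := by
  refine le_antisymm (sSup_le ?_) (le_sSup ⟨0, h, rfl⟩)
  rintro _ ⟨n, hn, rfl⟩
  have : n ≤ 0 := not_lt.1 fun h => hn (hpos n h)
  exact WithBot.coe_le_coe.2 (WithTop.coe_le_coe.2 this)

lemma bInv_eq_top_iff : bInv x 𝒜 p = ⊤ ↔ ∀ j, bIndex x 𝒜 p j ≠ 0 := by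
  rw [bInv, sInf_eq_top]
  constructor
  · intro h j hj
    exact ENat.natCast_ne_top j (h j ⟨j, hj, rfl⟩)
  · rintro h _ ⟨j, hj, rfl⟩
    exact absurd hj (h j)

end Graded

end Bridge

end SegreF

end

end

section
open scoped TensorProduct
noncomputable section

set_option linter.unusedSectionVars false

namespace SegreF

/-! ### Krull dimension and algebraic independence -/

section KrullDim

lemma ringKrullDim_eq_of_isIntegral {A B : Type*} [CommRing A] [CommRing B] [Algebra A B]
    [Algebra.IsIntegral A B] (hinj : Function.Injective (algebraMap A B)) :
    ringKrullDim B = ringKrullDim A := by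
  refine le_antisymm (Order.krullDim_le_of_strictMono (PrimeSpectrum.comap (algebraMap A B)) ?_) ?_
  · intro P Q h
    exact Ideal.IsIntegral.comap_lt_comap (R := A) (show P.asIdeal < Q.asIdeal from h)
  · have H : ∀ l : LTSeries (PrimeSpectrum A), ∃ l' : LTSeries (PrimeSpectrum B),
        l'.length = l.length ∧ PrimeSpectrum.comap (algebraMap A B) l'.last = l.last := by
      intro l
      induction l using RelSeries.inductionOn' with
      | singleton P =>
        obtain ⟨Q, -, hQ, hQP⟩ := Ideal.exists_ideal_over_prime_of_isIntegral P.asIdeal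
          (⊥ : Ideal B) (by
            rw [← RingHom.ker_eq_comap_bot, (RingHom.injective_iff_ker_eq_bot _).1 hinj]
            exact bot_le)
        exact ⟨RelSeries.singleton _ ⟨Q, hQ⟩, rfl, PrimeSpectrum.ext hQP⟩
      | snoc l P hP ih =>
        obtain ⟨l', hl, hl'⟩ := ih
        have hlt : l.last.asIdeal < P.asIdeal := hP
        obtain ⟨Q, hle, hQ, hQP⟩ := Ideal.exists_ideal_over_prime_of_isIntegral P.asIdeal
          l'.last.asIdeal (by
            have : Ideal.comap (algebraMap A B) l'.last.asIdeal = l.last.asIdeal :=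
              congrArg PrimeSpectrum.asIdeal hl'
            rw [this]
            exact hlt.le)
        refine ⟨RelSeries.snoc l' ⟨Q, hQ⟩ (show l'.last < _ from lt_of_le_of_ne hle ?_), ?_, ?_⟩
        · intro h
          rw [h] at hl'
          have : P.asIdeal = l.last.asIdeal := by
            rw [← hQP]
            exact congrArg PrimeSpectrum.asIdeal hl'
          exact hlt.ne this.symm
        · simp [hl]
        · rw [RelSeries.last_snoc, RelSeries.last_snoc]
          exact PrimeSpectrum.ext hQP
    refine iSup_le fun l => ?_
    obtain ⟨l', hl, -⟩ := H l
    rw [← hl]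
    exact le_iSup (fun l : LTSeries (PrimeSpectrum B) => (l.length : WithBot ℕ∞)) l'

variable (k : Type*) [Field k]

lemma exists_algebraicIndependent_isIntegral (A : Type*) [CommRing A] [Nontrivial A] [Algebra k A]
    [Algebra.FiniteType k A] : ∃ (d : ℕ) (f : Fin d → A), AlgebraicIndependent k f ∧
      Algebra.IsIntegral (Algebra.adjoin k (Set.range f)) A ∧ ringKrullDim A = d := by
  obtain ⟨d, g, hg, hfin⟩ := exists_integral_inj_algHom_of_fg k A
  refine ⟨d, fun i => g (MvPolynomial.X i), (MvPolynomial.algebraicIndependent_X _ k).map' hg,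
    ?_, ?_⟩
  · have hrange : g.range = Algebra.adjoin k (Set.range fun i => g (MvPolynomial.X i)) := by
      rw [← Algebra.map_top, ← MvPolynomial.adjoin_range_X, AlgHom.map_adjoin, ← Set.range_comp]
      rfl
    rw [← hrange]
    refine ⟨fun a => ?_⟩
    obtain ⟨q, hq, hqa⟩ := hfin a
    refine ⟨q.map g.rangeRestrict.toRingHom, hq.map _, ?_⟩
    rw [Polynomial.eval₂_map]
    exact hqa
  · let _ := g.toRingHom.toAlgebra
    have : Algebra.IsIntegral (MvPolynomial (Fin d) k) A := ⟨hfin⟩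
    rw [ringKrullDim_eq_of_isIntegral (A := MvPolynomial (Fin d) k) (B := A) hg,
      MvPolynomial.ringKrullDim_of_isNoetherianRing, ringKrullDim_eq_zero_of_field]
    simp

lemma exists_ringKrullDim_eq_trdeg (A : Type*) [CommRing A] [IsDomain A] [Algebra k A]
    [Algebra.FiniteType k A] : ∃ d : ℕ, ringKrullDim A = d ∧ Algebra.trdeg k A = d := by
  obtain ⟨d, f, hf, hint, hd⟩ := exists_algebraicIndependent_isIntegral k A
  refine ⟨d, hd, ?_⟩
  have hb : IsTranscendenceBasis k f := hf.isTranscendenceBasis_iff_isAlgebraic.2 inferInstance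
  have := hb.lift_cardinalMk_eq_trdeg
  simpa using this.symm

variable {k} {A : Type*} [CommRing A] [Algebra k A]

lemma le_ringKrullDim_of_algebraicIndependent [Algebra.FiniteType k A] {m : ℕ} {f : Fin m → A}
    (hf : AlgebraicIndependent k f) : (m : WithBot ℕ∞) ≤ ringKrullDim A := by
  obtain ⟨P, hP, hPb⟩ := Ideal.exists_comap_eq_of_mem_minimalPrimes_of_injective
    (f := (MvPolynomial.aeval f : MvPolynomial (Fin m) k →ₐ[k] A).toRingHom) hf ⊥ (by
      rw [IsDomain.minimalPrimes_eq_singleton_bot]; rfl)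
  obtain ⟨d, hd, htr⟩ := exists_ringKrullDim_eq_trdeg k (A ⧸ P)
  have hf' : AlgebraicIndependent k (Ideal.Quotient.mkₐ k P ∘ f) := by
    have hcomp : MvPolynomial.aeval (Ideal.Quotient.mkₐ k P ∘ f) =
        (Ideal.Quotient.mkₐ k P).comp (MvPolynomial.aeval f) := by
      ext i; simp
    rw [AlgebraicIndependent, hcomp, injective_iff_map_eq_zero]
    intro q hq
    have h1 : MvPolynomial.aeval f q ∈ P := Ideal.Quotient.eq_zero_iff_mem.1 hq
    have h2 : q ∈ Ideal.comap
      (MvPolynomial.aeval f : MvPolynomial (Fin m) k →ₐ[k] A).toRingHom P := h1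
    rwa [hPb, Ideal.mem_bot] at h2
  have h := hf'.lift_cardinalMk_le_trdeg
  rw [htr] at h
  have hmd : m ≤ d := by
    simpa using h
  calc (m : WithBot ℕ∞) ≤ (d : ℕ) := by exact_mod_cast hmd
    _ = ringKrullDim (A ⧸ P) := hd.symm
    _ ≤ _ := ringKrullDim_quotient_le P

lemma exists_algebraicIndependent_mem [Algebra.FiniteType k A] {X : Set A}
    (hX : Algebra.adjoin k X = ⊤) {n : ℕ} (hn : (n : WithBot ℕ∞) ≤ ringKrullDim A) :
    ∃ f : Fin n → A, (∀ i, f i ∈ X) ∧ AlgebraicIndependent k f := by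
  obtain ⟨l, hl⟩ := Order.le_krullDim_iff.1 hn
  let P := l.head.asIdeal
  have hP : P.IsPrime := l.head.isPrime
  obtain ⟨d, hd, htr⟩ := exists_ringKrullDim_eq_trdeg k (A ⧸ P)
  have hnd : n ≤ d := by
    have h1 : (n : WithBot ℕ∞) ≤ ringKrullDim (A ⧸ P) := by
      rw [ringKrullDim_quotient, Order.le_krullDim_iff]
      refine ⟨⟨l.length, fun i => ⟨l i, ?_⟩, fun i => l.step i⟩, hl⟩
      exact LTSeries.head_le l i
    rw [hd] at h1
    exact_mod_cast h1
  let X' := Ideal.Quotient.mkₐ k P '' X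
  have hX' : Algebra.adjoin k X' = ⊤ := by
    rw [← AlgHom.map_adjoin, hX, Algebra.map_top, AlgHom.range_eq_top]
    exact Ideal.Quotient.mkₐ_surjective k P
  have : Algebra.IsAlgebraic (Algebra.adjoin k X') (A ⧸ P) := by
    rw [hX']
    refine ⟨fun a => ?_⟩
    have := isAlgebraic_algebraMap (A := A ⧸ P) (⟨a, Algebra.mem_top⟩ : (⊤ : Subalgebra k (A ⧸ P)))
    exact this
  obtain ⟨t, htX, ht⟩ := exists_isTranscendenceBasis_subset (R := k) X'
  have hcard : Cardinal.mk t = d := by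
    have := ht.cardinalMk_eq_trdeg
    rw [this, htr]
  obtain ⟨g⟩ : Nonempty (Fin n ↪ t) := by
    rw [← Cardinal.lift_mk_le', hcard]
    simpa using hnd
  choose f hfX hf using fun i => htX (g i).2
  refine ⟨f, hfX, AlgebraicIndependent.of_comp (Ideal.Quotient.mkₐ k P) ?_⟩
  have : Ideal.Quotient.mkₐ k P ∘ f = Subtype.val ∘ g := funext hf
  rw [this]
  exact ht.1.comp g g.injective

end KrullDim

end SegreF

end

end

section
open scoped TensorProduct
noncomputable section

set_option linter.unusedSectionVars false

namespace SegreF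

open scoped LaurentPolynomial

/-! ### Standard graded algebras -/

section Standard

variable {k A : Type*} [Field k] [CommRing A] [Algebra k A] {𝒜 : ℕ → Submodule k A}
  [GradedAlgebra 𝒜]

lemma pow_degree_one_le (n : ℕ) : (𝒜 1) ^ n ≤ 𝒜 n := by
  induction n with
  | zero =>
    rw [pow_zero, Submodule.one_le]
    exact SetLike.GradedOne.one_mem
  | succ n ih =>
    rw [pow_succ, Submodule.mul_le]
    exact fun a ha b hb => SetLike.mul_mem_graded (ih ha) hb

lemma IsStandardGraded.le_pow (h : IsStandardGraded 𝒜) (n : ℕ) : 𝒜 n ≤ (𝒜 1) ^ n := by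
  classical
  have h1 : ∀ a : A, a ∈ ⨆ m, (𝒜 1) ^ m := by
    intro a
    have ha : a ∈ Algebra.adjoin k (𝒜 1 : Set A) := h.generated ▸ Algebra.mem_top
    induction ha using Algebra.adjoin_induction with
    | mem a ha => exact Submodule.mem_iSup_of_mem 1 (by simpa using ha)
    | algebraMap c => exact Submodule.mem_iSup_of_mem 0 (by simp)
    | add a b _ _ ha hb => exact add_mem ha hb
    | mul a b _ _ ha hb =>
      have h2 : (⨆ m, (𝒜 1) ^ m) * (⨆ m, (𝒜 1) ^ m) ≤ ⨆ m, (𝒜 1) ^ m := by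
        rw [Submodule.iSup_mul]
        refine iSup_le fun m => ?_
        rw [Submodule.mul_iSup]
        refine iSup_le fun m' => ?_
        rw [← pow_add]
        exact le_iSup (fun m => (𝒜 1) ^ m) _
      exact h2 (Submodule.mul_mem_mul ha hb)
  have h2 : ∀ a : A, (DirectSum.decompose 𝒜 a n : A) ∈ (𝒜 1) ^ n := by
    intro a
    refine Submodule.iSup_induction (fun m => (𝒜 1) ^ m)
      (motive := fun a => (DirectSum.decompose 𝒜 a n : A) ∈ (𝒜 1) ^ n) (h1 a) ?_ ?_ ?_
    · intro m b hb
      by_cases hmn : m = n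
      · subst hmn
        rwa [DirectSum.decompose_of_mem_same 𝒜 (pow_degree_one_le m hb)]
      · rw [DirectSum.decompose_of_mem_ne 𝒜 (pow_degree_one_le m hb) hmn]
        exact zero_mem _
    · simp
    · intro a b ha hb
      rw [DirectSum.decompose_add]
      exact add_mem ha hb
  intro a ha
  have := h2 a
  rwa [DirectSum.decompose_of_mem_same 𝒜 ha] at this

variable {r : ℕ} {x : Fin r → A}

lemma degree_one_le_irrelevant : 𝒜 1 ≤ (HomogeneousIdeal.irrelevant 𝒜).toIdeal.restrictScalars k :=
  fun a ha => by
    change a ∈ HomogeneousIdeal.irrelevant 𝒜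
    rw [HomogeneousIdeal.mem_irrelevant_iff, GradedRing.proj_apply,
      DirectSum.decompose_of_mem_ne 𝒜 ha one_ne_zero]

lemma IsStandardGraded.degree_one_le_span (h : IsStandardGraded 𝒜)
    (hx : IsLinearGenerators x 𝒜) : 𝒜 1 ≤ Submodule.span k (Set.range x) := by
  classical
  intro a ha
  have h1 : a ∈ Ideal.span (Set.range x) := by
    rw [hx.2]
    exact degree_one_le_irrelevant ha
  obtain ⟨c, rfl⟩ := (Ideal.mem_span_range_iff_exists_fun).1 h1
  rw [← DirectSum.decompose_of_mem_same 𝒜 ha, DirectSum.decompose_sum, DFinsupp.finsetSum_apply,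
    AddSubmonoidClass.coe_finsetSum]
  refine sum_mem fun i _ => ?_
  have h2 : (DirectSum.decompose 𝒜 (c i * x i) (0 + 1) : A) = DirectSum.decompose 𝒜 (c i) 0 * x i :=
    DirectSum.coe_decompose_mul_add_of_right_mem 𝒜 (hx.1 i)
  have h3 : (DirectSum.decompose 𝒜 (c i) 0 : A) ∈ (1 : Submodule k A) :=
    h.degree_zero.le (SetLike.coe_mem _)
  obtain ⟨q, hq⟩ := Submodule.mem_one.1 h3
  rw [zero_add] at h2
  rw [h2, ← hq, ← Algebra.smul_def]
  exact Submodule.smul_mem _ _ (Submodule.subset_span ⟨i, rfl⟩)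

lemma IsStandardGraded.adjoin_range (h : IsStandardGraded 𝒜) (hx : IsLinearGenerators x 𝒜) :
    Algebra.adjoin k (Set.range x) = ⊤ := by
  rw [eq_top_iff, ← h.generated]
  exact Algebra.adjoin_le fun a ha =>
    Algebra.span_le_adjoin k _ (h.degree_one_le_span hx ha)

lemma IsStandardGraded.finiteType (h : IsStandardGraded 𝒜) (hx : IsLinearGenerators x 𝒜) :
    Algebra.FiniteType k A :=
  ⟨⟨(Set.finite_range x).toFinset, by simpa using h.adjoin_range hx⟩⟩

lemma IsStandardGraded.mem_pow (h : IsStandardGraded 𝒜) (hx : IsLinearGenerators x 𝒜) {n m : ℕ}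
    (hmn : m ≤ n) {a : A} (ha : a ∈ 𝒜 n) : a ∈ Ideal.span (Set.range x) ^ m := by
  refine Ideal.pow_le_pow_right hmn ?_
  have h1 : ∀ n : ℕ, (𝒜 1) ^ n ≤ (Ideal.span (Set.range x) ^ n).restrictScalars k := by
    intro n
    induction n with
    | zero => simp
    | succ n ih =>
      rw [pow_succ, pow_succ, Submodule.mul_le]
      refine fun a ha b hb => Ideal.mul_mem_mul (ih ha) ?_
      rw [hx.2]
      exact degree_one_le_irrelevant hb
  exact h1 n (h.le_pow n ha)

end Standard

/-! ### Coactions on tensor products -/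

section TensorCoaction

variable {k A B : Type*} [Field k] [CommRing A] [Algebra k A] [CommRing B] [Algebra k B]
variable (𝒜 : ℕ → Submodule k A) [GradedAlgebra 𝒜] (ℬ : ℕ → Submodule k B) [GradedAlgebra ℬ]

/-- The coaction on a graded algebra, with the degrees multiplied by `u`, as an algebra map. -/
def weightCoaction {Q : Type*} [CommRing Q] [Algebra k Q] (u : ℤ) (f : A →ₐ[k] Q) :
    A →ₐ[k] Q[T;T⁻¹] where
  __ := (AddMonoidAlgebra.mapRingHom ℤ (f : A →+* Q)).comp
    ((AddMonoidAlgebra.mapDomainRingHom A (AddMonoidHom.mulLeft u)).comp (gradedCoaction 𝒜))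
  commutes' c := by
    have h1 : gradedCoaction 𝒜 (algebraMap k A c) =
        AddMonoidAlgebra.single 0 (algebraMap k A c) := by
      have := mem_homog_gradedCoaction (SetLike.algebraMap_mem_graded 𝒜 c)
      rwa [mem_homog, Nat.cast_zero] at this
    change AddMonoidAlgebra.mapRingHom ℤ (f : A →+* Q)
      (AddMonoidAlgebra.mapDomain _ (gradedCoaction 𝒜 (algebraMap k A c))) = _
    rw [h1, AddMonoidAlgebra.mapDomain_single, AddMonoidAlgebra.mapRingHom_single]
    simp

lemma weightCoaction_apply {Q : Type*} [CommRing Q] [Algebra k Q] (u : ℤ) (f : A →ₐ[k] Q)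
    {n : ℕ} {a : A} (ha : a ∈ 𝒜 n) :
    weightCoaction 𝒜 u f a = AddMonoidAlgebra.single (u * n) (f a) := by
  change AddMonoidAlgebra.mapRingHom ℤ (f : A →+* Q)
      (AddMonoidAlgebra.mapDomain _ (gradedCoaction 𝒜 a)) = _
  rw [mem_homog.1 (mem_homog_gradedCoaction ha), AddMonoidAlgebra.mapDomain_single,
    AddMonoidAlgebra.mapRingHom_single]
  rfl

/-- The coaction on `A ⊗ B` for which `[A]ₘ ⊗ [B]ₙ` has degree `u m + v n`. -/
def tensorCoaction (u v : ℤ) : A ⊗[k] B →+* (A ⊗[k] B)[T;T⁻¹] :=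
  (Algebra.TensorProduct.lift
    (weightCoaction 𝒜 u (Algebra.TensorProduct.includeLeft : A →ₐ[k] A ⊗[k] B))
    (weightCoaction ℬ v (Algebra.TensorProduct.includeRight : B →ₐ[k] A ⊗[k] B))
    (fun _ _ => Commute.all _ _)).toRingHom

variable {𝒜 ℬ}

lemma tmul_mem_homog (u v : ℤ) {m n : ℕ} {a : A} {b : B} (ha : a ∈ 𝒜 m) (hb : b ∈ ℬ n) :
    a ⊗ₜ[k] b ∈ homog (tensorCoaction 𝒜 ℬ u v) (u * m + v * n) := by
  rw [mem_homog]
  refine (Algebra.TensorProduct.lift_tmul _ _ _ _ _).trans ?_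
  rw [weightCoaction_apply 𝒜 u _ ha, weightCoaction_apply ℬ v _ hb,
    AddMonoidAlgebra.single_mul_single]
  simp

lemma isGradedBy_tensorCoaction (u v : ℤ) : IsGradedBy (tensorCoaction 𝒜 ℬ u v) := by
  classical
  intro t
  induction t with
  | zero => exact zero_mem _
  | add s t hs ht => exact add_mem hs ht
  | tmul a b =>
    rw [← DirectSum.sum_support_decompose 𝒜 a, ← DirectSum.sum_support_decompose ℬ b,
      TensorProduct.sum_tmul]
    refine sum_mem fun m _ => ?_
    rw [TensorProduct.tmul_sum]
    exact sum_mem fun n _ => AddSubgroup.mem_iSup_of_mem _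
      (tmul_mem_homog u v (SetLike.coe_mem _) (SetLike.coe_mem _))

lemma segrePart_le_homog (u v : ℤ) {n : ℕ} {t : A ⊗[k] B} (ht : t ∈ segrePart 𝒜 ℬ n) :
    t ∈ homog (tensorCoaction 𝒜 ℬ u v) ((u + v) * n) := by
  obtain ⟨t, rfl⟩ := ht
  induction t with
  | zero => rw [map_zero]; exact zero_mem _
  | add s t hs ht => rw [map_add]; exact add_mem hs ht
  | tmul a b =>
    rw [add_mul]
    exact tmul_mem_homog u v a.2 b.2

end TensorCoaction

end SegreF

end

end

section
noncomputable section

set_option linter.unusedSectionVars false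

namespace SegreF

section Avoidance

variable {k A : Type*} [Field k] [CommRing A] [Algebra k A] {𝒜 : ℕ → Submodule k A}
  [GradedAlgebra 𝒜] {r : ℕ} {x : Fin r → A}

/-- Homogeneous prime avoidance, for homogeneous primes. -/
lemma exists_homogeneous_notMem_of_isHomogeneous (hx : ∀ i, x i ∈ 𝒜 1) (s : Finset (Ideal A))
    (hs : ∀ P ∈ s, P.IsPrime ∧ P.IsHomogeneous 𝒜 ∧ ∃ i, x i ∉ P) :
    ∃ a > 0, ∃ f ∈ 𝒜 a, ∀ P ∈ s, f ∉ P := by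
  classical
  induction hn : s.card generalizing s with
  | zero =>
    obtain rfl := Finset.card_eq_zero.1 hn
    exact ⟨1, one_pos, 0, zero_mem _, by simp⟩
  | succ n ih =>
    obtain ⟨P, hP⟩ := Finset.exists_minimal (s := s) (Finset.card_pos.1 (by omega))
    have hPs : P ∈ s := hP.1
    obtain ⟨hPp, hPh, i, hi⟩ := hs P hPs
    obtain ⟨a, ha, f, hf, hfQ⟩ := ih (s.erase P)
      (fun Q hQ => hs Q (Finset.mem_of_mem_erase hQ)) (by rw [Finset.card_erase_of_mem hPs, hn]; rfl)
    by_cases hfP : f ∈ P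
    swap
    · refine ⟨a, ha, f, hf, fun Q hQ => ?_⟩
      by_cases h : Q = P
      · rwa [h]
      · exact hfQ Q (Finset.mem_erase.2 ⟨h, hQ⟩)
    have hq : ∀ Q ∈ s.erase P, ∃ (m : ℕ) (q : A), q ∈ 𝒜 m ∧ q ∈ Q ∧ q ∉ P := by
      intro Q hQ
      by_contra! hcon
      have hQP : Q ≤ P := by
        intro u hu
        rw [← DirectSum.sum_support_decompose 𝒜 u]
        exact sum_mem fun m _ =>
          hcon m _ (SetLike.coe_mem _) ((hs Q (Finset.mem_of_mem_erase hQ)).2.1 m hu)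
      exact (Finset.mem_erase.1 hQ).1
        (le_antisymm hQP (hP.2 (Finset.mem_of_mem_erase hQ) hQP))
    choose! m q hqm hqQ hqP using hq
    have hg : ∀ s' ⊆ s.erase P, ∃ b : ℕ, ∏ Q ∈ s', q Q ∈ 𝒜 b := by
      intro s'
      induction s' using Finset.induction_on with
      | empty => exact fun _ => ⟨0, by simpa using SetLike.GradedOne.one_mem⟩
      | insert Q s' hQ ih' =>
        intro h
        obtain ⟨b, hb⟩ := ih' ((Finset.subset_insert _ _).trans h)
        rw [Finset.prod_insert hQ]
        exact ⟨_, SetLike.mul_mem_graded (hqm Q (h (Finset.mem_insert_self _ _))) hb⟩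
    obtain ⟨b, hb⟩ := hg _ subset_rfl
    have hg' : x i * ∏ Q ∈ s.erase P, q Q ∈ 𝒜 (1 + b) := SetLike.mul_mem_graded (hx i) hb
    have hgP : x i * ∏ Q ∈ s.erase P, q Q ∉ P := by
      rw [hPp.mul_mem_iff_mem_or_mem, hPp.prod_mem_iff]
      rintro (h | ⟨Q, hQ, h⟩)
      · exact hi h
      · exact hqP Q hQ h
    refine ⟨a * (1 + b), by positivity, f ^ (1 + b) + (x i * ∏ Q ∈ s.erase P, q Q) ^ a,
      add_mem ?_ ?_, fun Q hQ => ?_⟩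
    · have := SetLike.pow_mem_graded (1 + b) hf
      rwa [smul_eq_mul, mul_comm] at this
    · exact SetLike.pow_mem_graded a hg'
    · by_cases h : Q = P
      · subst h
        rw [Ideal.add_mem_iff_right _ (Ideal.pow_mem_of_mem _ hfP _ (by omega))]
        exact fun h => hgP (hPp.mem_of_pow_mem _ h)
      · have hQ' := Finset.mem_erase.2 ⟨h, hQ⟩
        have h1 : x i * ∏ Q ∈ s.erase P, q Q ∈ Q :=
          Q.mul_mem_left _ (Ideal.mem_of_dvd _ (Finset.dvd_prod_of_mem q hQ') (hqQ Q hQ'))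
        rw [Ideal.add_mem_iff_left _ (Ideal.pow_mem_of_mem _ h1 _ ha)]
        exact fun h => hfQ Q hQ' ((hs Q hQ).1.mem_of_pow_mem _ h)

/-- Homogeneous prime avoidance. -/
lemma exists_homogeneous_notMem (hx : ∀ i, x i ∈ 𝒜 1) {s : Set (Ideal A)} (hfin : s.Finite)
    (hs : ∀ P ∈ s, P.IsPrime ∧ ∃ i, x i ∉ P) :
    ∃ a > 0, ∃ f ∈ 𝒜 a, ∀ P ∈ s, f ∉ P := by
  classical
  obtain ⟨a, ha, f, hf, h⟩ := exists_homogeneous_notMem_of_isHomogeneous hx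
    (hfin.toFinset.image fun P => (P.homogeneousCore 𝒜).toIdeal) (by
      intro P' hP'
      obtain ⟨P, hP, rfl⟩ := Finset.mem_image.1 hP'
      obtain ⟨h1, i, h2⟩ := hs P (hfin.mem_toFinset.1 hP)
      exact ⟨h1.homogeneousCore, (P.homogeneousCore 𝒜).isHomogeneous, i,
        fun h => h2 (Ideal.toIdeal_homogeneousCore_le 𝒜 P h)⟩)
  exact ⟨a, ha, f, hf, fun P hP hfP => h _
    (Finset.mem_image_of_mem _ (hfin.mem_toFinset.2 hP))
    (Ideal.mem_homogeneousCore_of_homogeneous_of_mem ⟨a, hf⟩ hfP)⟩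

lemma exists_homogeneous_regular [IsNoetherianRing A] (hx : ∀ i, x i ∈ 𝒜 1) {I : Ideal A}
    (hI : ∀ u, (∀ i, x i * u ∈ I) → u ∈ I) :
    ∃ a > 0, ∃ f ∈ 𝒜 a, ∀ u, f * u ∈ I → u ∈ I := by
  obtain ⟨a, ha, f, hf, h⟩ := exists_homogeneous_notMem hx (associatedPrimes.finite A (A ⧸ I)) (by
    intro P hP
    obtain ⟨h1, u, h2⟩ := isAssociatedPrime_iff.1 hP
    refine ⟨h1, ?_⟩
    by_contra! hcon
    obtain ⟨u, rfl⟩ := Ideal.Quotient.mk_surjective u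
    have h3 : ∀ v, v ∈ P ↔ v * u ∈ I := fun v => by
      rw [h2, Submodule.mem_colon_singleton, Submodule.mem_bot, ← Ideal.Quotient.eq_zero_iff_mem]
      rfl
    refine h1.ne_top ((Ideal.eq_top_iff_one P).2 ((h3 1).2 ?_))
    rw [one_mul]
    exact hI u fun i => (h3 _).1 (hcon i))
  refine ⟨a, ha, f, hf, fun u hu => ?_⟩
  by_contra hu'
  have h1 : f ∈ ⋃ p ∈ associatedPrimes A (A ⧸ I), (p : Set A) := by
    rw [biUnion_associatedPrimes_eq_zero_divisors]
    refine ⟨Ideal.Quotient.mk I u, by rwa [Ne, Ideal.Quotient.eq_zero_iff_mem], ?_⟩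
    exact Ideal.Quotient.eq_zero_iff_mem.2 hu
  simp only [Set.mem_iUnion] at h1
  obtain ⟨P, hP, hfP⟩ := h1
  exact h P hP hfP

/-! ### Saturation -/

/-- The saturation of the ideal `I` with respect to the ideal `(x)`. -/
def saturation (x : Fin r → A) (I : Ideal A) : Ideal A where
  carrier := {u | ∃ N : ℕ, ∀ a ∈ Ideal.span (Set.range x) ^ N, a * u ∈ I}
  zero_mem' := ⟨0, fun a _ => by simp⟩
  add_mem' := by
    rintro u v ⟨N, hN⟩ ⟨M, hM⟩
    refine ⟨max N M, fun a ha => ?_⟩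
    rw [mul_add]
    exact add_mem (hN a (Ideal.pow_le_pow_right (le_max_left _ _) ha))
      (hM a (Ideal.pow_le_pow_right (le_max_right _ _) ha))
  smul_mem' := by
    rintro c u ⟨N, hN⟩
    refine ⟨N, fun a ha => ?_⟩
    rw [smul_eq_mul, mul_left_comm]
    exact I.mul_mem_left c (hN a ha)

lemma le_saturation (I : Ideal A) : I ≤ saturation x I :=
  fun _ hu => ⟨0, fun a _ => I.mul_mem_left a hu⟩

lemma exists_pow_mul_mem_of_mem_saturation {I : Ideal A} {u : A} (hu : u ∈ saturation x I) :
    ∃ N : ℕ, ∀ i, x i ^ N * u ∈ I := by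
  obtain ⟨N, hN⟩ := hu
  exact ⟨N, fun i => hN _ (Ideal.pow_mem_pow (Ideal.subset_span (Set.mem_range_self i)) N)⟩

lemma mem_saturation_of_mul_mem {I : Ideal A} {u : A} (h : ∀ i, x i * u ∈ saturation x I) :
    u ∈ saturation x I := by
  choose N hN using h
  refine ⟨Finset.univ.sup N + 1, fun a ha => ?_⟩
  have h1 : Ideal.span (Set.range x) ^ (Finset.univ.sup N + 1) ≤
      Submodule.comap (LinearMap.toSpanSingleton A A u) I := by
    rw [pow_succ, Ideal.mul_le]
    intro a ha b hb
    have h2 : Ideal.span (Set.range x) ≤ Submodule.comap (LinearMap.toSpanSingleton A A (a * u)) I := by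
      rw [Ideal.span_le]
      rintro _ ⟨i, rfl⟩
      have := hN i a (Ideal.pow_le_pow_right (Finset.le_sup (Finset.mem_univ i)) ha)
      rwa [mul_left_comm] at this
    have := h2 hb
    rw [Submodule.mem_comap, LinearMap.toSpanSingleton_apply, smul_eq_mul] at this ⊢
    rwa [mul_comm a b, mul_assoc]
  exact h1 ha

lemma saturation_isHomogeneous (hx : ∀ i, x i ∈ 𝒜 1) {I : Ideal A} (hI : I.IsHomogeneous 𝒜) :
    (saturation x I).IsHomogeneous 𝒜 := by
  classical
  intro n u hu
  obtain ⟨N, hN⟩ := hu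
  have hh : ∀ N : ℕ, (Ideal.span (Set.range x) ^ N).IsHomogeneous 𝒜 := by
    intro N
    have h1 := Ideal.homogeneous_span 𝒜 (Set.range x) (by rintro _ ⟨i, rfl⟩; exact ⟨1, hx i⟩)
    induction N with
    | zero => rw [pow_zero, Ideal.one_eq_top]; exact Ideal.IsHomogeneous.top 𝒜
    | succ N ih => rw [pow_succ]; exact ih.mul h1
  refine ⟨N, fun a ha => ?_⟩
  rw [← DirectSum.sum_support_decompose 𝒜 a, Finset.sum_mul]
  refine sum_mem fun m _ => ?_
  rw [← DirectSum.coe_decompose_mul_add_of_left_mem 𝒜 (SetLike.coe_mem _)]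
  exact hI _ (hN _ (hh N m ha))

lemma IsStandardGraded.exists_saturation_decompose_mem (h : IsStandardGraded 𝒜)
    (hx : IsLinearGenerators x 𝒜) {I : Ideal A} (hI : I.IsHomogeneous 𝒜) :
    ∃ n : ℕ, ∀ m ≥ n, ∀ u ∈ saturation x I, (DirectSum.decompose 𝒜 u m : A) ∈ I := by
  classical
  have := h.noetherian
  have hP : ∀ g ∈ saturation x I, ∃ n : ℕ, ∀ m ≥ n, ∀ a : A,
      (DirectSum.decompose 𝒜 (a * g) m : A) ∈ I := by
    intro g hg
    have h1 : ∀ i, ∃ n : ℕ, ∀ m ≥ n, ∀ a : A,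
        (DirectSum.decompose 𝒜 (a * (DirectSum.decompose 𝒜 g i : A)) m : A) ∈ I := by
      intro i
      obtain ⟨N, hN⟩ := saturation_isHomogeneous hx.1 hI i hg
      refine ⟨N + i, fun m hm a => ?_⟩
      rw [DirectSum.coe_decompose_mul_of_right_mem_of_le 𝒜 (SetLike.coe_mem _) (by omega)]
      exact hN _ (h.mem_pow hx (n := m - i) (by omega) (SetLike.coe_mem _))
    choose n hn using h1
    refine ⟨(DirectSum.decompose 𝒜 g).support.sup n, fun m hm a => ?_⟩
    conv in a * g => rw [← DirectSum.sum_support_decompose 𝒜 g, Finset.mul_sum]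
    rw [DirectSum.decompose_sum, DFinsupp.finsetSum_apply, AddSubmonoidClass.coe_finsetSum]
    exact sum_mem fun i hi => hn i m ((Finset.le_sup hi).trans hm) a
  obtain ⟨G, hG⟩ := (isNoetherianRing_iff_ideal_fg A).1 this (saturation x I)
  choose! n hn using hP
  refine ⟨G.sup n, fun m hm u hu => ?_⟩
  rw [← hG] at hu
  suffices H : ∀ a : A, (DirectSum.decompose 𝒜 (a * u) m : A) ∈ I by simpa using H 1
  induction hu using Submodule.span_induction with
  | mem g hg => exact hn g (hG ▸ Ideal.subset_span hg) m ((Finset.le_sup hg).trans hm)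
  | zero => simp
  | add u v _ _ hu hv =>
    intro a
    rw [mul_add, DirectSum.decompose_add]
    exact add_mem (hu a) (hv a)
  | smul c u _ hu =>
    intro a
    rw [smul_eq_mul, ← mul_assoc]
    exact hu _

end Avoidance

end SegreF

end

end

section
open scoped LaurentPolynomial
noncomputable section

set_option linter.unusedSectionVars false

namespace SegreF

/-! ### Cochains modulo an ideal -/

section Modulo

variable {A : Type*} [CommRing A]

lemma homogProj_mul_of_mem {ρ : A →+* A[T;T⁻¹]} (hρ : IsGradedBy ρ) {a : A} {m : ℤ}
    (ha : a ∈ homog ρ m) (n : ℤ) (b : A) :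
    homogProj ρ n (a * b) = a * homogProj ρ (n - m) b := by
  induction b using hρ.induction_on with
  | h l b hb =>
    rw [homogProj_of_mem (homog_mul_mem ha hb), homogProj_of_mem hb]
    by_cases h : m + l = n
    · rw [if_pos h, if_pos (by omega)]
    · rw [if_neg h, if_neg (by omega), mul_zero]
  | hadd b c hb hc => rw [mul_add, map_add, map_add, mul_add, hb, hc]

lemma homogProj_mem_span {ρ : A →+* A[T;T⁻¹]} (hρ : IsGradedBy ρ) {G : Set A}
    (hG : ∀ g ∈ G, ∀ n, homogProj ρ n g ∈ Ideal.span G) {a : A} (ha : a ∈ Ideal.span G) (n : ℤ) :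
    homogProj ρ n a ∈ Ideal.span G := by
  induction ha using Submodule.span_induction generalizing n with
  | mem g hg => exact hG g hg n
  | zero => rw [map_zero]; exact zero_mem _
  | add u v _ _ hu hv => rw [map_add]; exact add_mem (hu n) (hv n)
  | smul c u _ hu =>
    rw [smul_eq_mul]
    induction c using hρ.induction_on with
    | h l c hc => rw [homogProj_mul_of_mem hρ hc]; exact Ideal.mul_mem_left _ _ (hu _)
    | hadd c c' hc hc' => rw [add_mul, map_add]; exact add_mem hc hc'

variable {ι : Type*} [DecidableEq ι] {w : ι → A} {rk : ι → ℕ}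

/-- The components of the cochain `c` lie in the extensions of the ideal `I`. -/
def CubeMem (I : Ideal A) (c : Cube w) : Prop :=
  ∀ K, c K ∈ I.map (algebraMap A (CubeLoc w K))

variable {I : Ideal A} {c c' : Cube w}

lemma CubeMem.add (h : CubeMem I c) (h' : CubeMem I c') : CubeMem I (c + c') :=
  fun K => add_mem (h K) (h' K)

lemma CubeMem.sub (h : CubeMem I c) (h' : CubeMem I c') : CubeMem I (c - c') :=
  fun K => sub_mem (h K) (h' K)

lemma CubeMem.smul (h : CubeMem I c) (a : A) : CubeMem I (a • c) := fun K => by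
  rw [Pi.smul_apply, Algebra.smul_def]
  exact Ideal.mul_mem_left _ _ (h K)

lemma CubeMem.smul_of_mem {a : A} (h : a ∈ I) (c : Cube w) : CubeMem I (a • c) := fun K => by
  rw [Pi.smul_apply, Algebra.smul_def]
  exact Ideal.mul_mem_right _ _ (Ideal.mem_map_of_mem _ h)

lemma CubeMem.mono {J : Ideal A} (h : CubeMem I c) (hIJ : I ≤ J) : CubeMem J c :=
  fun K => Ideal.map_mono hIJ (h K)

lemma CubeMem.restr (h : CubeMem I c) (U : Set (Finset ι)) : CubeMem I (cubeRestr w U c) := by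
  intro K
  by_cases hK : K ∈ U
  · rw [cubeRestr_apply_of_mem hK]; exact h K
  · rw [cubeRestr_apply_of_notMem hK]; exact zero_mem _

lemma CubeMem.cubeD (h : CubeMem I c) : CubeMem I (cubeD w rk c) := by
  intro K
  rw [cubeD_apply]
  refine sum_mem fun i _ => ?_
  rw [Algebra.smul_def]
  refine Ideal.mul_mem_left _ _ ?_
  have h1 := Ideal.mem_map_of_mem (cubeRes w (K.erase_subset i)) (h (K.erase i))
  have h2 : (I.map (algebraMap A (CubeLoc w (K.erase i)))).map (cubeRes w (K.erase_subset i)) =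
      I.map (algebraMap A (CubeLoc w K)) := by
    refine (Ideal.map_map (algebraMap A (CubeLoc w (K.erase i)))
      (cubeRes w (K.erase_subset i)).toRingHom).trans ?_
    congr 1
    exact (cubeRes w (K.erase_subset i)).comp_algebraMap
  rwa [h2] at h1

lemma cubeMem_bot_iff : CubeMem ⊥ c ↔ c = 0 := by
  constructor
  · intro h
    funext K
    have := h K
    rwa [Ideal.map_bot, Ideal.mem_bot] at this
  · rintro rfl
    exact fun K => zero_mem _

lemma CubeMem.exists_add_smul {f : A} (h : CubeMem (I ⊔ Ideal.span {f}) c) :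
    ∃ c' : Cube w, CubeMem I (c - f • c') := by
  have h1 : ∀ K, ∃ m : CubeLoc w K, c K - f • m ∈ I.map (algebraMap A (CubeLoc w K)) := by
    intro K
    have h2 := h K
    rw [Ideal.map_sup, Ideal.map_span, Set.image_singleton] at h2
    obtain ⟨a, ha, b, hb, hab⟩ := Submodule.mem_sup.1 h2
    obtain ⟨m, rfl⟩ := Ideal.mem_span_singleton'.1 hb
    refine ⟨m, ?_⟩
    rw [← hab, Algebra.smul_def, mul_comm m, add_sub_cancel_right]
    exact ha
  choose c' hc' using h1
  exact ⟨c', hc'⟩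

/-- An element which is regular modulo `I` is regular on cochains modulo `I`. -/
lemma CubeMem.of_smul {f : A} (hf : ∀ u, f * u ∈ I → u ∈ I) (h : CubeMem I (f • c)) :
    CubeMem I c := by
  intro K
  obtain ⟨N, a, ha⟩ := IsLocalization.Away.surj (∏ i ∈ K, w i) (c K)
  have h1 : (f • c) K * algebraMap A (CubeLoc w K) (∏ i ∈ K, w i) ^ N =
      algebraMap A (CubeLoc w K) (f * a) := by
    rw [Pi.smul_apply, Algebra.smul_def, mul_assoc, ha, map_mul]
  obtain ⟨l, hl⟩ := (mem_map_away_iff h1).1 (h K)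
  refine (mem_map_away_iff ha).2 ⟨l, hf _ ?_⟩
  rwa [mul_left_comm]

variable {ρ : A →+* A[T;T⁻¹]} {δ : ι → ℤ} {hw : ∀ i, w i ∈ homog ρ (δ i)}

lemma CubeMem.cubeProj (hρ : IsGradedBy ρ) (hI : ∀ a ∈ I, ∀ n, homogProj ρ n a ∈ I)
    (h : CubeMem I c) (n : ℤ) : CubeMem I ((cubeProj hw n).map c) := by
  intro K
  refine homogProj_mem_span (hρ.locCoaction (homog_prod_mem hw K)) ?_ (h K) n
  rintro _ ⟨a, ha, rfl⟩ n
  rw [homogProj_map (locCoaction_comp (homog_prod_mem hw K))]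
  exact Ideal.mem_map_of_mem _ (hI a ha n)

lemma CubeHomog.smul {n a : ℤ} {f : A} (hf : f ∈ homog ρ a) (hc : CubeHomog hw n c) :
    CubeHomog hw (a + n) (f • c) := by
  intro K
  have h1 := map_mem_homog (locCoaction_comp (homog_prod_mem hw K)) hf
  rw [Pi.smul_apply, Algebra.smul_def]
  exact homog_mul_mem h1 (hc K)

lemma CubeHomog.restr {n : ℤ} (hc : CubeHomog hw n c) (U : Set (Finset ι)) :
    CubeHomog hw n (cubeRestr w U c) := by
  intro K
  by_cases hK : K ∈ U
  · rw [cubeRestr_apply_of_mem hK]; exact hc K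
  · rw [cubeRestr_apply_of_notMem hK]; exact zero_mem _

/-- A cochain which bounds a homogeneous cochain modulo a homogeneous ideal can be taken
homogeneous, and concentrated in one cohomological degree. -/
lemma CubeMem.exists_homogeneous (hρ : IsGradedBy ρ) (hI : ∀ a ∈ I, ∀ n, homogProj ρ n a ∈ I)
    {n : ℤ} {j : ℕ} (hcj : CubeSupp (cardSet ι (j + 1)) c) (hc : CubeHomog hw n c) {b : Cube w}
    (hb : CubeMem I (c - SegreF.cubeD w rk b)) :
    ∃ b' : Cube w, CubeSupp (cardSet ι j) b' ∧ CubeHomog hw n b' ∧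
      CubeMem I (c - SegreF.cubeD w rk b') := by
  refine ⟨(SegreF.cubeProj hw n).map (cubeRestr w (cardSet ι j) b), (cubeSupp_restr _ _).map _,
    cubeHomog_cubeProj hρ hw n _, ?_⟩
  have h1 := (hb.restr (cardSet ι (j + 1))).cubeProj (hw := hw) hρ hI n
  rwa [_root_.map_sub, hcj.restr_eq, cubeRestr_cubeD_card, CubeOp.map_sub, hc.cubeProj_eq,
    CubeOp.map_cubeD] at h1

end Modulo

section Vanishing

variable {k A : Type*} [Field k] [CommRing A] [Algebra k A] {𝒜 : ℕ → Submodule k A}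
  [GradedAlgebra 𝒜] {r : ℕ} {x : Fin r → A}

/-- The local cohomology of `A / I` in cohomological degree `j` vanishes in degrees at least `n`. -/
def VanishFrom (hx : ∀ i, x i ∈ 𝒜 1) (I : Ideal A) (j : ℕ) (n : ℤ) : Prop :=
  ∀ m ≥ n, ∀ c : Cube x, CubeSupp (cardSet _ j) c → CubeHomog (mem_homog_of_linear hx) m c →
    CubeMem I (cubeD x Fin.val c) → ∃ b : Cube x, CubeMem I (c - cubeD x Fin.val b)

lemma homogProj_mem_of_isHomogeneous {I : Ideal A} (hI : I.IsHomogeneous 𝒜) :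
    ∀ a ∈ I, ∀ n, homogProj (gradedCoaction 𝒜) n a ∈ I := by
  intro a ha n
  obtain h | h := lt_or_ge n 0
  · rw [eq_zero_of_mem_homog_gradedCoaction h (isGradedBy_gradedCoaction.homogProj_mem n a)]
    exact zero_mem _
  · lift n to ℕ using h
    rw [homogProj_gradedCoaction_natCast]
    exact hI n ha

lemma cubeMem_of_saturation {I : Ideal A} {c : Cube x} (hc : c ∅ ∈ I.map (algebraMap A _))
    (h : CubeMem (saturation x I) c) : CubeMem I c := by
  intro K
  obtain rfl | ⟨i, hi⟩ := K.eq_empty_or_nonempty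
  · exact hc
  obtain ⟨N, a, ha⟩ := IsLocalization.Away.surj (∏ i ∈ K, x i) (c K)
  obtain ⟨l, hl⟩ := (mem_map_away_iff ha).1 (h K)
  obtain ⟨M, hM⟩ := exists_pow_mul_mem_of_mem_saturation hl
  refine (mem_map_away_iff ha).2 ⟨M + l, ?_⟩
  rw [pow_add, mul_assoc]
  obtain ⟨q, hq⟩ := pow_dvd_pow_of_dvd (Finset.dvd_prod_of_mem x hi) M
  rw [hq, mul_assoc, mul_left_comm]
  exact I.mul_mem_left _ (hM i)

lemma exists_pow_smul_sub_cubeD_mem {I : Ideal A} {c : Cube x}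
    (hdc : CubeMem I (cubeD x Fin.val c)) {f : A} (hf : f ∈ Ideal.span (Set.range x)) :
    ∃ (N : ℕ) (b : Cube x), CubeMem I (f ^ N • c - cubeD x Fin.val b) := by
  let Q : Ideal A :=
    { carrier := {a | ∃ b : Cube x, CubeMem I (a • c - cubeD x Fin.val b)}
      zero_mem' := ⟨0, by rw [zero_smul, map_zero, sub_zero]; exact fun K => zero_mem _⟩
      add_mem' := by
        rintro a a' ⟨b, hb⟩ ⟨b', hb'⟩
        refine ⟨b + b', ?_⟩
        rw [add_smul, map_add, add_sub_add_comm]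
        exact hb.add hb'
      smul_mem' := by
        rintro a a' ⟨b, hb⟩
        refine ⟨a • b, ?_⟩
        rw [smul_assoc, map_smul, ← smul_sub]
        exact hb.smul a }
  have h1 : Ideal.span (Set.range x) ≤ Q.radical := by
    rw [Ideal.span_le]
    rintro _ ⟨i, rfl⟩
    obtain ⟨n, b, -, hb⟩ := exists_smul_sub_cubeD_mem (w := x) Fin.val_injective
      (U := Set.univ) (i := i) Set.ordConnected_univ (fun K => by simp) I
      (c := c) (fun K hK => absurd (Set.mem_univ K) hK) fun K _ => hdc K
    exact ⟨n, b, fun K => hb K (Set.mem_univ K)⟩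
  exact h1 hf

lemma vanishFrom_succ (hx : IsLinearGenerators x 𝒜) {I : Ideal A}
    (hI : I.IsHomogeneous 𝒜) {a : ℕ} (ha : a > 0) {f : A} (hf : f ∈ 𝒜 a)
    (hreg : ∀ u, f * u ∈ saturation x I → u ∈ saturation x I) {j : ℕ} {n : ℤ}
    (h : VanishFrom hx.1 (saturation x I ⊔ Ideal.span {f}) j n) :
    VanishFrom hx.1 I (j + 1) n := by
  have hρ := isGradedBy_gradedCoaction (𝒜 := 𝒜)
  have hI' := saturation_isHomogeneous hx.1 hI
  have hJ : (saturation x I ⊔ Ideal.span {f}).IsHomogeneous 𝒜 :=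
    hI'.sup (Ideal.homogeneous_span 𝒜 _ (by rintro _ rfl; exact ⟨a, hf⟩))
  have hfh := mem_homog_gradedCoaction hf
  intro m hm c hcj hc hdc
  have hfx : f ∈ Ideal.span (Set.range x) := by
    rw [hx.2]
    change f ∈ HomogeneousIdeal.irrelevant 𝒜
    rw [HomogeneousIdeal.mem_irrelevant_iff, GradedRing.proj_apply,
      DirectSum.decompose_of_mem_ne 𝒜 hf ha.ne']
  obtain ⟨N, b, hb⟩ := exists_pow_smul_sub_cubeD_mem hdc hfx
  have hfc : ∀ N : ℕ, CubeHomog (mem_homog_of_linear hx.1) (N * a + m) (f ^ N • c) :=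
    fun N => hc.smul (homog_pow_mem hfh N)
  have key : ∀ N : ℕ, (∃ b : Cube x, CubeMem (saturation x I) (f ^ N • c - cubeD x Fin.val b)) →
      ∃ b : Cube x, CubeMem (saturation x I) (c - cubeD x Fin.val b) := by
    intro N
    induction N with
    | zero => rintro ⟨b, hb⟩; exact ⟨b, by simpa using hb⟩
    | succ N ih =>
      rintro ⟨b, hb⟩
      apply ih
      obtain ⟨b, hbj, hbh, hb⟩ := hb.exists_homogeneous hρ (homogProj_mem_of_isHomogeneous hI')
        (hcj.smul (f ^ (N + 1))) (hfc (N + 1))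
      obtain ⟨e, he⟩ := h _ (by push_cast; nlinarith) b hbj hbh (by
        have h1 := (CubeMem.smul_of_mem (Ideal.mem_sup_right (Ideal.mem_span_singleton_self f))
          (f ^ N • c)).sub (hb.mono (le_sup_left (b := Ideal.span {f})))
        rw [smul_smul, ← pow_succ'] at h1
        simpa using h1)
      obtain ⟨b1, hb1⟩ := he.exists_add_smul
      refine ⟨b1, CubeMem.of_smul hreg ?_⟩
      have h2 := hb.add (hb1.cubeD (rk := Fin.val))
      rw [map_sub, map_sub, cubeD_cubeD Fin.val_injective, sub_zero, map_smul,
        sub_add_sub_cancel, pow_succ', ← smul_smul, ← smul_sub] at h2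
      exact h2
  obtain ⟨b, hb⟩ := key N ⟨b, hb.mono (le_saturation I)⟩
  obtain ⟨b, hbj, -, hb⟩ := hb.exists_homogeneous hρ (homogProj_mem_of_isHomogeneous hI') hcj hc
  refine ⟨b, cubeMem_of_saturation ?_ hb⟩
  rw [(hcj.sub hbj.cubeD_card) ∅ (by simp [cardSet])]
  exact zero_mem _

lemma vanishFrom_of_ringKrullDim_lt [IsNoetherianRing A] (hx : IsLinearGenerators x 𝒜) {I : Ideal A}
    (hI : I.IsHomogeneous 𝒜) {j : ℕ} (hj : ringKrullDim (A ⧸ I) < j) (n : ℤ) :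
    VanishFrom hx.1 I j n := by
  induction j generalizing I with
  | zero =>
    have h1 : Subsingleton (A ⧸ I) := by
      by_contra h
      rw [not_subsingleton_iff_nontrivial] at h
      exact absurd hj (not_lt.2 ringKrullDim_nonneg_of_nontrivial)
    rw [Ideal.Quotient.subsingleton_iff] at h1
    subst h1
    refine fun m _ c _ _ _ => ⟨0, fun K => ?_⟩
    rw [Ideal.map_top]
    trivial
  | succ j ih =>
    obtain ⟨a, ha, f, hf, hreg⟩ := exists_homogeneous_regular hx.1 (I := saturation x I)
      fun u hu => mem_saturation_of_mul_mem hu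
    refine vanishFrom_succ hx hI ha hf hreg (ih ?_ ?_)
    · exact (saturation_isHomogeneous hx.1 hI).sup
        (Ideal.homogeneous_span 𝒜 _ (by rintro _ rfl; exact ⟨a, hf⟩))
    · have h1 : Ideal.Quotient.mk (saturation x I) f ∈ nonZeroDivisors (A ⧸ saturation x I) := by
        rw [mem_nonZeroDivisors_iff_right]
        intro u hu
        obtain ⟨u, rfl⟩ := Ideal.Quotient.mk_surjective u
        rw [← map_mul, Ideal.Quotient.eq_zero_iff_mem] at hu
        exact Ideal.Quotient.eq_zero_iff_mem.2 (hreg u (by rwa [mul_comm]))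
      have h2 := ringKrullDim_quotient_succ_le_of_nonZeroDivisor h1
      have h3 := ringKrullDim_eq_of_ringEquiv
        (DoubleQuot.quotQuotEquivQuotSup (saturation x I) (Ideal.span {f}))
      rw [Ideal.map_span, Set.image_singleton] at h3
      rw [h3] at h2
      have h4 : ringKrullDim (A ⧸ saturation x I) ≤ ringKrullDim (A ⧸ I) :=
        ringKrullDim_le_of_surjective (Ideal.Quotient.factor (le_saturation I))
          (Ideal.Quotient.factor_surjective _)
      have h5 := (h2.trans h4).trans_lt hj
      rw [Nat.cast_succ] at h5
      by_contra hcon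
      exact absurd h5 (not_lt.2 (add_le_add_left (not_lt.1 hcon) 1))

lemma IsStandardGraded.exists_vanishFrom (hA : IsStandardGraded 𝒜) (hx : IsLinearGenerators x 𝒜)
    {I : Ideal A} (hI : I.IsHomogeneous 𝒜) (j : ℕ) : ∃ n, VanishFrom hx.1 I j n := by
  have := hA.noetherian
  have hρ := isGradedBy_gradedCoaction (𝒜 := 𝒜)
  induction j generalizing I with
  | zero =>
    obtain ⟨n, hn⟩ := hA.exists_saturation_decompose_mem hx hI
    refine ⟨n, fun m hm c hcj hc hdc => ⟨0, ?_⟩⟩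
    rw [map_zero, sub_zero]
    lift m to ℕ using by omega
    have h0 : (∅ : Finset (Fin r)).card = 0 := rfl
    have hdeg : ∑ i ∈ (∅ : Finset (Fin r)), (fun _ => 1 : Fin r → ℤ) i = 0 := rfl
    obtain ⟨N, a, ha, hca⟩ := exists_of_mem_homog_locCoaction hρ
      (homog_prod_mem (mem_homog_of_linear hx.1) ∅) (hc ∅)
    rw [hdeg, mul_zero, add_zero] at ha
    have ham := mem_of_mem_homog_gradedCoaction ha
    have hsat : a ∈ saturation x I := by
      have hle : Ideal.span (Set.range x) ≤
          Ideal.radical (Submodule.comap (LinearMap.toSpanSingleton A A a) I) := by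
        intro f hf
        obtain ⟨M, b, hb⟩ := exists_pow_smul_sub_cubeD_mem hdc hf
        have h1 := hb ∅
        rw [Pi.sub_apply, cubeD_apply, Finset.sum_empty, sub_zero] at h1
        obtain ⟨l, hl⟩ := (mem_map_away_iff (a := f ^ M * a) (n := N) (by
          rw [Pi.smul_apply, Algebra.smul_def, mul_assoc, hca, map_mul])).1 h1
        rw [Finset.prod_empty, one_pow, one_mul] at hl
        exact ⟨M, hl⟩
      exact Ideal.exists_pow_le_of_le_radical_of_fg hle
        ((isNoetherianRing_iff_ideal_fg A).1 this _)
    have haI := hn m (by omega) a hsat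
    rw [DirectSum.decompose_of_mem_same 𝒜 ham] at haI
    intro K
    obtain rfl | hK := K.eq_empty_or_nonempty
    · exact (mem_map_away_iff hca).2 ⟨0, by simpa using haI⟩
    · rw [hcj K (by simpa [cardSet] using hK.ne_empty)]
      exact zero_mem _
  | succ j ih =>
    obtain ⟨a, ha, f, hf, hreg⟩ := exists_homogeneous_regular hx.1 (I := saturation x I)
      fun u hu => mem_saturation_of_mul_mem hu
    obtain ⟨n, hn⟩ := ih (I := saturation x I ⊔ Ideal.span {f})
      ((saturation_isHomogeneous hx.1 hI).sup
        (Ideal.homogeneous_span 𝒜 _ (by rintro _ rfl; exact ⟨a, hf⟩)))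
    exact ⟨n, vanishFrom_succ hx hI ha hf hreg hn⟩

/-- Homogeneous cocycles above the dimension, or of large degree, are coboundaries. -/
lemma VanishFrom.isCubeCobound {hx : ∀ i, x i ∈ 𝒜 1} {j : ℕ} {n m : ℤ}
    (h : VanishFrom hx ⊥ j n) (hm : n ≤ m) {c : Cube x} (hcj : CubeSupp (cardSet _ j) c)
    (hc : CubeHomog (mem_homog_of_linear hx) m c) (hdc : cubeD x Fin.val c = 0) :
    IsCubeCobound Fin.val Set.univ c := by
  obtain ⟨b, hb⟩ := h m hm c hcj hc (by rw [cubeMem_bot_iff, hdc])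
  rw [cubeMem_bot_iff, sub_eq_zero] at hb
  exact ⟨b, fun K hK => absurd (Set.mem_univ K) hK, fun K _ => by rw [hb]⟩

lemma IsStandardGraded.isCubeCobound_of_ringKrullDim_lt (hA : IsStandardGraded 𝒜)
    (hx : IsLinearGenerators x 𝒜) {j : ℕ} (hj : ringKrullDim A < j) {c : Cube x}
    (hcj : CubeSupp (cardSet _ j) c) (hdc : cubeD x Fin.val c = 0) :
    IsCubeCobound Fin.val Set.univ c := by
  have := hA.noetherian
  have hρ := isGradedBy_gradedCoaction (𝒜 := 𝒜)
  obtain ⟨s, hs⟩ := exists_sum_cubeProj_eq hρ (mem_homog_of_linear hx.1) c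
  have H : ∀ s' ⊆ s, IsCubeCobound Fin.val Set.univ
      (∑ n ∈ s', (cubeProj (mem_homog_of_linear hx.1) n).map c) := by
    intro s'
    induction s' using Finset.induction_on with
    | empty => exact fun _ => ⟨0, fun _ _ => rfl, fun K _ => by rw [map_zero, Finset.sum_empty]⟩
    | insert n s' hn ih =>
      intro h
      rw [Finset.sum_insert hn]
      refine IsCubeCobound.add ?_ (ih ((Finset.subset_insert _ _).trans h))
      refine (vanishFrom_of_ringKrullDim_lt hx (Ideal.IsHomogeneous.bot 𝒜)
        (by rwa [ringKrullDim_eq_of_ringEquiv (RingEquiv.quotientBot A)]) n).isCubeCobound le_rfl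
        (hcj.map _) (cubeHomog_cubeProj hρ _ n c) ?_
      rw [← CubeOp.map_cubeD, hdc, CubeOp.map_zero]
  rw [hs]
  exact H s subset_rfl

variable (p : ℕ) [Fact p.Prime] [CharP k p]

lemma CubeHomog.iterate_frobOp {ι : Type*} [DecidableEq ι] {w : ι → A} {δ : ι → ℤ}
    {ρ : A →+* A[T;T⁻¹]} {hw : ∀ i, w i ∈ homog ρ (δ i)} {n : ℤ} {c : Cube w}
    (hc : CubeHomog hw n c) (e : ℕ) :
    CubeHomog hw ((p ^ e : ℕ) * n) ((frobOp k p w).map^[e] c) := by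
  intro K
  rw [iterate_frobOp_apply]
  exact homog_pow_mem (hc K) _

/-- The local cohomology of a standard graded ring is nilpotent in positive degrees. -/
lemma IsStandardGraded.isFrobNilp_of_pos (hA : IsStandardGraded 𝒜) (hx : IsLinearGenerators x 𝒜)
    {j : ℕ} {n : ℤ} (hn : 0 < n) {c : Cube x} (hcj : CubeSupp (cardSet _ j) c)
    (hc : CubeHomog (mem_homog_of_linear hx.1) n c) (hdc : cubeD x Fin.val c = 0) :
    IsFrobNilp k p Fin.val Set.univ c := by
  obtain ⟨N, hN⟩ := hA.exists_vanishFrom hx (Ideal.IsHomogeneous.bot 𝒜) j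
  have hp : 2 ≤ p := (Fact.out : p.Prime).two_le
  refine ⟨N.toNat, hN.isCubeCobound ?_ (hcj.iterate _ _) (hc.iterate_frobOp p N.toNat) ?_⟩
  · have h1 : N.toNat < p ^ N.toNat := Nat.lt_pow_self hp
    have h2 : N ≤ (p ^ N.toNat : ℕ) := by omega
    nlinarith
  · have h1 := (show IsCubeCocycle Fin.val Set.univ c from
      fun K _ => congrFun hdc K).iterate (frobOp k p x) N.toNat
    exact funext fun K => h1 K (Set.mem_univ K)

lemma IsStandardGraded.isNilpInDegree_of_pos (hA : IsStandardGraded 𝒜)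
    (hx : IsLinearGenerators x 𝒜) {j : ℕ} {n : ℤ} (hn : 0 < n) :
    IsNilpInDegree (locCohFrob x k p j) (locCohDeg x 𝒜 j) n :=
  (isNilpInDegree_locCohFrob_iff p hx.1).2 fun _ hcj hc hdc =>
    hA.isFrobNilp_of_pos p hx hn hcj hc hdc

lemma IsStandardGraded.isNilpInDegree_zero_of_bInv_eq_top (hA : IsStandardGraded 𝒜)
    (hx : IsLinearGenerators x 𝒜) (h : bInv x 𝒜 p = ⊤) (j : ℕ) :
    IsNilpInDegree (locCohFrob x k p j) (locCohDeg x 𝒜 j) 0 := by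
  by_contra hcon
  exact bInv_eq_top_iff p |>.1 h j
    (bIndex_eq_zero p hcon fun n hn => hA.isNilpInDegree_of_pos p hx hn)

end Vanishing

end SegreF

end

end

section
open scoped TensorProduct
noncomputable section

set_option linter.unusedSectionVars false

namespace SegreF

/-! ### Regular sequences of length two -/

/-- `f, g` is a (weakly) regular sequence. -/
structure IsRegPair {A : Type*} [CommRing A] (f g : A) : Prop where
  left : ∀ u, f * u = 0 → u = 0
  right : ∀ u, g * u ∈ Ideal.span {f} → u ∈ Ideal.span {f}

section Depth

variable {k A : Type*} [Field k] [CommRing A] [Algebra k A] {𝒜 : ℕ → Submodule k A}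
  [GradedAlgebra 𝒜]

lemma exists_isRegPair (h : 2 ≤ depth 𝒜) : ∃ f g : A, f ∈ HomogeneousIdeal.irrelevant 𝒜 ∧
    g ∈ HomogeneousIdeal.irrelevant 𝒜 ∧ IsRegPair f g := by
  obtain ⟨rs, hrs, hreg, hlen⟩ : ∃ rs : List A, (∀ a ∈ rs, a ∈ HomogeneousIdeal.irrelevant 𝒜) ∧
      RingTheory.Sequence.IsRegular A rs ∧ 2 ≤ rs.length := by
    by_contra! hcon
    have h1 : depth 𝒜 ≤ 1 := by
      refine iSup_le fun rs => iSup_le fun hrs => ?_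
      have := hcon rs hrs.1 hrs.2
      exact_mod_cast Nat.lt_succ_iff.1 this
    exact absurd (h.trans h1) (by decide)
  match rs, hlen with
  | f :: g :: rs, _ =>
    have h1 := (RingTheory.Sequence.isWeaklyRegular_cons_iff A f _).1 hreg.toIsWeaklyRegular
    have h2 := ((RingTheory.Sequence.isWeaklyRegular_cons_iff _ g _).1 h1.2).1
    refine ⟨f, g, hrs f (by simp), hrs g (by simp), ⟨fun u hu => ?_, fun u hu => ?_⟩⟩
    · exact h1.1 (show f • u = f • (0 : A) by rw [smul_eq_mul, hu, smul_zero])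
    · have h3 : ∀ v : A, v ∈ Ideal.span {f} ↔
          (Submodule.Quotient.mk v : QuotSMulTop f A) = 0 := fun v => by
        rw [Submodule.Quotient.mk_eq_zero, Ideal.mem_span_singleton']
        constructor
        · rintro ⟨a, rfl⟩
          exact ⟨a, trivial, by simp [mul_comm]⟩
        · rintro ⟨a, -, rfl⟩
          exact ⟨a, by simp [mul_comm]⟩
      rw [h3] at hu ⊢
      refine h2 ?_
      change g • (Submodule.Quotient.mk u : QuotSMulTop f A) = g • 0
      rw [smul_zero, ← Submodule.Quotient.mk_smul, smul_eq_mul, hu]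

lemma two_le_ringKrullDim (hA : Nontrivial A) (h : 2 ≤ depth 𝒜) : 2 ≤ ringKrullDim A := by
  obtain ⟨f, g, hf, hg, hreg⟩ := exists_isRegPair h
  have h1 : f ∈ nonZeroDivisors A := by
    rw [mem_nonZeroDivisors_iff_right]
    exact fun u hu => hreg.left u (by rwa [mul_comm])
  have h2 : Ideal.Quotient.mk (Ideal.span {f}) g ∈ nonZeroDivisors (A ⧸ Ideal.span {f}) := by
    rw [mem_nonZeroDivisors_iff_right]
    intro u hu
    obtain ⟨u, rfl⟩ := Ideal.Quotient.mk_surjective u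
    rw [← map_mul, Ideal.Quotient.eq_zero_iff_mem] at hu
    exact Ideal.Quotient.eq_zero_iff_mem.2 (hreg.right u (by rwa [mul_comm]))
  have h3 := ringKrullDim_quotient_succ_le_of_nonZeroDivisor h1
  have h4 := ringKrullDim_quotient_succ_le_of_nonZeroDivisor h2
  have h5 := ringKrullDim_eq_of_ringEquiv
    (DoubleQuot.quotQuotEquivQuotSup (Ideal.span {f}) (Ideal.span {g}))
  rw [Ideal.map_span, Set.image_singleton] at h5
  have h6 : Nontrivial (A ⧸ Ideal.span {f} ⊔ Ideal.span {g}) := by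
    rw [Ideal.Quotient.nontrivial_iff]
    intro htop
    have h7 : Ideal.span {f} ⊔ Ideal.span {g} ≤ (HomogeneousIdeal.irrelevant 𝒜).toIdeal :=
      sup_le ((Ideal.span_singleton_le_iff_mem _).2 hf) ((Ideal.span_singleton_le_iff_mem _).2 hg)
    rw [htop] at h7
    have h8 : (1 : A) ∈ HomogeneousIdeal.irrelevant 𝒜 := h7 trivial
    rw [HomogeneousIdeal.mem_irrelevant_iff, GradedRing.proj_apply,
      DirectSum.decompose_of_mem_same 𝒜 SetLike.GradedOne.one_mem] at h8
    exact one_ne_zero h8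
  have h7 : (0 : WithBot ℕ∞) ≤ ringKrullDim (A ⧸ Ideal.span {f} ⊔ Ideal.span {g}) :=
    ringKrullDim_nonneg_of_nontrivial
  rw [h5] at h4
  calc (2 : WithBot ℕ∞) = 0 + 1 + 1 := by norm_num
    _ ≤ _ := add_le_add_left (add_le_add_left h7 1) 1
    _ ≤ _ := add_le_add_left h4 1
    _ ≤ _ := h3

end Depth

section TensorRegular

variable {k A B : Type*} [Field k] [CommRing A] [Algebra k A] [CommRing B] [Algebra k B]

lemma tmul_one_regular {a : A} (ha : ∀ u, a * u = 0 → u = 0) (t : A ⊗[k] B)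
    (h : a ⊗ₜ[k] (1 : B) * t = 0) : t = 0 := by
  have h1 : Function.Injective (LinearMap.mulLeft k a) :=
    (injective_iff_map_eq_zero _).2 fun u hu => ha u hu
  refine (injective_iff_map_eq_zero _).1
    (Module.Flat.rTensor_preserves_injective_linearMap (M := B) _ h1) t ?_
  rw [← h]
  refine DFunLike.congr_fun (f := LinearMap.rTensor B (LinearMap.mulLeft k a))
    (g := LinearMap.mulLeft k (a ⊗ₜ[k] (1 : B))) ?_ t
  ext u v
  simp

lemma one_tmul_regular {b : B} (hb : ∀ u, b * u = 0 → u = 0) (t : A ⊗[k] B)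
    (h : (1 : A) ⊗ₜ[k] b * t = 0) : t = 0 := by
  have h1 : Function.Injective (LinearMap.mulLeft k b) :=
    (injective_iff_map_eq_zero _).2 fun u hu => hb u hu
  refine (injective_iff_map_eq_zero _).1
    (Module.Flat.lTensor_preserves_injective_linearMap (M := A) _ h1) t ?_
  rw [← h]
  refine DFunLike.congr_fun (f := LinearMap.lTensor A (LinearMap.mulLeft k b))
    (g := LinearMap.mulLeft k ((1 : A) ⊗ₜ[k] b)) ?_ t
  ext u v
  simp

lemma tmul_regular {a : A} {b : B} (ha : ∀ u, a * u = 0 → u = 0) (hb : ∀ u, b * u = 0 → u = 0)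
    (t : A ⊗[k] B) (h : a ⊗ₜ[k] b * t = 0) : t = 0 := by
  refine one_tmul_regular hb t (tmul_one_regular ha _ ?_)
  rw [← mul_assoc, Algebra.TensorProduct.tmul_mul_tmul, mul_one, one_mul, h]

lemma map_mk_eq_zero_iff_left (f : A) (t : A ⊗[k] B) :
    Algebra.TensorProduct.map (Ideal.Quotient.mkₐ k (Ideal.span {f})) (AlgHom.id k B) t = 0 ↔
      t ∈ Ideal.span {f ⊗ₜ[k] (1 : B)} := by
  rw [← RingHom.mem_ker, Algebra.TensorProduct.rTensor_ker _ (Ideal.Quotient.mkₐ_surjective k _)]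
  have : RingHom.ker (Ideal.Quotient.mkₐ k (Ideal.span {f})) = Ideal.span {f} :=
    Ideal.Quotient.mkₐ_ker k _
  rw [this, Ideal.map_span, Set.image_singleton]
  rfl

lemma map_mk_eq_zero_iff_right (g : B) (t : A ⊗[k] B) :
    Algebra.TensorProduct.map (AlgHom.id k A) (Ideal.Quotient.mkₐ k (Ideal.span {g})) t = 0 ↔
      t ∈ Ideal.span {(1 : A) ⊗ₜ[k] g} := by
  rw [← RingHom.mem_ker, Algebra.TensorProduct.lTensor_ker _ (Ideal.Quotient.mkₐ_surjective k _)]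
  have : RingHom.ker (Ideal.Quotient.mkₐ k (Ideal.span {g})) = Ideal.span {g} :=
    Ideal.Quotient.mkₐ_ker k _
  rw [this, Ideal.map_span, Set.image_singleton]
  rfl

lemma quotient_regular {f g : A} (h : ∀ u, g * u ∈ Ideal.span {f} → u ∈ Ideal.span {f})
    (u : A ⧸ Ideal.span {f}) (hu : Ideal.Quotient.mk (Ideal.span {f}) g * u = 0) : u = 0 := by
  obtain ⟨u, rfl⟩ := Ideal.Quotient.mk_surjective u
  rw [← map_mul, Ideal.Quotient.eq_zero_iff_mem] at hu
  exact Ideal.Quotient.eq_zero_iff_mem.2 (h u hu)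

/-- Two regular pairs `f, g` in `A` and `f', g'` in `B` give a regular pair in the product of the
ideals they generate. -/
lemma IsRegPair.tmul {f g : A} {f' g' : B} (h : IsRegPair f g) (h' : IsRegPair f' g') :
    IsRegPair (f ⊗ₜ[k] f') (g ⊗ₜ[k] f' + f ⊗ₜ[k] g') := by
  have hmul : ∀ (a : A) (b : B), a ⊗ₜ[k] b = a ⊗ₜ[k] (1 : B) * (1 : A) ⊗ₜ[k] b := by simp
  have hL : ∀ t : A ⊗[k] B, g ⊗ₜ[k] f' * t ∈ Ideal.span {f ⊗ₜ[k] (1 : B)} →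
      t ∈ Ideal.span {f ⊗ₜ[k] (1 : B)} := by
    intro t ht
    rw [← map_mk_eq_zero_iff_left] at ht ⊢
    rw [map_mul, Algebra.TensorProduct.map_tmul] at ht
    exact tmul_regular (quotient_regular h.right) h'.left _ ht
  have hR : ∀ t : A ⊗[k] B, f ⊗ₜ[k] g' * t ∈ Ideal.span {(1 : A) ⊗ₜ[k] f'} →
      t ∈ Ideal.span {(1 : A) ⊗ₜ[k] f'} := by
    intro t ht
    rw [← map_mk_eq_zero_iff_right] at ht ⊢
    rw [map_mul, Algebra.TensorProduct.map_tmul] at ht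
    exact tmul_regular h.left (quotient_regular h'.right) _ ht
  have hR' : ∀ t : A ⊗[k] B, f ⊗ₜ[k] (1 : B) * t ∈ Ideal.span {(1 : A) ⊗ₜ[k] f'} →
      t ∈ Ideal.span {(1 : A) ⊗ₜ[k] f'} := by
    intro t ht
    rw [← map_mk_eq_zero_iff_right] at ht ⊢
    rw [map_mul, Algebra.TensorProduct.map_tmul, map_one] at ht
    exact tmul_one_regular h.left _ ht
  have hf : ∀ t : A ⊗[k] B, f ⊗ₜ[k] f' * t ∈ Ideal.span {f ⊗ₜ[k] (1 : B)} := fun t =>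
    Ideal.mem_span_singleton.2 ⟨(1 : A) ⊗ₜ[k] f' * t, by rw [hmul f f', mul_assoc]⟩
  have hf' : ∀ t : A ⊗[k] B, f ⊗ₜ[k] f' * t ∈ Ideal.span {(1 : A) ⊗ₜ[k] f'} := fun t =>
    Ideal.mem_span_singleton.2 ⟨f ⊗ₜ[k] (1 : B) * t, by rw [hmul f f']; ring⟩
  have hg : ∀ t : A ⊗[k] B, f ⊗ₜ[k] g' * t ∈ Ideal.span {f ⊗ₜ[k] (1 : B)} := fun t =>
    Ideal.mem_span_singleton.2 ⟨(1 : A) ⊗ₜ[k] g' * t, by rw [hmul f g', mul_assoc]⟩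
  have hg' : ∀ t : A ⊗[k] B, g ⊗ₜ[k] f' * t ∈ Ideal.span {(1 : A) ⊗ₜ[k] f'} := fun t =>
    Ideal.mem_span_singleton.2 ⟨g ⊗ₜ[k] (1 : B) * t, by rw [hmul g f']; ring⟩
  refine ⟨fun t ht => ?_, fun t ht => ?_⟩
  · exact tmul_regular h.left h'.left t ht
  · obtain ⟨v, hv⟩ := Ideal.mem_span_singleton.1 ht
    have h1 : t ∈ Ideal.span {f ⊗ₜ[k] (1 : B)} := by
      refine hL t ?_
      rw [show g ⊗ₜ[k] f' * t = f ⊗ₜ[k] f' * v - f ⊗ₜ[k] g' * t by rw [← hv]; ring]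
      exact sub_mem (hf v) (hg t)
    have h2 : t ∈ Ideal.span {(1 : A) ⊗ₜ[k] f'} := by
      refine hR t ?_
      rw [show f ⊗ₜ[k] g' * t = f ⊗ₜ[k] f' * v - g ⊗ₜ[k] f' * t by rw [← hv]; ring]
      exact sub_mem (hf' v) (hg' t)
    obtain ⟨t1, rfl⟩ := Ideal.mem_span_singleton.1 h1
    obtain ⟨t2, rfl⟩ := Ideal.mem_span_singleton.1 (hR' t1 h2)
    exact Ideal.mem_span_singleton.2 ⟨t2, by rw [hmul f f', mul_assoc]⟩

end TensorRegular

/-! ### Vanishing in cohomological degrees zero and one -/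

section LowDegree

variable {A : Type*} [CommRing A] {ι : Type*} [DecidableEq ι] [Fintype ι] {w : ι → A} {rk : ι → ℕ}
  {X : Set ι} {U : Set (Finset ι)}

lemma exists_pow_smul_eq_cubeD (hrk : Function.Injective rk) (hU : U.OrdConnected)
    (hX : ∀ i ∈ X, ∀ K, K ∈ U ↔ insert i K ∈ U) {c : Cube w} (hc : CubeSupp U c)
    (hdc : IsCubeCocycle rk U c) {f : A} (hf : f ∈ (Ideal.span (w '' X)).radical) :
    ∃ (N : ℕ) (b : Cube w), CubeSupp U b ∧ ∀ K ∈ U, cubeD w rk b K = (f ^ N • c) K := by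
  let Q : Ideal A :=
    { carrier := {a | ∃ b : Cube w, CubeSupp U b ∧ ∀ K ∈ U, cubeD w rk b K = (a • c) K}
      zero_mem' := ⟨0, fun _ _ => rfl, fun K _ => by rw [zero_smul, map_zero]⟩
      add_mem' := by
        rintro a a' ⟨b, hb, hd⟩ ⟨b', hb', hd'⟩
        exact ⟨b + b', hb.add hb', fun K hK => by
          rw [add_smul, map_add, Pi.add_apply, Pi.add_apply, hd K hK, hd' K hK]⟩
      smul_mem' := by
        rintro a a' ⟨b, hb, hd⟩
        exact ⟨a • b, hb.smul a, fun K hK => by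
          rw [map_smul, smul_assoc, Pi.smul_apply, Pi.smul_apply, hd K hK]⟩ }
  have h1 : Ideal.span (w '' X) ≤ Q.radical := by
    rw [Ideal.span_le]
    rintro _ ⟨i, hi, rfl⟩
    obtain ⟨n, b, hb, hd⟩ := exists_smul_sub_cubeD_mem (w := w) hrk hU (hX i hi) ⊥ hc
      fun K hK => by rw [hdc K hK]; exact zero_mem _
    refine ⟨n, b, hb, fun K hK => ?_⟩
    have := hd K hK
    rw [Ideal.map_bot, Ideal.mem_bot, sub_eq_zero] at this
    exact this.symm
  exact Ideal.radical_le_radical_iff.2 h1 hf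

lemma smul_cancel {f : A} (hf : ∀ u, f * u = 0 → u = 0) {c : Cube w} (h : f • c = 0) : c = 0 :=
  cubeMem_bot_iff.1 (CubeMem.of_smul (f := f) (fun u hu => by simpa using hf u (by simpa using hu))
    (cubeMem_bot_iff.2 h))

lemma pow_smul_cancel {f : A} (hf : ∀ u, f * u = 0 → u = 0) (N : ℕ) {c : Cube w}
    (h : f ^ N • c = 0) : c = 0 := by
  induction N with
  | zero => simpa using h
  | succ N ih => exact ih (smul_cancel hf (by rwa [smul_smul, ← pow_succ']))

lemma eq_zero_of_isCubeCocycle (hrk : Function.Injective rk) (hU : U.OrdConnected)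
    (hX : ∀ i ∈ X, ∀ K, K ∈ U ↔ insert i K ∈ U) {f : A}
    (hf : f ∈ (Ideal.span (w '' X)).radical) (hf' : ∀ u, f * u = 0 → u = 0)
    {c : Cube w} (hc : CubeSupp U c) (hc0 : CubeSupp (cardSet ι 0) c)
    (hdc : IsCubeCocycle rk U c) : c = 0 := by
  obtain ⟨N, b, hb, hd⟩ := exists_pow_smul_eq_cubeD hrk hU hX hc hdc hf
  refine pow_smul_cancel hf' N (funext fun K => ?_)
  by_cases hK : K ∈ U
  · by_cases hK0 : K.card = 0
    · obtain rfl := Finset.card_eq_zero.1 hK0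
      rw [← hd _ hK, cubeD_apply, Finset.sum_empty]
      rfl
    · rw [Pi.smul_apply, hc0 K hK0, smul_zero]; rfl
  · rw [Pi.smul_apply, hc K hK, smul_zero]; rfl

lemma IsRegPair.exists_eq_pow_smul {f g : A} (h : IsRegPair f g) (N M : ℕ) {b b' : Cube w}
    (hb : g ^ M • b = f ^ N • b') : ∃ b'' : Cube w, b = f ^ N • b'' := by
  induction N generalizing b b' with
  | zero => exact ⟨b, by simp⟩
  | succ N ih =>
    have h1 : ∀ M : ℕ, CubeMem (Ideal.span {f}) (g ^ M • b) → CubeMem (Ideal.span {f}) b := by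
      intro M
      induction M with
      | zero => intro h; simpa using h
      | succ M ihM =>
        intro h2
        exact ihM (CubeMem.of_smul h.right (by rwa [smul_smul, ← pow_succ']))
    have h2 : CubeMem (Ideal.span {f}) b := by
      refine h1 M ?_
      rw [hb, pow_succ', ← smul_smul]
      exact CubeMem.smul_of_mem (Ideal.mem_span_singleton_self f) _
    obtain ⟨b1, hb1⟩ := CubeMem.exists_add_smul (I := ⊥) (f := f) (by rwa [bot_sup_eq])
    rw [cubeMem_bot_iff, sub_eq_zero] at hb1
    subst hb1
    have h3 : g ^ M • b1 = f ^ N • b' := by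
      rw [← sub_eq_zero]
      refine smul_cancel h.left ?_
      rw [smul_sub, sub_eq_zero, smul_smul, smul_smul, ← pow_succ', ← hb, smul_smul, mul_comm]
    obtain ⟨b2, rfl⟩ := ih h3
    exact ⟨b2, by rw [smul_smul, ← pow_succ']⟩

lemma IsRegPair.isCubeCobound (hrk : Function.Injective rk) (hU : U.OrdConnected)
    (hX : ∀ i ∈ X, ∀ K, K ∈ U ↔ insert i K ∈ U) {f g : A} (h : IsRegPair f g)
    (hf : f ∈ (Ideal.span (w '' X)).radical) (hg : g ∈ (Ideal.span (w '' X)).radical)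
    {c : Cube w} (hc : CubeSupp U c) (hc1 : CubeSupp (cardSet ι 1) c)
    (hdc : IsCubeCocycle rk U c) : IsCubeCobound rk U c := by
  have H : ∀ f ∈ (Ideal.span (w '' X)).radical, ∃ (N : ℕ) (b : Cube w), CubeSupp U b ∧
      CubeSupp (cardSet ι 0) b ∧ ∀ K ∈ U, cubeD w rk b K = (f ^ N • c) K := by
    intro f hf
    obtain ⟨N, b, hb, hd⟩ := exists_pow_smul_eq_cubeD hrk hU hX hc hdc hf
    obtain ⟨b', h1, h2, h3⟩ := IsCubeCobound.card (j := 0) (c := f ^ N • c) ⟨b, hb, hd⟩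
      (hc1.smul _)
    exact ⟨N, b', h2, h1, h3⟩
  obtain ⟨N, b, hb, hb0, hd⟩ := H f hf
  obtain ⟨M, b', hb', hb0', hd'⟩ := H g hg
  have h1 : g ^ M • b = f ^ N • b' := by
    rw [← sub_eq_zero]
    refine eq_zero_of_isCubeCocycle hrk hU hX hf h.left ((hb.smul _).sub (hb'.smul _))
      ((hb0.smul _).sub (hb0'.smul _)) fun K hK => ?_
    rw [map_sub, map_smul, map_smul, Pi.sub_apply, Pi.smul_apply, Pi.smul_apply, hd K hK, hd' K hK,
      Pi.smul_apply, Pi.smul_apply, smul_comm, sub_self]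
  obtain ⟨b'', hb''⟩ := h.exists_eq_pow_smul N M h1
  have h2 : CubeSupp U b'' := by
    have h3 : f ^ N • (b'' - cubeRestr w U b'') = 0 := by
      rw [smul_sub, ← map_smul, ← hb'', hb.restr_eq, sub_self]
    have h4 := sub_eq_zero.1 (pow_smul_cancel h.left N h3)
    rw [h4]
    exact cubeSupp_restr _ _
  refine ⟨b'', h2, ?_⟩
  have h3 : f ^ N • (cubeRestr w U (cubeD w rk b'') - c) = 0 := by
    funext K
    by_cases hK : K ∈ U
    · rw [smul_sub, ← map_smul, ← map_smul, ← hb'', Pi.sub_apply, cubeRestr_apply_of_mem hK,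
        hd K hK, sub_self]
      rfl
    · rw [Pi.smul_apply, Pi.sub_apply, cubeRestr_apply_of_notMem hK, hc K hK, sub_zero, smul_zero]
      rfl
  have h4 := sub_eq_zero.1 (pow_smul_cancel h.left N h3)
  intro K hK
  rw [← h4, cubeRestr_apply_of_mem hK]

end LowDegree

end SegreF

end

end

section
open scoped TensorProduct
noncomputable section

set_option linter.unusedSectionVars false

namespace SegreF

/-! ### The dimension of a Segre product -/

section Dimension

variable {k A B : Type*} [Field k] [CommRing A] [Algebra k A] [CommRing B] [Algebra k B]

lemma transcendental_C_mul_X {σ : Type*} (i : σ) :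
    AlgebraicIndependent k (fun o : Option σ => o.elim
      (Polynomial.C (MvPolynomial.X i) * Polynomial.X : Polynomial (MvPolynomial σ k))
      (fun l => Polynomial.C (MvPolynomial.X l))) := by
  have h1 : AlgebraicIndependent k
      (fun l : σ => (Polynomial.C (MvPolynomial.X l) : Polynomial (MvPolynomial σ k))) :=
    (MvPolynomial.algebraicIndependent_X σ k).map' (f := (Polynomial.CAlgHom (R := k)))
      Polynomial.C_injective
  rw [h1.option_iff_transcendental]
  have h2 : Transcendental (MvPolynomial σ k)
      (Polynomial.C (MvPolynomial.X i) * Polynomial.X : Polynomial (MvPolynomial σ k)) := by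
    have h3 : (MvPolynomial.X i : MvPolynomial σ k) ≠ 0 := MvPolynomial.X_ne_zero i
    refine Polynomial.transcendental _ ?_ ?_
    · rw [Polynomial.natDegree_C_mul_X _ h3]; exact one_ne_zero
    · simp
  refine Transcendental.of_ringHom_of_comp_eq (h1.aevalEquiv.symm : _ →+* MvPolynomial σ k)
    (RingHom.id _) (a := Polynomial.C (MvPolynomial.X i) * Polynomial.X) h2
    h1.aevalEquiv.symm.injective ?_
  refine RingHom.ext fun u => ?_
  obtain ⟨v, rfl⟩ := h1.aevalEquiv.surjective u
  have h3 : (MvPolynomial.aeval fun l : σ => (Polynomial.C (MvPolynomial.X l) :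
      Polynomial (MvPolynomial σ k))) = Polynomial.CAlgHom (R := k) :=
    MvPolynomial.algHom_ext fun l => by simp
  refine Eq.trans ?_ (h1.algebraMap_aevalEquiv v).symm
  rw [h3]
  exact congrArg Polynomial.C (h1.aevalEquiv.symm_apply_apply v)

lemma AlgebraicIndependent.tmul_option {σ : Type*} {a : σ → A} {b : Fin 2 → B}
    (ha : AlgebraicIndependent k a) (hb : AlgebraicIndependent k b) (i : σ) :
    AlgebraicIndependent k (fun o : Option σ => o.elim (a i ⊗ₜ[k] b 1) fun l => a l ⊗ₜ[k] b 0) := by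
  have h1 : AlgebraicIndependent k (fun o : Option σ => o.elim
      ((MvPolynomial.X i : MvPolynomial σ k) ⊗ₜ[k] (MvPolynomial.X 1 : MvPolynomial (Fin 2) k))
      fun l => MvPolynomial.X l ⊗ₜ[k] MvPolynomial.X 0) := by
    refine AlgebraicIndependent.of_comp (Algebra.TensorProduct.lift
      (Polynomial.CAlgHom (R := k) (A := MvPolynomial σ k))
      (MvPolynomial.aeval ![1, Polynomial.X]) (fun _ _ => Commute.all _ _)) ?_
    convert transcendental_C_mul_X (k := k) i using 1
    funext o
    cases o <;> simp
  have h2 : Function.Injective (Algebra.TensorProduct.map (MvPolynomial.aeval (R := k) a)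
      (MvPolynomial.aeval (R := k) b)) :=
    TensorProduct.map_injective_of_flat_flat (MvPolynomial.aeval (R := k) a).toLinearMap
      (MvPolynomial.aeval (R := k) b).toLinearMap ha hb
  convert h1.map' h2 using 1
  · funext o
    cases o <;> simp
  · rfl

variable {𝒜 : ℕ → Submodule k A} [GradedAlgebra 𝒜] {ℬ : ℕ → Submodule k B} [GradedAlgebra ℬ]
  {r s : ℕ} {x : Fin r → A} {y : Fin s → B}

lemma segrePart_le_segre (n : ℕ) : segrePart 𝒜 ℬ n ≤ (segre 𝒜 ℬ).toSubmodule :=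
  fun _ h => Submodule.mem_iSup_of_mem n h

lemma adjoin_eq_segre (hA : IsStandardGraded 𝒜) (hB : IsStandardGraded ℬ)
    (hx : IsLinearGenerators x 𝒜) (hy : IsLinearGenerators y ℬ) :
    Algebra.adjoin k (Set.range fun l : Fin r × Fin s => x l.1 ⊗ₜ[k] y l.2) = segre 𝒜 ℬ := by
  refine le_antisymm (Algebra.adjoin_le ?_) ?_
  · rintro _ ⟨l, rfl⟩
    exact segrePart_le_segre 1 (tmul_mem_segrePart (hx.1 _) (hy.1 _))
  have h1 : ∀ u ∈ 𝒜 1, ∀ v ∈ ℬ 1, u ⊗ₜ[k] v ∈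
      Algebra.adjoin k (Set.range fun l : Fin r × Fin s => x l.1 ⊗ₜ[k] y l.2) := by
    intro u hu v hv
    have hu' := hA.degree_one_le_span hx hu
    have hv' := hB.degree_one_le_span hy hv
    clear hu hv
    induction hu' using Submodule.span_induction with
    | mem u h =>
      obtain ⟨i, rfl⟩ := h
      induction hv' using Submodule.span_induction with
      | mem v h =>
        obtain ⟨j, rfl⟩ := h
        exact Algebra.subset_adjoin ⟨(i, j), rfl⟩
      | zero => rw [TensorProduct.tmul_zero]; exact zero_mem _
      | add v v' hv hv' h h' =>
        rw [TensorProduct.tmul_add]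
        exact add_mem h h'
      | smul c v hv h =>
        rw [TensorProduct.tmul_smul]
        exact Subalgebra.smul_mem _ h c
    | zero => rw [TensorProduct.zero_tmul]; exact zero_mem _
    | add u u' hu hu' h h' =>
      rw [TensorProduct.add_tmul]
      exact add_mem h h'
    | smul c u hu h =>
      rw [← TensorProduct.smul_tmul']
      exact Subalgebra.smul_mem _ h c
  have h2 : ∀ n : ℕ, ∀ u ∈ (𝒜 1) ^ n, ∀ v ∈ (ℬ 1) ^ n, u ⊗ₜ[k] v ∈
      Algebra.adjoin k (Set.range fun l : Fin r × Fin s => x l.1 ⊗ₜ[k] y l.2) := by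
    intro n
    induction n with
    | zero =>
      intro u hu v hv
      rw [pow_zero] at hu hv
      obtain ⟨c, rfl⟩ := Submodule.mem_one.1 hu
      obtain ⟨c', rfl⟩ := Submodule.mem_one.1 hv
      rw [Algebra.algebraMap_eq_smul_one, Algebra.algebraMap_eq_smul_one, TensorProduct.smul_tmul_smul]
      exact Subalgebra.smul_mem _ (one_mem _) _
    | succ n ih =>
      intro u hu v hv
      rw [pow_succ] at hu hv
      induction hu using Submodule.mul_induction_on' with
      | mem_mul_mem u hu u' hu' =>
        induction hv using Submodule.mul_induction_on' with
        | mem_mul_mem v hv v' hv' =>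
          rw [← Algebra.TensorProduct.tmul_mul_tmul]
          exact mul_mem (ih u hu v hv) (h1 u' hu' v' hv')
        | add v _ v' _ h h' => rw [TensorProduct.tmul_add]; exact add_mem h h'
      | add u _ u' _ h h' => rw [TensorProduct.add_tmul]; exact add_mem h h'
  have h3 : (⨆ n, segrePart 𝒜 ℬ n) ≤ Subalgebra.toSubmodule
      (Algebra.adjoin k (Set.range fun l : Fin r × Fin s => x l.1 ⊗ₜ[k] y l.2)) :=
    iSup_le fun n => segrePart_le fun a ha b hb => h2 n a (hA.le_pow n ha) b (hB.le_pow n hb)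
  exact fun t ht => h3 ht

lemma segre_finiteType (hA : IsStandardGraded 𝒜) (hB : IsStandardGraded ℬ)
    (hx : IsLinearGenerators x 𝒜) (hy : IsLinearGenerators y ℬ) :
    Algebra.FiniteType k (segre 𝒜 ℬ) := by
  rw [← Subalgebra.fg_iff_finiteType, Subalgebra.fg_def]
  exact ⟨_, Set.finite_range _, adjoin_eq_segre hA hB hx hy⟩

lemma succ_le_ringKrullDim_segre_left (hA : IsStandardGraded 𝒜) (hB : IsStandardGraded ℬ)
    (hx : IsLinearGenerators x 𝒜) (hy : IsLinearGenerators y ℬ) {d : ℕ} (hd : 0 < d)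
    (hdA : (d : WithBot ℕ∞) ≤ ringKrullDim A) (hdB : 2 ≤ ringKrullDim B) :
    ((d + 1 : ℕ) : WithBot ℕ∞) ≤ ringKrullDim (segre 𝒜 ℬ) := by
  have := hA.finiteType hx
  have := hB.finiteType hy
  have := segre_finiteType hA hB hx hy
  obtain ⟨f, hf, hfi⟩ := exists_algebraicIndependent_mem (hA.adjoin_range hx) hdA
  obtain ⟨g, hg, hgi⟩ := exists_algebraicIndependent_mem (hB.adjoin_range hy) (n := 2) hdB
  have h1 : ∀ i, f i ∈ 𝒜 1 := fun i => by obtain ⟨l, hl⟩ := hf i; rw [← hl]; exact hx.1 l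
  have h2 : ∀ i, g i ∈ ℬ 1 := fun i => by obtain ⟨l, hl⟩ := hg i; rw [← hl]; exact hy.1 l
  have h3 := (AlgebraicIndependent.tmul_option hfi hgi ⟨0, hd⟩).comp _ (finSuccEquiv d).injective
  refine le_ringKrullDim_of_algebraicIndependent (f := fun i => (⟨_, segrePart_le_segre 1
    (?_ : (fun o : Option (Fin d) => o.elim (f ⟨0, hd⟩ ⊗ₜ[k] g 1) fun l => f l ⊗ₜ[k] g 0)
      (finSuccEquiv d i) ∈ segrePart 𝒜 ℬ 1)⟩ : segre 𝒜 ℬ))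
    (AlgebraicIndependent.of_comp (segre 𝒜 ℬ).val h3)
  cases finSuccEquiv d i <;> exact tmul_mem_segrePart (h1 _) (h2 _)

lemma succ_le_ringKrullDim_segre_right (hA : IsStandardGraded 𝒜) (hB : IsStandardGraded ℬ)
    (hx : IsLinearGenerators x 𝒜) (hy : IsLinearGenerators y ℬ) {e : ℕ} (he : 0 < e)
    (hdA : 2 ≤ ringKrullDim A) (hdB : (e : WithBot ℕ∞) ≤ ringKrullDim B) :
    ((e + 1 : ℕ) : WithBot ℕ∞) ≤ ringKrullDim (segre 𝒜 ℬ) := by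
  have := hA.finiteType hx
  have := hB.finiteType hy
  have := segre_finiteType hA hB hx hy
  obtain ⟨f, hf, hfi⟩ := exists_algebraicIndependent_mem (hA.adjoin_range hx) (n := 2) hdA
  obtain ⟨g, hg, hgi⟩ := exists_algebraicIndependent_mem (hB.adjoin_range hy) hdB
  have h1 : ∀ i, f i ∈ 𝒜 1 := fun i => by obtain ⟨l, hl⟩ := hf i; rw [← hl]; exact hx.1 l
  have h2 : ∀ i, g i ∈ ℬ 1 := fun i => by obtain ⟨l, hl⟩ := hg i; rw [← hl]; exact hy.1 l
  have h3 := ((AlgebraicIndependent.tmul_option hgi hfi ⟨0, he⟩).map'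
    (f := (Algebra.TensorProduct.comm k B A : B ⊗[k] A →ₐ[k] A ⊗[k] B))
    (Algebra.TensorProduct.comm k B A).injective).comp _ (finSuccEquiv e).injective
  refine le_ringKrullDim_of_algebraicIndependent (f := fun i => (⟨_, segrePart_le_segre 1
    (?_ : Algebra.TensorProduct.comm k B A ((fun o : Option (Fin e) =>
      o.elim (g ⟨0, he⟩ ⊗ₜ[k] f 1) fun l => g l ⊗ₜ[k] f 0)
      (finSuccEquiv e i)) ∈ segrePart 𝒜 ℬ 1)⟩ : segre 𝒜 ℬ))
    (AlgebraicIndependent.of_comp (segre 𝒜 ℬ).val h3)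
  cases finSuccEquiv e i <;> exact tmul_mem_segrePart (h1 _) (h2 _)

lemma adjoin_tensor_eq_top {X : Set A} {Y : Set B} (hX : Algebra.adjoin k X = ⊤)
    (hY : Algebra.adjoin k Y = ⊤) :
    Algebra.adjoin k ((Algebra.TensorProduct.includeLeft : A →ₐ[k] A ⊗[k] B) '' X ∪
      (Algebra.TensorProduct.includeRight : B →ₐ[k] A ⊗[k] B) '' Y) = ⊤ := by
  rw [eq_top_iff, ← Algebra.TensorProduct.adjoin_tmul_eq_top]
  refine Algebra.adjoin_le ?_
  rintro _ ⟨a, b, rfl⟩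
  rw [show a ⊗ₜ[k] b = a ⊗ₜ[k] (1 : B) * (1 : A) ⊗ₜ[k] b by simp]
  refine mul_mem (Algebra.adjoin_mono Set.subset_union_left ?_)
    (Algebra.adjoin_mono Set.subset_union_right ?_)
  · have h : a ∈ Algebra.adjoin k X := by rw [hX]; trivial
    rw [← AlgHom.map_adjoin (Algebra.TensorProduct.includeLeft : A →ₐ[k] A ⊗[k] B) X]
    exact ⟨a, h, rfl⟩
  · have h : b ∈ Algebra.adjoin k Y := by rw [hY]; trivial
    rw [← AlgHom.map_adjoin (Algebra.TensorProduct.includeRight : B →ₐ[k] A ⊗[k] B) Y]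
    exact ⟨b, h, rfl⟩

lemma le_add_of_le_ringKrullDim_tensor [Algebra.FiniteType k A] [Algebra.FiniteType k B]
    {d e n : ℕ} (hd : ringKrullDim A = d) (he : ringKrullDim B = e)
    (hn : (n : WithBot ℕ∞) ≤ ringKrullDim (A ⊗[k] B)) : n ≤ d + e := by
  classical
  have : Algebra.FiniteType k (A ⊗[k] B) := .trans (S := A) inferInstance inferInstance
  obtain ⟨f, hf, hfi⟩ := exists_algebraicIndependent_mem (adjoin_tensor_eq_top
    (X := (Set.univ : Set A)) (Y := (Set.univ : Set B)) (by simp) (by simp)) hn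
  let s : Finset (Fin n) := Finset.univ.filter fun i => f i ∈ Set.range fun a => a ⊗ₜ[k] (1 : B)
  have h1 : s.card ≤ d := by
    have h2 : ∀ i : s, ∃ a, a ⊗ₜ[k] (1 : B) = f i := fun i => (Finset.mem_filter.1 i.2).2
    choose a ha using h2
    have h3 : AlgebraicIndependent k (a ∘ s.equivFin.symm) := by
      refine AlgebraicIndependent.of_comp
        (Algebra.TensorProduct.includeLeft : A →ₐ[k] A ⊗[k] B) ?_
      convert hfi.comp (fun i => (s.equivFin.symm i : Fin n))
        (Subtype.val_injective.comp s.equivFin.symm.injective) using 1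
      · funext i
        exact ha _
      · rfl
    have := le_ringKrullDim_of_algebraicIndependent h3
    rw [hd] at this
    exact_mod_cast this
  have h1' : sᶜ.card ≤ e := by
    have h2 : ∀ i : (sᶜ : Finset (Fin n)), ∃ b, (1 : A) ⊗ₜ[k] b = f i := by
      intro i
      have h3 : f i ∉ Set.range fun a => a ⊗ₜ[k] (1 : B) := by
        have := Finset.mem_compl.1 i.2
        simpa [s] using this
      rcases hf i with ⟨a, -, ha⟩ | ⟨b, -, hb⟩
      · exact absurd ⟨a, ha⟩ h3
      · exact ⟨b, hb⟩
    choose a ha using h2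
    have h3 : AlgebraicIndependent k (a ∘ (sᶜ).equivFin.symm) := by
      refine AlgebraicIndependent.of_comp
        (Algebra.TensorProduct.includeRight : B →ₐ[k] A ⊗[k] B) ?_
      convert hfi.comp (fun i => ((sᶜ).equivFin.symm i : Fin n))
        (Subtype.val_injective.comp (sᶜ).equivFin.symm.injective) using 1
      funext i
      exact ha _
    have := le_ringKrullDim_of_algebraicIndependent h3
    rw [he] at this
    exact_mod_cast this
  have := s.card_add_card_compl
  rw [Fintype.card_fin] at this
  omega

lemma segre_le_homog {t : A ⊗[k] B} (ht : t ∈ segre 𝒜 ℬ) :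
    t ∈ homog (tensorCoaction 𝒜 ℬ 1 (-1)) 0 := by
  refine Submodule.iSup_induction _ (motive := fun t => t ∈ homog (tensorCoaction 𝒜 ℬ 1 (-1)) 0)
    ht (fun n t ht => ?_) (zero_mem _) fun _ _ => add_mem
  simpa using segrePart_le_homog 1 (-1) ht

lemma transcendental_segre {a : A} {c : ℕ} (hc : 0 < c) (ha : a ∈ 𝒜 c)
    (hreg : ∀ u, a * u = 0 → u = 0) {S : Subalgebra k (A ⊗[k] B)} (hS : S ≤ segre 𝒜 ℬ) :
    Transcendental S (a ⊗ₜ[k] (1 : B)) := by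
  rw [transcendental_iff]
  intro P hP
  have ha' : a ⊗ₜ[k] (1 : B) ∈ homog (tensorCoaction 𝒜 ℬ 1 (-1)) c := by
    simpa using tmul_mem_homog 1 (-1) ha (SetLike.GradedOne.one_mem (A := ℬ))
  rw [Polynomial.aeval_eq_sum_range] at hP
  ext i
  rw [Polynomial.coeff_zero, ZeroMemClass.coe_zero]
  have h1 : ∀ l : ℕ, P.coeff l • (a ⊗ₜ[k] (1 : B)) ^ l ∈ homog (tensorCoaction 𝒜 ℬ 1 (-1)) (l * c) := by
    intro l
    rw [Algebra.smul_def]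
    have := homog_mul_mem (segre_le_homog (hS (P.coeff l).2)) (homog_pow_mem ha' l)
    rwa [zero_add] at this
  have h2 : (P.coeff i : A ⊗[k] B) * (a ⊗ₜ[k] (1 : B)) ^ i = 0 := by
    by_cases hi : i ∈ Finset.range (P.natDegree + 1)
    · have h3 := congrArg (homogProj (tensorCoaction 𝒜 ℬ 1 (-1)) (i * c)) hP
      rw [map_sum, map_zero, Finset.sum_eq_single_of_mem i hi, homogProj_of_mem (h1 i),
        if_pos rfl] at h3
      · exact h3
      · intro l _ hl
        rw [homogProj_of_mem (h1 l), if_neg]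
        intro h
        exact hl (by exact_mod_cast mul_right_cancel₀ (by exact_mod_cast hc.ne') h)
    · rw [Polynomial.coeff_eq_zero_of_natDegree_lt (by simpa using hi), ZeroMemClass.coe_zero,
        zero_mul]
  rw [Algebra.TensorProduct.tmul_pow, one_pow, mul_comm] at h2
  refine tmul_one_regular (a := a ^ i) ?_ _ h2
  clear h2
  intro u h
  induction i with
  | zero => simpa using h
  | succ i ih => exact ih (hreg _ (by rwa [← mul_assoc, ← pow_succ']))

lemma ringKrullDim_segre_lt [IsNoetherianRing A] (hA : IsStandardGraded 𝒜) (hB : IsStandardGraded ℬ)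
    (hx : IsLinearGenerators x 𝒜) (hy : IsLinearGenerators y ℬ) (hdA : 2 ≤ depth 𝒜) {d e n : ℕ}
    (hd : ringKrullDim A = d) (he : ringKrullDim B = e)
    (hn : (n : WithBot ℕ∞) ≤ ringKrullDim (segre 𝒜 ℬ)) : n + 1 ≤ d + e := by
  have := hA.finiteType hx
  have := hB.finiteType hy
  have := segre_finiteType hA hB hx hy
  have : Algebra.FiniteType k (A ⊗[k] B) := .trans (S := A) inferInstance inferInstance
  obtain ⟨f, hf, hfi⟩ := exists_algebraicIndependent_mem (X := (Set.univ : Set (segre 𝒜 ℬ)))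
    (Algebra.adjoin_univ k _) hn
  obtain ⟨f0, g0, hf0, -, hreg0⟩ := exists_isRegPair hdA
  obtain ⟨c, hc, a, ha, hreg⟩ := exists_homogeneous_regular hx.1 (I := ⊥) (by
    intro u hu
    refine hreg0.left u ?_
    have h1 : f0 ∈ Ideal.span (Set.range x) := by rw [hx.2]; exact hf0
    have h2 : Ideal.span (Set.range x) ≤ LinearMap.ker (LinearMap.toSpanSingleton A A u) := by
      rw [Ideal.span_le]
      rintro _ ⟨i, rfl⟩
      exact hu i
    exact h2 h1)
  have h1 : AlgebraicIndependent k (fun i => (f i : A ⊗[k] B)) :=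
    hfi.map' (f := (segre 𝒜 ℬ).val) Subtype.val_injective
  have h2 := (h1.option_iff_transcendental (a ⊗ₜ[k] (1 : B))).2
    (transcendental_segre hc ha hreg (Algebra.adjoin_le (by
      rintro _ ⟨i, rfl⟩; exact (f i).2)))
  have h3 := le_ringKrullDim_of_algebraicIndependent (h2.comp _ (finSuccEquiv n).injective)
  exact le_add_of_le_ringKrullDim_tensor hd he h3

end Dimension

end SegreF

end

end

section
open scoped TensorProduct
noncomputable section

set_option linter.unusedSectionVars false

namespace SegreF

/-! ### The Künneth formula over a field -/

section Kunneth

variable {k V W : Type*} [Field k] [AddCommGroup V] [Module k V] [AddCommGroup W] [Module k W]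

/-- The differential of the tensor product of two complexes, `ε` being the sign operator. -/
def tensorD (dV ε : V →ₗ[k] V) (dW : W →ₗ[k] W) : V ⊗[k] W →ₗ[k] V ⊗[k] W :=
  TensorProduct.map dV LinearMap.id + TensorProduct.map ε dW

lemma tensorD_tmul (dV ε : V →ₗ[k] V) (dW : W →ₗ[k] W) (v : V) (u : W) :
    tensorD dV ε dW (v ⊗ₜ u) = dV v ⊗ₜ u + ε v ⊗ₜ dW u := by
  simp [tensorD]

/-- A linear map over a field has a generalized inverse. -/
lemma exists_generalized_inverse (d : W →ₗ[k] W) : ∃ h : W →ₗ[k] W, d ∘ₗ h ∘ₗ d = d := by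
  obtain ⟨s, hs⟩ := LinearMap.exists_rightInverse_of_surjective d.rangeRestrict
    d.range_rangeRestrict
  obtain ⟨h, hh⟩ := LinearMap.exists_extend s
  refine ⟨h, LinearMap.ext fun u => ?_⟩
  have h1 : h (d u) = s (d.rangeRestrict u) := DFunLike.congr_fun hh (d.rangeRestrict u)
  have h2 := congrArg Subtype.val (DFunLike.congr_fun hs (d.rangeRestrict u))
  rw [LinearMap.comp_apply, LinearMap.comp_apply, h1]
  exact h2

/-- A cocycle of a tensor product of complexes is cohomologous to a sum of products of
cocycles. -/
lemma exists_sum_cocycles {dV ε : V →ₗ[k] V} {dW : W →ₗ[k] W} (hε : ε ∘ₗ ε = LinearMap.id)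
    (hεd : ε ∘ₗ dV = - (dV ∘ₗ ε)) (hW : dW ∘ₗ dW = 0) {v : V ⊗[k] W}
    (hv : tensorD dV ε dW v = 0) :
    ∃ (v' : V ⊗[k] W) (n : ℕ) (c : Fin n → V) (u : Fin n → W), (∀ i, dV (c i) = 0) ∧
      (∀ i, dW (u i) = 0) ∧ v = tensorD dV ε dW v' + ∑ i, c i ⊗ₜ u i := by
  obtain ⟨h, hh⟩ := exists_generalized_inverse dW
  let P : W →ₗ[k] W := LinearMap.id - dW ∘ₗ h - h ∘ₗ dW
  have hP : dW ∘ₗ P = 0 := by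
    rw [show P = LinearMap.id - dW ∘ₗ h - h ∘ₗ dW from rfl, LinearMap.comp_sub, LinearMap.comp_sub,
      hh, ← LinearMap.comp_assoc, hW, LinearMap.zero_comp, LinearMap.comp_id, sub_zero, sub_self]
  have hP' : P ∘ₗ dW = 0 := by
    rw [show P = LinearMap.id - dW ∘ₗ h - h ∘ₗ dW from rfl, LinearMap.sub_comp, LinearMap.sub_comp,
      LinearMap.comp_assoc, hh, LinearMap.comp_assoc, hW, LinearMap.comp_zero, LinearMap.id_comp,
      sub_zero, sub_self]
  let s : V ⊗[k] W →ₗ[k] V ⊗[k] W := TensorProduct.map ε h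
  let Q : V ⊗[k] W →ₗ[k] V ⊗[k] W := TensorProduct.map LinearMap.id P
  have key : ∀ t, t = tensorD dV ε dW (s t) + s (tensorD dV ε dW t) + Q t := by
    intro t
    induction t with
    | zero => simp
    | add t t' ht ht' =>
      conv_lhs => rw [ht, ht']
      simp only [map_add]
      abel
    | tmul v u =>
      have h1 : ∀ v, ε (ε v) = v := fun v => DFunLike.congr_fun hε v
      have h2 : ε (dV v) = - dV (ε v) := DFunLike.congr_fun hεd v
      simp only [s, Q, P, TensorProduct.map_tmul, tensorD_tmul, map_add, h1, h2,
        LinearMap.sub_apply, LinearMap.comp_apply, LinearMap.id_apply, TensorProduct.neg_tmul,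
        TensorProduct.tmul_sub]
      abel
  have hQ : ∀ t, tensorD dV ε dW (Q t) = TensorProduct.map dV LinearMap.id (Q t) := by
    intro t
    rw [tensorD, LinearMap.add_apply, add_eq_left]
    change TensorProduct.map ε dW (TensorProduct.map LinearMap.id P t) = 0
    rw [TensorProduct.map_map, hP, TensorProduct.map_zero_right, LinearMap.zero_apply]
  have hQ' : ∀ t, Q (tensorD dV ε dW t) = TensorProduct.map dV LinearMap.id (Q t) := by
    intro t
    induction t with
    | zero => simp
    | add t t' ht ht' => simp only [map_add, ht, ht']
    | tmul v u =>
      have h1 : P (dW u) = 0 := DFunLike.congr_fun hP' u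
      simp [Q, tensorD_tmul, h1]
  have h1 : v = tensorD dV ε dW (s v) + Q v := by
    conv_lhs => rw [key v, hv, map_zero, add_zero]
  have h2 : TensorProduct.map dV LinearMap.id (Q v) = 0 := by rw [← hQ', hv, map_zero]
  have h3 : Q v = tensorD dV ε dW (s (Q v)) + Q (Q v) := by
    conv_lhs => rw [key (Q v), hQ, h2, map_zero, add_zero]
  have h4 : ∃ z : LinearMap.ker dV ⊗[k] W,
      TensorProduct.map (LinearMap.ker dV).subtype LinearMap.id z = Q v :=
    (Module.Flat.rTensor_exact W (f := (LinearMap.ker dV).subtype) (g := dV)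
      (LinearMap.exact_subtype_ker_map dV) (Q v)).1 h2
  obtain ⟨z, hz⟩ := h4
  have h5 : ∀ z : LinearMap.ker dV ⊗[k] W, ∃ (n : ℕ) (c : Fin n → LinearMap.ker dV)
      (u : Fin n → W), z = ∑ i, c i ⊗ₜ u i := by
    intro z
    obtain ⟨S, h⟩ := TensorProduct.exists_finset z
    refine ⟨S.card, fun i => (S.equivFin.symm i).1.1, fun i => (S.equivFin.symm i).1.2, ?_⟩
    rw [h, ← Finset.sum_coe_sort]
    exact (Equiv.sum_comp S.equivFin.symm fun i : S => i.1.1 ⊗ₜ[k] i.1.2).symm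
  obtain ⟨n, c, u, hcu⟩ := h5 z
  refine ⟨s v + s (Q v), n, fun i => c i, fun i => P (u i), fun i => (c i).2,
    fun i => DFunLike.congr_fun hP (u i), ?_⟩
  have h6 : Q (Q v) = ∑ i, (c i : V) ⊗ₜ[k] P (u i) := by
    rw [← hz, hcu, map_sum, map_sum]
    simp [Q]
  rw [map_add, ← h6, add_assoc, ← h3]
  exact h1

lemma exists_eq_of_tensorD_eq_tmul {dV ε : V →ₗ[k] V} {dW : W →ₗ[k] W} {f : V →ₗ[k] k}
    (hf : f ∘ₗ dV = 0) {t : V ⊗[k] W} {v : V} (hv : f v = 1) {u : W}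
    (ht : tensorD dV ε dW t = v ⊗ₜ u) : ∃ b, dW b = u := by
  let g : ∀ f : V →ₗ[k] k, V ⊗[k] W →ₗ[k] W := fun f =>
    (TensorProduct.lid k W).toLinearMap ∘ₗ TensorProduct.map f LinearMap.id
  have h1 : ∀ t, g f (tensorD dV ε dW t) = dW (g (f ∘ₗ ε) t) := by
    intro t
    induction t with
    | zero => simp
    | add t t' h h' => simp only [map_add, h, h']
    | tmul v u =>
      have h2 : f (dV v) = 0 := DFunLike.congr_fun hf v
      simp [g, tensorD_tmul, h2]
  refine ⟨g (f ∘ₗ ε) t, ?_⟩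
  rw [← h1, ht]
  simp [g, hv]

lemma exists_eq_of_tensorD_eq_tmul_left {dV ε : V →ₗ[k] V} {dW : W →ₗ[k] W} {g : W →ₗ[k] k}
    (hg : g ∘ₗ dW = 0) {t : V ⊗[k] W} {v : V} {u : W} (hu : g u = 1)
    (ht : tensorD dV ε dW t = v ⊗ₜ u) : ∃ b, dV b = v := by
  let h : V ⊗[k] W →ₗ[k] V :=
    (TensorProduct.rid k V).toLinearMap ∘ₗ TensorProduct.map LinearMap.id g
  have h1 : ∀ t, h (tensorD dV ε dW t) = dV (h t) := by
    intro t
    induction t with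
    | zero => simp
    | add t t' h h' => simp only [map_add, h, h']
    | tmul v u =>
      have h2 : g (dW u) = 0 := DFunLike.congr_fun hg u
      simp [h, tensorD_tmul, h2]
  refine ⟨h t, ?_⟩
  rw [← h1, ht]
  simp [h, hu]

end Kunneth

/-! ### Pushing cochains forward -/

section Push

variable {k A B : Type*} [Field k] [CommRing A] [Algebra k A] [CommRing B] [Algebra k B]
variable {α ι : Type*} [Fintype α] [DecidableEq α] [DecidableEq ι]

/-- The preimage of a finite set. -/
def preSet (e : α → ι) (K : Finset ι) : Finset α := Finset.univ.filter fun a => e a ∈ K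

omit [DecidableEq α] in
lemma mem_preSet {e : α → ι} {K : Finset ι} {a : α} : a ∈ preSet e K ↔ e a ∈ K := by
  simp [preSet]

lemma preSet_mono (e : α → ι) {K L : Finset ι} (h : K ⊆ L) : preSet e K ⊆ preSet e L :=
  fun _ ha => mem_preSet.2 (h (mem_preSet.1 ha))

lemma preSet_erase {e : α → ι} (he : Function.Injective e) (K : Finset ι) (a : α) :
    preSet e (K.erase (e a)) = (preSet e K).erase a := by
  ext b
  simp [mem_preSet, he.eq_iff]

lemma preSet_erase_of_notMem {e : α → ι} {K : Finset ι} {i : ι} (hi : ∀ a, e a ≠ i) :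
    preSet e (K.erase i) = preSet e K := by
  ext b
  simp [mem_preSet, hi]

variable {φ : A →ₐ[k] B} {e : α → ι} (he : Function.Injective e) {x : α → A} {w : ι → B}
  (hw : ∀ a, w (e a) = φ (x a))

include he hw in
lemma map_prod_preSet_dvd (K : Finset ι) : φ (∏ a ∈ preSet e K, x a) ∣ ∏ i ∈ K, w i := by
  rw [map_prod, ← Finset.prod_congr rfl fun a _ => hw a, ← Finset.prod_image he.injOn]
  refine Finset.prod_dvd_prod_of_subset _ _ _ fun i hi => ?_
  obtain ⟨a, ha, rfl⟩ := Finset.mem_image.1 hi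
  exact mem_preSet.1 ha

/-- The map between the terms of two Čech complexes induced by a map of rings. -/
def locMap (K : Finset ι) : CubeLoc x (preSet e K) →ₐ[k] CubeLoc w K :=
  IsLocalization.Away.liftAlgHom (∏ a ∈ preSet e K, x a)
    (f := (IsScalarTower.toAlgHom k B (CubeLoc w K)).comp φ)
    (isUnit_of_dvd_unit (map_dvd (algebraMap B (CubeLoc w K)) (map_prod_preSet_dvd he hw K))
      (IsLocalization.Away.algebraMap_isUnit (∏ i ∈ K, w i)))

lemma locMap_algebraMap (K : Finset ι) (a : A) :
    locMap he hw K (algebraMap A _ a) = algebraMap B (CubeLoc w K) (φ a) := by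
  rw [locMap, IsLocalization.Away.coe_liftAlgHom, IsLocalization.Away.lift_eq]
  rfl

lemma locMap_cubeRes {K L : Finset ι} (h : K ⊆ L) (m : CubeLoc x (preSet e K)) :
    cubeRes w h (locMap he hw K m) = locMap he hw L (cubeRes x (preSet_mono e h) m) := by
  have h1 : ((cubeRes w h).toRingHom.comp (locMap he hw K).toRingHom) =
      (locMap he hw L).toRingHom.comp (cubeRes x (preSet_mono e h)).toRingHom := by
    refine IsLocalization.ringHom_ext (Submonoid.powers (∏ a ∈ preSet e K, x a))
      (RingHom.ext fun a => ?_)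
    change cubeRes w h (locMap he hw K (algebraMap A _ a)) =
      locMap he hw L (cubeRes x (preSet_mono e h) (algebraMap A _ a))
    rw [AlgHom.commutes, locMap_algebraMap, locMap_algebraMap, AlgHom.commutes]
  exact DFunLike.congr_fun h1 m

/-- The push forward of cochains. -/
def push : Cube x →ₗ[k] Cube w :=
  LinearMap.pi fun K => (locMap he hw K).toLinearMap ∘ₗ LinearMap.proj (preSet e K)

lemma push_apply (c : Cube x) (K : Finset ι) :
    push he hw c K = locMap he hw K (c (preSet e K)) := rfl

lemma cubeRes_push (c : Cube x) {K L : Finset ι} (h : K ⊆ L) :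
    cubeRes w h (push he hw c K) =
      locMap he hw L (cubeRes x (preSet_mono e h) (c (preSet e K))) :=
  locMap_cubeRes he hw h _

omit [Fintype α] in
lemma cubeRes_congr {c : Cube x} {I I' J : Finset α} (hI : I = I') (h : I ⊆ J) (h' : I' ⊆ J) :
    cubeRes x h (c I) = cubeRes x h' (c I') := by
  subst hI
  rfl

lemma cubeRes_push_of_preSet_eq (c : Cube x) {K L : Finset ι} (h : K ⊆ L)
    (h' : preSet e K = preSet e L) : cubeRes w h (push he hw c K) = push he hw c L := by
  rw [cubeRes_push, cubeRes_congr h' _ subset_rfl, cubeRes_refl, push_apply]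

/-- The differential of a push forward, one index at a time. -/
lemma push_cubeD (rk : α → ℕ) (c : Cube x) (K : Finset ι) :
    push he hw (cubeD x rk c) K = ∑ a ∈ preSet e K, cubeSign B rk a (preSet e K) •
      cubeRes w (K.erase_subset (e a)) (push he hw c (K.erase (e a))) := by
  rw [push_apply, cubeD_apply, map_sum]
  refine Finset.sum_congr rfl fun a _ => ?_
  rw [cubeSign, cubeSign, cubeRes_push,
    cubeRes_congr (preSet_erase he K a) _ ((preSet e K).erase_subset a)]
  exact map_neg_one_pow_smul (A' := B) (locMap he hw K).toRingHom.toAddMonoidHom _ _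

end Push

end SegreF

end

end

section
noncomputable section

set_option linter.unusedSectionVars false

namespace SegreF

/-! ### Families in a disjoint union of three index sets -/

section Families

/-- The conditions: to be empty, to be nonempty, and no condition. -/
def partOk {α : Type*} : Fin 3 → Finset α → Prop
  | 0, s => s = ∅
  | 1, s => s.Nonempty
  | 2, _ => True

lemma partOk_zero {α : Type*} {s : Finset α} : partOk 0 s ↔ s = ∅ := Iff.rfl
lemma partOk_one {α : Type*} {s : Finset α} : partOk 1 s ↔ s.Nonempty := Iff.rfl
lemma partOk_two {α : Type*} {s : Finset α} : partOk 2 s ↔ True := Iff.rfl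

lemma partOk_of_subset {α : Type*} {q : Fin 3} {s t u : Finset α} (hs : partOk q s)
    (hu : partOk q u) (hst : s ⊆ t) (htu : t ⊆ u) : partOk q t := by
  match q with
  | 0 => exact Finset.subset_empty.1 ((show u = ∅ from hu) ▸ htu)
  | 1 => exact Finset.Nonempty.mono hst hs
  | 2 => trivial

variable {t r s : ℕ}

/-- The index set. -/
abbrev TriIdx (t r s : ℕ) : Type := Fin t ⊕ (Fin r ⊕ Fin s)

/-- The ordering of the index set. -/
def triRk : TriIdx t r s → ℕ
  | .inl a => a
  | .inr (.inl b) => t + b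
  | .inr (.inr c) => t + r + c

lemma triRk_injective : Function.Injective (triRk : TriIdx t r s → ℕ) := by
  rintro (a | a | a) (b | b | b) h <;> simp only [triRk] at h
  · rw [Fin.ext h]
  · exact absurd h (by have := a.2; omega)
  · exact absurd h (by have := a.2; omega)
  · exact absurd h (by have := b.2; omega)
  · rw [Fin.ext (show (a : ℕ) = b by omega)]
  · exact absurd h (by have := a.2; omega)
  · exact absurd h (by have := b.2; omega)
  · exact absurd h (by have := b.2; omega)
  · rw [Fin.ext (show (a : ℕ) = b by omega)]

/-- The inclusion of the first block. -/
def idxZ : Fin t → TriIdx t r s := Sum.inl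
/-- The inclusion of the second block. -/
def idxX : Fin r → TriIdx t r s := fun b => Sum.inr (Sum.inl b)
/-- The inclusion of the third block. -/
def idxY : Fin s → TriIdx t r s := fun c => Sum.inr (Sum.inr c)

lemma idxZ_injective : Function.Injective (idxZ : Fin t → TriIdx t r s) := Sum.inl_injective
lemma idxX_injective : Function.Injective (idxX : Fin r → TriIdx t r s) :=
  Sum.inr_injective.comp Sum.inl_injective
lemma idxY_injective : Function.Injective (idxY : Fin s → TriIdx t r s) :=
  Sum.inr_injective.comp Sum.inr_injective

@[to_additive]
lemma prod_triIdx {M : Type*} [CommMonoid M] (K : Finset (TriIdx t r s)) (f : TriIdx t r s → M) :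
    ∏ i ∈ K, f i = (∏ a ∈ preSet idxZ K, f (idxZ a)) *
      ((∏ b ∈ preSet idxX K, f (idxX b)) * ∏ c ∈ preSet idxY K, f (idxY c)) := by
  have h1 : ∏ i ∈ K, f i = ∏ i : TriIdx t r s, if i ∈ K then f i else 1 := by
    rw [← Finset.prod_filter, Finset.filter_univ_mem]
  rw [h1, Fintype.prod_sum_type, Fintype.prod_sum_type]
  simp only [preSet, Finset.prod_filter]
  rfl

lemma card_triIdx (K : Finset (TriIdx t r s)) :
    K.card = (preSet idxZ K).card + ((preSet idxX K).card + (preSet idxY K).card) := by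
  simp only [Finset.card_eq_sum_ones]
  exact sum_triIdx K (fun _ => 1)

/-- The family of the sets whose three parts satisfy the given conditions. -/
def fam (a b c : Fin 3) : Set (Finset (TriIdx t r s)) :=
  {K | partOk a (preSet idxZ K) ∧ partOk b (preSet idxX K) ∧ partOk c (preSet idxY K)}

lemma fam_ordConnected (a b c : Fin 3) : (fam a b c : Set (Finset (TriIdx t r s))).OrdConnected :=
  ⟨fun _ hK _ hL _ hM => ⟨partOk_of_subset hK.1 hL.1 (preSet_mono _ hM.1) (preSet_mono _ hM.2),
    partOk_of_subset hK.2.1 hL.2.1 (preSet_mono _ hM.1) (preSet_mono _ hM.2),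
    partOk_of_subset hK.2.2 hL.2.2 (preSet_mono _ hM.1) (preSet_mono _ hM.2)⟩⟩

lemma preSet_insert_of_ne {α ι : Type*} [Fintype α] [DecidableEq α] [DecidableEq ι] {e : α → ι}
    {i : ι} (hi : ∀ a, e a ≠ i) (K : Finset ι) : preSet e (insert i K) = preSet e K := by
  ext b
  simp [mem_preSet, hi]

lemma mem_fam_insert_idxX {a c : Fin 3} (b : Fin r) (K : Finset (TriIdx t r s)) :
    K ∈ fam a 2 c ↔ insert (idxX b) K ∈ fam a 2 c := by
  simp only [fam, Set.mem_ofPred_eq, partOk_two,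
    preSet_insert_of_ne (e := idxZ) (i := idxX b) (fun _ => by simp [idxZ, idxX]) K,
    preSet_insert_of_ne (e := idxY) (i := idxX b) (fun _ => by simp [idxY, idxX]) K]

lemma mem_fam_insert_idxY {a b : Fin 3} (c : Fin s) (K : Finset (TriIdx t r s)) :
    K ∈ fam a b 2 ↔ insert (idxY c) K ∈ fam a b 2 := by
  simp only [fam, Set.mem_ofPred_eq, partOk_two,
    preSet_insert_of_ne (e := idxZ) (i := idxY c) (fun _ => by simp [idxZ, idxY]) K,
    preSet_insert_of_ne (e := idxX) (i := idxY c) (fun _ => by simp [idxY, idxX]) K]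

lemma mem_fam_insert_idxZ {b c : Fin 3} (a : Fin t) (K : Finset (TriIdx t r s)) :
    K ∈ fam 2 b c ↔ insert (idxZ a) K ∈ fam 2 b c := by
  simp only [fam, Set.mem_ofPred_eq, partOk_two,
    preSet_insert_of_ne (e := idxX) (i := idxZ a) (fun _ => by simp [idxZ, idxX]) K,
    preSet_insert_of_ne (e := idxY) (i := idxZ a) (fun _ => by simp [idxZ, idxY]) K]

lemma isCubeSplit_fam_idxX (a c : Fin 3) : IsCubeSplit (fam a 2 c : Set (Finset (TriIdx t r s)))
    (fam a 0 c) (fam a 1 c) := by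
  refine ⟨fam_ordConnected _ _ _, ?_, ?_, ?_⟩
  · ext K
    simp only [fam, Set.mem_union, Set.mem_ofPred_eq, partOk_zero, partOk_one, partOk_two]
    have := (preSet idxX K).eq_empty_or_nonempty
    tauto
  · rintro K ⟨-, h, -⟩ ⟨-, h', -⟩
    exact h'.ne_empty h
  · exact fun K hK L hL hKL => ⟨hL.1, hK.2.1.mono (preSet_mono _ hKL), hL.2.2⟩

lemma isCubeSplit_fam_idxY (a b : Fin 3) : IsCubeSplit (fam a b 2 : Set (Finset (TriIdx t r s)))
    (fam a b 0) (fam a b 1) := by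
  refine ⟨fam_ordConnected _ _ _, ?_, ?_, ?_⟩
  · ext K
    simp only [fam, Set.mem_union, Set.mem_ofPred_eq, partOk_zero, partOk_one, partOk_two]
    have := (preSet idxY K).eq_empty_or_nonempty
    tauto
  · rintro K ⟨-, -, h⟩ ⟨-, -, h'⟩
    exact h'.ne_empty h
  · exact fun K hK L hL hKL => ⟨hL.1, hL.2.1, hK.2.2.mono (preSet_mono _ hKL)⟩

lemma isCubeSplit_fam_idxZ (b c : Fin 3) : IsCubeSplit (fam 2 b c : Set (Finset (TriIdx t r s)))
    (fam 0 b c) (fam 1 b c) := by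
  refine ⟨fam_ordConnected _ _ _, ?_, ?_, ?_⟩
  · ext K
    simp only [fam, Set.mem_union, Set.mem_ofPred_eq, partOk_zero, partOk_one, partOk_two]
    have := (preSet idxZ K).eq_empty_or_nonempty
    tauto
  · rintro K ⟨h, -, -⟩ ⟨h', -, -⟩
    exact h'.ne_empty h
  · exact fun K hK L hL hKL => ⟨hK.1.mono (preSet_mono _ hKL), hL.2.1, hL.2.2⟩

end Families

section Link

variable {t r s : ℕ} {B : Type*} [CommRing B] {w : TriIdx t r s → B}

/-- The conditions on three families of elements under which the Čech complexes of the families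
of sets that meet two of the three blocks compute the same cohomology. -/
structure IsTriple (w : TriIdx t r s → B) : Prop where
  memX : ∀ a, w (idxZ a) ∈ Ideal.span (w '' Set.range idxX)
  memY : ∀ a, w (idxZ a) ∈ Ideal.span (w '' Set.range idxY)
  memZ : ∀ b c, w (idxX b) * w (idxY c) ∈ Ideal.span (w '' Set.range idxZ)

variable (h : IsTriple w)

include h

lemma IsTriple.isCubeAcyclic_idxX (c : Fin 3) : IsCubeAcyclic w triRk (fam 1 2 c) := by
  refine isCubeAcyclic_of_mem_radical triRk_injective (Finset.univ.image idxX)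
    (fam_ordConnected _ _ _) ?_ fun K hK => Ideal.le_radical ?_
  · intro i hi K
    obtain ⟨b, -, rfl⟩ := Finset.mem_image.1 hi
    exact mem_fam_insert_idxX b K
  · obtain ⟨a, ha⟩ := partOk_one.1 hK.1
    rw [mem_preSet] at ha
    have h1 : idxZ a ∈ K \ Finset.univ.image idxX :=
      Finset.mem_sdiff.2 ⟨ha, by simp [idxZ, idxX]⟩
    refine Ideal.mem_of_dvd _ (Finset.dvd_prod_of_mem w h1) ?_
    have := h.memX a
    simpa using this

lemma IsTriple.isCubeAcyclic_idxY (b : Fin 3) : IsCubeAcyclic w triRk (fam 1 b 2) := by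
  refine isCubeAcyclic_of_mem_radical triRk_injective (Finset.univ.image idxY)
    (fam_ordConnected _ _ _) ?_ fun K hK => Ideal.le_radical ?_
  · intro i hi K
    obtain ⟨c, -, rfl⟩ := Finset.mem_image.1 hi
    exact mem_fam_insert_idxY c K
  · obtain ⟨a, ha⟩ := partOk_one.1 hK.1
    rw [mem_preSet] at ha
    have h1 : idxZ a ∈ K \ Finset.univ.image idxY :=
      Finset.mem_sdiff.2 ⟨ha, by simp [idxZ, idxY]⟩
    refine Ideal.mem_of_dvd _ (Finset.dvd_prod_of_mem w h1) ?_
    have := h.memY a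
    simpa using this

lemma IsTriple.isCubeAcyclic_idxZ : IsCubeAcyclic w triRk (fam 2 1 1) := by
  refine isCubeAcyclic_of_mem_radical triRk_injective (Finset.univ.image idxZ)
    (fam_ordConnected _ _ _) ?_ fun K hK => Ideal.le_radical ?_
  · intro i hi K
    obtain ⟨a, -, rfl⟩ := Finset.mem_image.1 hi
    exact mem_fam_insert_idxZ a K
  · obtain ⟨b, hb⟩ := partOk_one.1 hK.2.1
    obtain ⟨c, hc⟩ := partOk_one.1 hK.2.2
    rw [mem_preSet] at hb hc
    have h1 : ({idxX b, idxY c} : Finset (TriIdx t r s)) ⊆ K \ Finset.univ.image idxZ := by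
      intro i hi
      rw [Finset.mem_insert, Finset.mem_singleton] at hi
      rcases hi with rfl | rfl
      · exact Finset.mem_sdiff.2 ⟨hb, by simp [idxZ, idxX]⟩
      · exact Finset.mem_sdiff.2 ⟨hc, by simp [idxZ, idxY]⟩
    have h2 := Finset.prod_dvd_prod_of_subset _ _ w h1
    rw [Finset.prod_pair (by simp [idxX, idxY])] at h2
    refine Ideal.mem_of_dvd _ h2 ?_
    have := h.memZ b c
    simpa using this

omit h in
/-- The classes of `u` on the sets within the first block and of `v` on the sets that avoid the
first block and meet the other ones correspond to each other. -/
def IsLinked (u v : Cube w) : Prop :=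
  IsCubeCobound triRk (fam 1 1 1) (cubeRestr w (fam 1 1 1) (cubeD w triRk
    (cubeRestr w (fam 1 1 0) (cubeD w triRk u))) - cubeRestr w (fam 1 1 1) (cubeD w triRk v))

lemma IsTriple.exists_linked_right {u : Cube w} (hu : CubeSupp (fam 1 0 0) u)
    (hu' : IsCubeCocycle triRk (fam 1 0 0) u) :
    ∃ v, CubeSupp (fam 0 1 1) v ∧ IsCubeCocycle triRk (fam 0 1 1) v ∧ IsLinked u v := by
  have h1 := (isCubeSplit_fam_idxX 1 0).isCubeCocycle_conn triRk_injective hu hu'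
  have h2 := (isCubeSplit_fam_idxY 1 1).isCubeCocycle_conn triRk_injective (cubeSupp_restr _ _) h1
  exact (isCubeSplit_fam_idxZ 1 1).exists_conn h.isCubeAcyclic_idxZ (cubeSupp_restr _ _) h2

lemma IsTriple.exists_linked_left {v : Cube w} (hv : CubeSupp (fam 0 1 1) v)
    (hv' : IsCubeCocycle triRk (fam 0 1 1) v) :
    ∃ u, CubeSupp (fam 1 0 0) u ∧ IsCubeCocycle triRk (fam 1 0 0) u ∧ IsLinked u v := by
  have h1 := (isCubeSplit_fam_idxZ 1 1).isCubeCocycle_conn triRk_injective hv hv'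
  obtain ⟨u1, hu1, hu1', h2⟩ := (isCubeSplit_fam_idxY 1 1).exists_conn (h.isCubeAcyclic_idxY 1)
    (cubeSupp_restr _ _) h1
  obtain ⟨u, hu, hu', h3⟩ := (isCubeSplit_fam_idxX 1 0).exists_conn (h.isCubeAcyclic_idxX 0) hu1 hu1'
  refine ⟨u, hu, hu', ?_⟩
  have h4 := (isCubeSplit_fam_idxY 1 1).isCubeCobound_conn triRk_injective
    (hu1.sub (cubeSupp_restr _ _)) h3
  have h5 := (h4.add h2).neg
  rw [map_sub, map_sub] at h5
  unfold IsLinked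
  convert h5 using 1
  abel

lemma IsTriple.isCubeCobound_of_right {u v : Cube w} (hu : CubeSupp (fam 1 0 0) u)
    (hu' : IsCubeCocycle triRk (fam 1 0 0) u) (hv : CubeSupp (fam 0 1 1) v) (huv : IsLinked u v)
    (hc : IsCubeCobound triRk (fam 0 1 1) v) : IsCubeCobound triRk (fam 1 0 0) u := by
  have h1 := (isCubeSplit_fam_idxX 1 0).isCubeCocycle_conn triRk_injective hu hu'
  have h2 := huv.add ((isCubeSplit_fam_idxZ 1 1).isCubeCobound_conn triRk_injective hv hc)
  rw [sub_add_cancel] at h2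
  exact (isCubeSplit_fam_idxX 1 0).isCubeCobound_of_conn (h.isCubeAcyclic_idxX 0) hu hu'
    ((isCubeSplit_fam_idxY 1 1).isCubeCobound_of_conn (h.isCubeAcyclic_idxY 1)
      (cubeSupp_restr _ _) h1 h2)

lemma IsTriple.isCubeCobound_of_left {u v : Cube w} (hu : CubeSupp (fam 1 0 0) u)
    (hv : CubeSupp (fam 0 1 1) v) (hv' : IsCubeCocycle triRk (fam 0 1 1) v) (huv : IsLinked u v)
    (hc : IsCubeCobound triRk (fam 1 0 0) u) : IsCubeCobound triRk (fam 0 1 1) v := by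
  have h1 := (isCubeSplit_fam_idxX 1 0).isCubeCobound_conn triRk_injective hu hc
  have h2 := (isCubeSplit_fam_idxY 1 1).isCubeCobound_conn triRk_injective (cubeSupp_restr _ _) h1
  have h3 := h2.sub huv
  rw [sub_sub_cancel] at h3
  exact (isCubeSplit_fam_idxZ 1 1).isCubeCobound_of_conn h.isCubeAcyclic_idxZ hv hv' h3

omit h

lemma IsLinked.map {u v : Cube w} (h : IsLinked u v) (φ : CubeOp w) :
    IsLinked (φ.map u) (φ.map v) := by
  have := IsCubeCobound.map φ h
  rwa [φ.map_sub, φ.map_restr, φ.map_cubeD, φ.map_restr, φ.map_cubeD, φ.map_restr, φ.map_cubeD]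
    at this

lemma IsLinked.iterate {u v : Cube w} (h : IsLinked u v) (φ : CubeOp w) (e : ℕ) :
    IsLinked (φ.map^[e] u) (φ.map^[e] v) := by
  induction e with
  | zero => exact h
  | succ e ih =>
    rw [Function.iterate_succ_apply', Function.iterate_succ_apply']
    exact ih.map φ

lemma cubeRestr_comm {ι : Type*} [DecidableEq ι] {w : ι → B} (U V : Set (Finset ι)) (c : Cube w) :
    cubeRestr w U (cubeRestr w V c) = cubeRestr w V (cubeRestr w U c) := by
  rw [cubeRestr_restr, cubeRestr_restr, Set.inter_comm]

lemma IsCubeCobound.restr_card {ι : Type*} [DecidableEq ι] {w : ι → B} {rk : ι → ℕ}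
    {U : Set (Finset ι)} {c : Cube w} (h : IsCubeCobound rk U c) (j : ℕ) :
    IsCubeCobound rk U (cubeRestr w (cardSet ι (j + 1)) c) := by
  obtain ⟨b, hb, hd⟩ := h
  refine ⟨cubeRestr w (cardSet ι j) b, ?_, fun K hK => ?_⟩
  · rw [← hb.restr_eq, cubeRestr_comm]
    exact cubeSupp_restr _ _
  · rw [← cubeRestr_cubeD_card]
    by_cases h : K ∈ cardSet ι (j + 1)
    · rw [cubeRestr_apply_of_mem h, cubeRestr_apply_of_mem h, hd K hK]
    · rw [cubeRestr_apply_of_notMem h, cubeRestr_apply_of_notMem h]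

lemma IsLinked.restr_card {u v : Cube w} (h : IsLinked u v) (j : ℕ) :
    IsLinked (cubeRestr w (cardSet _ j) u) (cubeRestr w (cardSet _ (j + 1)) v) := by
  have := IsCubeCobound.restr_card h (j + 1)
  rwa [map_sub, cubeRestr_comm, cubeRestr_cubeD_card, cubeRestr_comm _ (fam 1 1 0),
    cubeRestr_cubeD_card, cubeRestr_comm, cubeRestr_cubeD_card] at this

lemma IsCubeCocycle.restr_card {ι : Type*} [DecidableEq ι] {w : ι → B} {rk : ι → ℕ}
    {U : Set (Finset ι)} {c : Cube w} (h : IsCubeCocycle rk U c) (j : ℕ) :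
    IsCubeCocycle rk U (cubeRestr w (cardSet ι j) c) := by
  intro K hK
  rw [← cubeRestr_cubeD_card]
  by_cases h' : K ∈ cardSet ι (j + 1)
  · rw [cubeRestr_apply_of_mem h', h K hK]
  · rw [cubeRestr_apply_of_notMem h']

end Link

end SegreF

end

end

section
open scoped TensorProduct
noncomputable section

set_option linter.unusedSectionVars false

namespace SegreF

/-! ### Signs -/

section Signs

variable {t r s : ℕ} (B : Type*) [CommRing B]

lemma preSet_filter {α ι : Type*} [Fintype α] [DecidableEq ι] (e : α → ι) (K : Finset ι)
    (q : ι → Prop) [DecidablePred q] :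
    preSet e (K.filter q) = (preSet e K).filter fun a => q (e a) := by
  ext b
  simp [mem_preSet]

lemma cubeSign_idxZ (a : Fin t) (K : Finset (TriIdx t r s)) :
    cubeSign B triRk (idxZ a) K = cubeSign B Fin.val a (preSet idxZ K) := by
  have h1 : (preSet idxX K).filter (fun b => triRk (idxX b : TriIdx t r s) <
      triRk (idxZ a : TriIdx t r s)) = ∅ :=
    Finset.filter_false_of_mem fun b _ => by simp only [triRk, idxX, idxZ]; omega
  have h2 : (preSet idxY K).filter (fun b => triRk (idxY b : TriIdx t r s) <
      triRk (idxZ a : TriIdx t r s)) = ∅ :=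
    Finset.filter_false_of_mem fun b _ => by simp only [triRk, idxY, idxZ]; omega
  rw [cubeSign, card_triIdx, preSet_filter, preSet_filter, preSet_filter, h1, h2]
  rfl

lemma cubeSign_idxX (b : Fin r) {K : Finset (TriIdx t r s)} (hK : preSet idxZ K = ∅) :
    cubeSign B triRk (idxX b) K = cubeSign B Fin.val b (preSet idxX K) := by
  have h1 : (preSet idxX K).filter (fun a => triRk (idxX a : TriIdx t r s) <
      triRk (idxX b : TriIdx t r s)) = (preSet idxX K).filter fun a => a.val < b.val :=
    Finset.filter_congr fun a _ => by simp only [triRk, idxX]; omega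
  have h2 : (preSet idxY K).filter (fun a => triRk (idxY a : TriIdx t r s) <
      triRk (idxX b : TriIdx t r s)) = ∅ :=
    Finset.filter_false_of_mem fun a _ => by simp only [triRk, idxY, idxX]; omega
  rw [cubeSign, card_triIdx, preSet_filter, preSet_filter, preSet_filter, h1, h2, hK]
  simp [cubeSign]

lemma cubeSign_idxY (c : Fin s) {K : Finset (TriIdx t r s)} (hK : preSet idxZ K = ∅) :
    cubeSign B triRk (idxY c) K =
      (-1) ^ (preSet idxX K).card * cubeSign B Fin.val c (preSet idxY K) := by
  have h1 : (preSet idxX K).filter (fun a => triRk (idxX a : TriIdx t r s) <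
      triRk (idxY c : TriIdx t r s)) = preSet idxX K :=
    Finset.filter_true_of_mem fun a _ => by simp only [triRk, idxX, idxY]; omega
  have h2 : (preSet idxY K).filter (fun a => triRk (idxY a : TriIdx t r s) <
      triRk (idxY c : TriIdx t r s)) = (preSet idxY K).filter fun a => a.val < c.val :=
    Finset.filter_congr fun a _ => by simp only [triRk, idxY]; omega
  rw [cubeSign, card_triIdx, preSet_filter, preSet_filter, preSet_filter, h1, h2, hK, cubeSign,
    ← pow_add]
  simp

end Signs

/-! ### Cross products of cochains -/

section Cross

variable {k R S : Type*} [Field k] [CommRing R] [Algebra k R] [CommRing S] [Algebra k S]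
variable {t r s : ℕ} {x : Fin r → R} {y : Fin s → S} {w : TriIdx t r s → R ⊗[k] S}
  (hwx : ∀ b, w (idxX b) = (Algebra.TensorProduct.includeLeft : R →ₐ[k] R ⊗[k] S) (x b))
  (hwy : ∀ c, w (idxY c) = (Algebra.TensorProduct.includeRight : S →ₐ[k] R ⊗[k] S) (y c))

section LocTensor

variable (K : Finset (TriIdx t r s))

/-- The product map `R_{x_I} ⊗ S_{y_J} → (R ⊗ S)_{w_K}`. -/
def locTensor : CubeLoc x (preSet (idxX (t := t) (s := s)) K) ⊗[k]
    CubeLoc y (preSet (idxY (t := t) (r := r)) K) →ₐ[k] CubeLoc w K :=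
  Algebra.TensorProduct.lift (locMap idxX_injective hwx K) (locMap idxY_injective hwy K)
    (fun _ _ => Commute.all _ _)

variable (k x y) in
/-- The localization map `R ⊗ S → R_{x_I} ⊗ S_{y_J}`. -/
def tensorLoc : R ⊗[k] S →ₐ[k] CubeLoc x (preSet (idxX (t := t) (s := s)) K) ⊗[k]
    CubeLoc y (preSet (idxY (t := t) (r := r)) K) :=
  Algebra.TensorProduct.map (IsScalarTower.toAlgHom k R _) (IsScalarTower.toAlgHom k S _)

lemma locTensor_tensorLoc (b : R ⊗[k] S) :
    locTensor hwx hwy K (tensorLoc k x y K b) = algebraMap (R ⊗[k] S) (CubeLoc w K) b := by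
  have h : (locTensor hwx hwy K).comp (tensorLoc k x y K) =
      IsScalarTower.toAlgHom k (R ⊗[k] S) (CubeLoc w K) := by
    refine Algebra.TensorProduct.ext' fun a b => ?_
    change locTensor hwx hwy K (algebraMap R _ a ⊗ₜ algebraMap S _ b) =
      algebraMap (R ⊗[k] S) (CubeLoc w K) (a ⊗ₜ b)
    rw [locTensor, Algebra.TensorProduct.lift_tmul, locMap_algebraMap, locMap_algebraMap, ← map_mul]
    simp
  exact DFunLike.congr_fun h b

variable {K}

include hwx hwy in
lemma prod_eq_tmul (hK : preSet idxZ K = ∅) :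
    ∏ i ∈ K, w i = (∏ b ∈ preSet idxX K, x b) ⊗ₜ[k] (∏ c ∈ preSet idxY K, y c) := by
  rw [prod_triIdx, hK, Finset.prod_empty, one_mul, Finset.prod_congr rfl fun b _ => hwx b,
    Finset.prod_congr rfl fun c _ => hwy c, ← map_prod, ← map_prod]
  exact (Algebra.TensorProduct.tmul_mul_tmul _ _ _ _).trans (by rw [mul_one, one_mul])

lemma isUnit_tensorLoc : IsUnit (tensorLoc k x y K
    ((∏ b ∈ preSet idxX K, x b) ⊗ₜ[k] (∏ c ∈ preSet idxY K, y c))) := by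
  have h1 : IsUnit (algebraMap R (CubeLoc x (preSet (idxX (t := t) (s := s)) K))
    (∏ b ∈ preSet idxX K, x b)) := IsLocalization.Away.algebraMap_isUnit _
  have h2 : IsUnit (algebraMap S (CubeLoc y (preSet (idxY (t := t) (r := r)) K))
    (∏ b ∈ preSet idxY K, y b)) := IsLocalization.Away.algebraMap_isUnit _
  have h3 := (h1.map (Algebra.TensorProduct.includeLeft : _ →ₐ[k]
    CubeLoc x (preSet (idxX (t := t) (s := s)) K) ⊗[k]
      CubeLoc y (preSet (idxY (t := t) (r := r)) K))).mul
    (h2.map (Algebra.TensorProduct.includeRight : _ →ₐ[k]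
    CubeLoc x (preSet (idxX (t := t) (s := s)) K) ⊗[k]
      CubeLoc y (preSet (idxY (t := t) (r := r)) K)))
  convert h3 using 1
  exact ((Algebra.TensorProduct.tmul_mul_tmul _ _ _ _).trans (by rw [mul_one, one_mul]; rfl)).symm

lemma exists_mul_pow_eq_tensorLoc (u : CubeLoc x (preSet (idxX (t := t) (s := s)) K) ⊗[k]
    CubeLoc y (preSet (idxY (t := t) (r := r)) K)) : ∃ (N : ℕ) (b : R ⊗[k] S),
    u * tensorLoc k x y K
      ((∏ b ∈ preSet idxX K, x b) ⊗ₜ[k] (∏ c ∈ preSet idxY K, y c)) ^ N = tensorLoc k x y K b := by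
  induction u with
  | zero => exact ⟨0, 0, by simp⟩
  | add u v hu hv =>
    obtain ⟨N, b, hb⟩ := hu
    obtain ⟨M, b', hb'⟩ := hv
    refine ⟨N + M, b * ((∏ b ∈ preSet idxX K, x b) ⊗ₜ[k] (∏ c ∈ preSet idxY K, y c)) ^ M +
      b' * ((∏ b ∈ preSet idxX K, x b) ⊗ₜ[k] (∏ c ∈ preSet idxY K, y c)) ^ N, ?_⟩
    rw [map_add, map_mul, map_mul, ← hb, ← hb', map_pow, map_pow]
    ring
  | tmul m m' =>
    obtain ⟨N, a, ha⟩ := IsLocalization.Away.surj (∏ b ∈ preSet idxX K, x b) m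
    obtain ⟨M, a', ha'⟩ := IsLocalization.Away.surj (∏ b ∈ preSet idxY K, y b) m'
    refine ⟨N + M, (a * (∏ b ∈ preSet idxX K, x b) ^ M) ⊗ₜ (a' * (∏ b ∈ preSet idxY K, y b) ^ N), ?_⟩
    simp only [tensorLoc, Algebra.TensorProduct.map_tmul, map_mul, map_pow,
      Algebra.TensorProduct.tmul_pow, Algebra.TensorProduct.tmul_mul_tmul,
      IsScalarTower.coe_toAlgHom', ← ha, ← ha']
    congr 1 <;> ring

lemma locTensor_injective (hK : preSet idxZ K = ∅) :
    Function.Injective (locTensor hwx hwy K) := by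
  rw [injective_iff_map_eq_zero]
  intro u hu
  obtain ⟨N, b, hb⟩ := exists_mul_pow_eq_tensorLoc u
  have h1 := congrArg (locTensor hwx hwy K) hb
  rw [map_mul, hu, zero_mul, locTensor_tensorLoc] at h1
  obtain ⟨⟨_, M, rfl⟩, h2⟩ := (IsLocalization.map_eq_zero_iff
    (Submonoid.powers (∏ i ∈ K, w i)) (CubeLoc w K) b).1 h1.symm
  have h3 := congrArg (tensorLoc k x y K) h2
  simp only [map_mul, map_pow, map_zero] at h3
  rw [prod_eq_tmul hwx hwy hK, ← hb, mul_left_comm, ← pow_add] at h3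
  exact (isUnit_tensorLoc.pow _).mul_left_eq_zero.1 h3

lemma locTensor_surjective (hK : preSet idxZ K = ∅) :
    Function.Surjective (locTensor hwx hwy K) := by
  intro m
  obtain ⟨N, b, hb⟩ := IsLocalization.Away.surj (∏ i ∈ K, w i) m
  obtain ⟨q, hq⟩ := (isUnit_tensorLoc (k := k) (x := x) (y := y) (K := K)).pow N
  refine ⟨tensorLoc k x y K b * (q⁻¹ : _ˣ), ?_⟩
  have h1 : algebraMap (R ⊗[k] S) (CubeLoc w K) (∏ i ∈ K, w i) ^ N = locTensor hwx hwy K q := by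
    rw [hq, map_pow, locTensor_tensorLoc]
    exact congrArg (fun b => algebraMap (R ⊗[k] S) (CubeLoc w K) b ^ N) (prod_eq_tmul hwx hwy hK)
  rw [map_mul, locTensor_tensorLoc, ← hb, h1, mul_assoc, ← map_mul, Units.mul_inv, map_one, mul_one]

end LocTensor

/-- The cross product of cochains. -/
def cross (c : Cube x) (d : Cube y) : Cube w := fun K =>
  if preSet idxZ K = ∅ then push idxX_injective hwx c K * push idxY_injective hwy d K else 0

variable {hwx hwy} in
lemma cross_apply {K : Finset (TriIdx t r s)} (hK : preSet idxZ K = ∅) (c : Cube x) (d : Cube y) :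
    cross hwx hwy c d K = push idxX_injective hwx c K * push idxY_injective hwy d K := if_pos hK

variable {hwx hwy} in
lemma cross_apply_of_ne {K : Finset (TriIdx t r s)} (hK : preSet idxZ K ≠ ∅) (c : Cube x)
    (d : Cube y) : cross hwx hwy c d K = 0 := if_neg hK

/-- The cross product as a linear map on the tensor product. -/
def crossL : Cube x ⊗[k] Cube y →ₗ[k] Cube w :=
  TensorProduct.lift (LinearMap.mk₂ k (cross hwx hwy)
    (fun c c' d => funext fun K => by simp only [cross, map_add, Pi.add_apply]; split_ifs <;> ring)
    (fun q c d => funext fun K => by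
      simp only [cross, map_smul, Pi.smul_apply]
      split_ifs
      · exact smul_mul_assoc _ _ _
      · exact (smul_zero _).symm)
    (fun c d d' => funext fun K => by simp only [cross, map_add, Pi.add_apply]; split_ifs <;> ring)
    (fun q c d => funext fun K => by
      simp only [cross, map_smul, Pi.smul_apply]
      split_ifs
      · exact mul_smul_comm _ _ _
      · exact (smul_zero _).symm))

lemma crossL_tmul (c : Cube x) (d : Cube y) : crossL hwx hwy (c ⊗ₜ d) = cross hwx hwy c d := rfl

lemma crossL_apply {K : Finset (TriIdx t r s)} (hK : preSet idxZ K = ∅) (u : Cube x ⊗[k] Cube y) :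
    crossL hwx hwy u K = locTensor hwx hwy K
      (TensorProduct.map (LinearMap.proj (preSet idxX K)) (LinearMap.proj (preSet idxY K)) u) := by
  induction u with
  | zero => simp
  | add u v hu hv => simp only [map_add, Pi.add_apply, hu, hv]
  | tmul c d => rw [crossL_tmul, cross_apply hK]; rfl

/-- The set with given second and third parts and empty first part. -/
def joinSet (I : Finset (Fin r)) (J : Finset (Fin s)) : Finset (TriIdx t r s) :=
  I.image idxX ∪ J.image idxY

lemma preSet_idxZ_joinSet (I : Finset (Fin r)) (J : Finset (Fin s)) :
    preSet idxZ (joinSet I J : Finset (TriIdx t r s)) = ∅ := by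
  ext a
  simp [mem_preSet, joinSet, idxZ, idxX, idxY]

lemma preSet_idxX_joinSet (I : Finset (Fin r)) (J : Finset (Fin s)) :
    preSet idxX (joinSet I J : Finset (TriIdx t r s)) = I := by
  ext a
  simp [mem_preSet, joinSet, idxX, idxY]

lemma preSet_idxY_joinSet (I : Finset (Fin r)) (J : Finset (Fin s)) :
    preSet idxY (joinSet I J : Finset (TriIdx t r s)) = J := by
  ext a
  simp [mem_preSet, joinSet, idxX, idxY]

lemma crossL_injective : Function.Injective (crossL hwx hwy) := by
  rw [injective_iff_map_eq_zero]
  intro u hu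
  have h1 : ∀ (I : Finset (Fin r)) (J : Finset (Fin s)),
      TensorProduct.map (LinearMap.proj I) (LinearMap.proj J) u = (0 : CubeLoc x I ⊗[k] CubeLoc y J) := by
    intro I J
    have h2 := congrFun hu (joinSet I J)
    rw [crossL_apply hwx hwy (preSet_idxZ_joinSet I J), Pi.zero_apply,
      map_eq_zero_iff _ (locTensor_injective hwx hwy (preSet_idxZ_joinSet I J)),
      preSet_idxX_joinSet, preSet_idxY_joinSet] at h2
    exact h2
  have h2 : ∀ v : Cube x ⊗[k] Cube y, v = ∑ I, ∑ J, TensorProduct.map (LinearMap.single k _ I)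
      (LinearMap.single k _ J) (TensorProduct.map (LinearMap.proj I) (LinearMap.proj J) v :
        CubeLoc x I ⊗[k] CubeLoc y J) := by
    intro v
    induction v with
    | zero => simp
    | add v v' h h' =>
      simp only [map_add, Finset.sum_add_distrib, ← h, ← h']
    | tmul c d =>
      simp only [TensorProduct.map_tmul, LinearMap.coe_proj, Function.eval, LinearMap.coe_single]
      simp only [← TensorProduct.tmul_sum, ← TensorProduct.sum_tmul, Finset.univ_sum_single]
  rw [h2 u]
  simp [h1]

lemma triIdx_ext {K L : Finset (TriIdx t r s)} (hZ : preSet idxZ K = preSet idxZ L)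
    (hX : preSet idxX K = preSet idxX L) (hY : preSet idxY K = preSet idxY L) : K = L := by
  ext i
  rcases i with a | b | c
  · have := Finset.ext_iff.1 hZ a
    rwa [mem_preSet, mem_preSet] at this
  · have := Finset.ext_iff.1 hX b
    rwa [mem_preSet, mem_preSet] at this
  · have := Finset.ext_iff.1 hY c
    rwa [mem_preSet, mem_preSet] at this

lemma map_proj_map_single {I I' : Finset (Fin r)} {J J' : Finset (Fin s)}
    (h : ¬ (I = I' ∧ J = J')) (m : CubeLoc x I ⊗[k] CubeLoc y J) :
    (TensorProduct.map (LinearMap.proj I') (LinearMap.proj J') (TensorProduct.map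
      (LinearMap.single k (fun I => CubeLoc x I) I) (LinearMap.single k (fun J => CubeLoc y J) J) m) :
        CubeLoc x I' ⊗[k] CubeLoc y J') = 0 := by
  rw [TensorProduct.map_map]
  by_cases hI : I = I'
  · have h1 : (LinearMap.proj J' : Cube y →ₗ[k] CubeLoc y J') ∘ₗ
        LinearMap.single k (fun J => CubeLoc y J) J = 0 :=
      LinearMap.proj_comp_single_ne k _ _ _ fun h' => h ⟨hI, h'.symm⟩
    rw [h1, TensorProduct.map_zero_right, LinearMap.zero_apply]
  · have h1 : (LinearMap.proj I' : Cube x →ₗ[k] CubeLoc x I') ∘ₗ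
        LinearMap.single k (fun I => CubeLoc x I) I = 0 :=
      LinearMap.proj_comp_single_ne k _ _ _ fun h' => hI h'.symm
    rw [h1, TensorProduct.map_zero_left, LinearMap.zero_apply]

lemma map_proj_map_single_same (I : Finset (Fin r)) (J : Finset (Fin s))
    (m : CubeLoc x I ⊗[k] CubeLoc y J) :
    (TensorProduct.map (LinearMap.proj I) (LinearMap.proj J) (TensorProduct.map
      (LinearMap.single k (fun I => CubeLoc x I) I) (LinearMap.single k (fun J => CubeLoc y J) J) m) :
        CubeLoc x I ⊗[k] CubeLoc y J) = m := by
  rw [TensorProduct.map_map, LinearMap.proj_comp_single_same, LinearMap.proj_comp_single_same,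
    TensorProduct.map_id, LinearMap.id_apply]

lemma exists_crossL_eq {v : Cube w} (hv : CubeSupp (fam 0 2 2) v) : ∃ u, crossL hwx hwy u = v := by
  classical
  have h1 : ∀ K : Finset (TriIdx t r s), ∃ m, preSet idxZ K = ∅ → locTensor hwx hwy K m = v K := by
    intro K
    by_cases hK : preSet idxZ K = ∅
    · obtain ⟨m, hm⟩ := locTensor_surjective hwx hwy hK (v K)
      exact ⟨m, fun _ => hm⟩
    · exact ⟨0, fun h => absurd h hK⟩
  choose m hm using h1
  let f : Finset (TriIdx t r s) → Cube x ⊗[k] Cube y := fun K => TensorProduct.map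
    (LinearMap.single k (fun I => CubeLoc x I) (preSet idxX K))
    (LinearMap.single k (fun J => CubeLoc y J) (preSet idxY K)) (m K)
  refine ⟨∑ K ∈ Finset.univ.filter (fun K : Finset (TriIdx t r s) => preSet idxZ K = ∅), f K,
    funext fun L => ?_⟩
  by_cases hL : preSet idxZ L = ∅
  · rw [crossL_apply hwx hwy hL, map_sum, Finset.sum_eq_single_of_mem L (by simpa using hL),
      map_proj_map_single_same, hm L hL]
    intro K hK hKL
    refine map_proj_map_single (fun h => hKL ?_) (m K)
    exact triIdx_ext ((Finset.mem_filter.1 hK).2.trans hL.symm) h.1 h.2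
  · rw [hv L fun h => hL h.1]
    have h2 : ∀ u : Cube x ⊗[k] Cube y, crossL hwx hwy u L = 0 := by
      intro u
      induction u with
      | zero => simp
      | add u v hu hv => rw [map_add, Pi.add_apply, hu, hv, add_zero]
      | tmul c d => exact cross_apply_of_ne hL c d
    exact h2 _

/-- The sign operator on cochains. -/
def cubeEps (k : Type*) [Field k] [Algebra k R] (x : Fin r → R) : Cube x →ₗ[k] Cube x :=
  LinearMap.pi fun I => ((-1 : k) ^ I.card) • LinearMap.proj I

lemma cubeEps_apply (c : Cube x) (I : Finset (Fin r)) :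
    cubeEps k x c I = ((-1 : R) ^ I.card) • c I := by
  change ((-1 : k) ^ I.card) • c I = _
  exact map_neg_one_pow_smul (A' := R) (AddMonoidHom.id _) _ _

lemma cubeD_cross (c : Cube x) (d : Cube y) {K : Finset (TriIdx t r s)} (hK : preSet idxZ K = ∅) :
    cubeD w triRk (cross hwx hwy c d) K = cross hwx hwy (cubeD x Fin.val c) d K +
      cross hwx hwy (cubeEps k x c) (cubeD y Fin.val d) K := by
  have hZ : ∀ i, preSet idxZ (K.erase i) = ∅ := fun i =>
    Finset.subset_empty.1 (hK ▸ preSet_mono idxZ (K.erase_subset i))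
  rw [cubeD_apply, sum_triIdx, hK, Finset.sum_empty, zero_add, cross_apply hK, cross_apply hK,
    push_cubeD, push_cubeD, Finset.sum_mul, Finset.mul_sum]
  congr 1
  · refine Finset.sum_congr rfl fun b _ => ?_
    rw [cross_apply (hZ _), map_mul, cubeSign_idxX _ _ hK, smul_mul_assoc,
      cubeRes_push_of_preSet_eq idxY_injective hwy d _
        (preSet_erase_of_notMem fun _ => by simp [idxX, idxY])]
  · refine Finset.sum_congr rfl fun b _ => ?_
    rw [cross_apply (hZ _), map_mul, cubeSign_idxY _ _ hK,
      cubeRes_push_of_preSet_eq idxX_injective hwx c _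
        (preSet_erase_of_notMem fun _ => by simp [idxX, idxY]), mul_comm ((-1 : R ⊗[k] S) ^ _),
      mul_smul, mul_smul_comm, push_apply idxX_injective hwx (cubeEps k x c), cubeEps_apply]
    congr 1
    have h1 : locMap idxX_injective hwx K (((-1 : R) ^ (preSet idxX K).card) • c (preSet idxX K)) =
        ((-1 : R ⊗[k] S) ^ (preSet idxX K).card) • push idxX_injective hwx c K :=
      map_neg_one_pow_smul (A' := R ⊗[k] S)
        (locMap idxX_injective hwx K).toRingHom.toAddMonoidHom _ _
    rw [h1, smul_mul_assoc]

end Cross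

end SegreF

end

end

section
open scoped TensorProduct
noncomputable section

set_option linter.unusedSectionVars false

namespace SegreF

/-! ### The Künneth formula for Čech complexes -/

/-- The nonempty sets. -/
def neSet (α : Type*) : Set (Finset α) := {K | K.Nonempty}

lemma neSet_ordConnected (α : Type*) : (neSet α).OrdConnected :=
  ⟨fun _ hK _ _ _ hM => Finset.Nonempty.mono hM.1 hK⟩

section Restricted

variable (k : Type*) [Field k] {R : Type*} [CommRing R] [Algebra k R] {r : ℕ} (x : Fin r → R)

/-- Restriction to the nonempty sets. -/
def neRestr : Cube x →ₗ[k] Cube x := (cubeRestr x (neSet (Fin r))).restrictScalars k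

/-- The differential of the Čech complex of the nonempty sets. -/
def neD : Cube x →ₗ[k] Cube x :=
  neRestr k x ∘ₗ (cubeD x Fin.val).restrictScalars k ∘ₗ neRestr k x

variable {k x}

lemma neRestr_apply_of_nonempty {K : Finset (Fin r)} (hK : K.Nonempty) (c : Cube x) :
    neRestr k x c K = c K := cubeRestr_apply_of_mem hK c

lemma neRestr_apply_empty (c : Cube x) : neRestr k x c ∅ = 0 :=
  cubeRestr_apply_of_notMem Finset.not_nonempty_empty c

lemma neRestr_neRestr (c : Cube x) : neRestr k x (neRestr k x c) = neRestr k x c :=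
  (cubeSupp_restr _ _).restr_eq

lemma cubeSupp_neRestr (c : Cube x) : CubeSupp (neSet _) (neRestr k x c) := cubeSupp_restr _ _

lemma CubeSupp.neRestr_eq {c : Cube x} (hc : CubeSupp (neSet _) c) : neRestr k x c = c :=
  hc.restr_eq

lemma neRestr_cubeEps (c : Cube x) :
    neRestr k x (cubeEps k x c) = cubeEps k x (neRestr k x c) := by
  funext K
  rw [cubeEps_apply]
  obtain rfl | hK := K.eq_empty_or_nonempty
  · rw [neRestr_apply_empty, neRestr_apply_empty, smul_zero]
  · rw [neRestr_apply_of_nonempty hK, neRestr_apply_of_nonempty hK, cubeEps_apply]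

lemma cubeEps_cubeEps (c : Cube x) : cubeEps k x (cubeEps k x c) = c := by
  funext K
  rw [cubeEps_apply, cubeEps_apply, smul_smul, ← mul_pow]
  simp

lemma cubeEps_cubeD (c : Cube x) :
    cubeEps k x (cubeD x Fin.val c) = - cubeD x Fin.val (cubeEps k x c) := by
  funext K
  rw [cubeEps_apply, Pi.neg_apply, cubeD_apply, cubeD_apply, Finset.smul_sum, ← Finset.sum_neg_distrib]
  refine Finset.sum_congr rfl fun i hi => ?_
  rw [cubeEps_apply, map_smul, smul_comm, ← smul_neg, ← Finset.card_erase_add_one hi, pow_succ,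
    mul_neg_one, neg_smul]

lemma neD_neD : neD k x ∘ₗ neD k x = 0 := by
  refine LinearMap.ext fun c => funext fun K => ?_
  change neRestr k x (cubeD x Fin.val (neRestr k x (neRestr k x
    (cubeD x Fin.val (neRestr k x c))))) K = 0
  rw [neRestr_neRestr]
  obtain rfl | hK := K.eq_empty_or_nonempty
  · exact neRestr_apply_empty _
  · rw [neRestr_apply_of_nonempty hK]
    exact cubeD_restr_cubeD_apply (neSet_ordConnected _) Fin.val_injective (cubeSupp_neRestr c) hK

lemma neD_apply_of_supp {c : Cube x} (hc : CubeSupp (neSet _) c) :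
    neD k x c = neRestr k x (cubeD x Fin.val c) := by
  change neRestr k x (cubeD x Fin.val (neRestr k x c)) = _
  rw [hc.neRestr_eq]

lemma neRestr_neD (c : Cube x) : neRestr k x (neD k x c) = neD k x c := neRestr_neRestr _

lemma neD_neRestr (c : Cube x) : neD k x (neRestr k x c) = neD k x c := by
  change neRestr k x (cubeD x Fin.val (neRestr k x (neRestr k x c))) = _
  rw [neRestr_neRestr]
  rfl

lemma isCubeCocycle_iff_neD {c : Cube x} (hc : CubeSupp (neSet _) c) :
    IsCubeCocycle Fin.val (neSet _) c ↔ neD k x c = 0 := by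
  rw [neD_apply_of_supp hc]
  constructor
  · intro h
    funext K
    obtain rfl | hK := K.eq_empty_or_nonempty
    · exact neRestr_apply_empty _
    · rw [neRestr_apply_of_nonempty hK, h K hK]; rfl
  · intro h K hK
    rw [← neRestr_apply_of_nonempty (k := k) hK (cubeD x Fin.val c), h]
    rfl

end Restricted

section Kunneth

variable {k R S : Type*} [Field k] [CommRing R] [Algebra k R] [CommRing S] [Algebra k S]
variable {t r s : ℕ} {x : Fin r → R} {y : Fin s → S} {w : TriIdx t r s → R ⊗[k] S}
  (hwx : ∀ b, w (idxX b) = (Algebra.TensorProduct.includeLeft : R →ₐ[k] R ⊗[k] S) (x b))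
  (hwy : ∀ c, w (idxY c) = (Algebra.TensorProduct.includeRight : S →ₐ[k] R ⊗[k] S) (y c))

lemma cross_congr {c c' : Cube x} {d d' : Cube y} {K : Finset (TriIdx t r s)}
    (hc : c (preSet idxX K) = c' (preSet idxX K)) (hd : d (preSet idxY K) = d' (preSet idxY K)) :
    cross hwx hwy c d K = cross hwx hwy c' d' K := by
  unfold cross
  rw [push_apply, push_apply, push_apply, push_apply, hc, hd]

lemma cross_eq_zero_left {c : Cube x} {d : Cube y} {K : Finset (TriIdx t r s)}
    (hc : c (preSet idxX K) = 0) : cross hwx hwy c d K = 0 := by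
  unfold cross
  rw [push_apply, hc, map_zero, zero_mul, ite_self]

lemma cross_eq_zero_right {c : Cube x} {d : Cube y} {K : Finset (TriIdx t r s)}
    (hd : d (preSet idxY K) = 0) : cross hwx hwy c d K = 0 := by
  unfold cross
  rw [push_apply idxY_injective, hd, map_zero, mul_zero, ite_self]

lemma cross_neRestr (c : Cube x) (d : Cube y) :
    cross hwx hwy (neRestr k x c) (neRestr k y d) =
      cubeRestr w (fam 0 1 1) (cross hwx hwy c d) := by
  funext K
  by_cases hK : K ∈ fam 0 1 1
  · rw [cubeRestr_apply_of_mem hK]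
    exact cross_congr hwx hwy (neRestr_apply_of_nonempty hK.2.1 _)
      (neRestr_apply_of_nonempty hK.2.2 _)
  · rw [cubeRestr_apply_of_notMem hK]
    by_cases hZ : preSet idxZ K = ∅
    · obtain hX | hX := (preSet idxX K).eq_empty_or_nonempty
      · refine cross_eq_zero_left hwx hwy ?_
        rw [hX, neRestr_apply_empty]
      · obtain hY | hY := (preSet idxY K).eq_empty_or_nonempty
        · refine cross_eq_zero_right hwx hwy ?_
          rw [hY, neRestr_apply_empty]
        · exact absurd ⟨hZ, hX, hY⟩ hK
    · exact cross_apply_of_ne hZ _ _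

lemma CubeSupp.cross {c : Cube x} {d : Cube y} (hc : CubeSupp (neSet _) c)
    (hd : CubeSupp (neSet _) d) : CubeSupp (fam 0 1 1) (cross hwx hwy c d) := by
  rw [← hc.neRestr_eq (k := k), ← hd.neRestr_eq (k := k), cross_neRestr]
  exact cubeSupp_restr _ _

lemma crossL_map_neRestr (u : Cube x ⊗[k] Cube y) :
    crossL hwx hwy (TensorProduct.map (neRestr k x) (neRestr k y) u) =
      cubeRestr w (fam 0 1 1) (crossL hwx hwy u) := by
  induction u with
  | zero => simp
  | add u v hu hv => simp only [map_add, hu, hv]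
  | tmul c d => exact cross_neRestr hwx hwy c d

lemma crossL_tensorD (u : Cube x ⊗[k] Cube y) :
    crossL hwx hwy (tensorD (neD k x) (cubeEps k x) (neD k y)
      (TensorProduct.map (neRestr k x) (neRestr k y) u)) =
      cubeRestr w (fam 0 1 1) (cubeD w triRk (cubeRestr w (fam 0 1 1) (crossL hwx hwy u))) := by
  induction u with
  | zero => simp
  | add u v hu hv => simp only [map_add, hu, hv]
  | tmul c d =>
    rw [TensorProduct.map_tmul, tensorD_tmul, map_add, crossL_tmul, crossL_tmul, crossL_tmul,
      ← cross_neRestr, neD_apply_of_supp (cubeSupp_neRestr c), neD_apply_of_supp (cubeSupp_neRestr d),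
      ← neRestr_cubeEps]
    conv_lhs => rw [← neRestr_neRestr d, ← neRestr_neRestr (cubeEps k x c)]
    rw [cross_neRestr, neRestr_cubeEps, neRestr_neRestr, cross_neRestr, ← map_add]
    funext K
    by_cases hK : K ∈ fam 0 1 1
    · rw [cubeRestr_apply_of_mem hK, cubeRestr_apply_of_mem hK, cubeD_cross hwx hwy _ _ hK.1]
      rfl
    · rw [cubeRestr_apply_of_notMem hK, cubeRestr_apply_of_notMem hK]

/-- The Künneth formula: a cocycle is cohomologous to a sum of cross products of cocycles. -/
lemma exists_sum_cross {v : Cube w} (hv : CubeSupp (fam 0 1 1) v)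
    (hv' : IsCubeCocycle triRk (fam 0 1 1) v) :
    ∃ (n : ℕ) (c : Fin n → Cube x) (d : Fin n → Cube y), (∀ i, CubeSupp (neSet _) (c i)) ∧
      (∀ i, CubeSupp (neSet _) (d i)) ∧ (∀ i, IsCubeCocycle Fin.val (neSet _) (c i)) ∧
      (∀ i, IsCubeCocycle Fin.val (neSet _) (d i)) ∧
      IsCubeCobound triRk (fam 0 1 1) (v - ∑ i, cross hwx hwy (c i) (d i)) := by
  obtain ⟨u, hu⟩ := exists_crossL_eq hwx hwy
    (hv.mono fun K hK => (⟨hK.1, trivial, trivial⟩ : K ∈ fam 0 2 2))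
  have h1 : tensorD (neD k x) (cubeEps k x) (neD k y)
      (TensorProduct.map (neRestr k x) (neRestr k y) u) = 0 := by
    refine crossL_injective hwx hwy ?_
    rw [crossL_tensorD, map_zero, hu, hv.restr_eq]
    funext K
    by_cases hK : K ∈ fam 0 1 1
    · rw [cubeRestr_apply_of_mem hK, hv' K hK]; rfl
    · rw [cubeRestr_apply_of_notMem hK]; rfl
  obtain ⟨u', n, c, d, hc, hd, h2⟩ := exists_sum_cocycles
    (LinearMap.ext fun c => cubeEps_cubeEps c) (LinearMap.ext fun c => by
      change cubeEps k x (neRestr k x (cubeD x Fin.val (neRestr k x c))) =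
        - neRestr k x (cubeD x Fin.val (neRestr k x (cubeEps k x c)))
      rw [← neRestr_cubeEps, cubeEps_cubeD, map_neg, neRestr_cubeEps]) neD_neD h1
  refine ⟨n, fun i => neRestr k x (c i), fun i => neRestr k y (d i), fun i => cubeSupp_neRestr _,
    fun i => cubeSupp_neRestr _, fun i => ?_, fun i => ?_,
    cubeRestr w (fam 0 1 1) (crossL hwx hwy u'), cubeSupp_restr _ _, fun K hK => ?_⟩
  · rw [isCubeCocycle_iff_neD (k := k) (cubeSupp_neRestr _), neD_neRestr, hc]
  · rw [isCubeCocycle_iff_neD (k := k) (cubeSupp_neRestr _), neD_neRestr, hd]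
  · have h3 : TensorProduct.map (neRestr k x) (neRestr k y)
        (tensorD (neD k x) (cubeEps k x) (neD k y) u') = tensorD (neD k x) (cubeEps k x) (neD k y)
          (TensorProduct.map (neRestr k x) (neRestr k y) u') := by
      clear h2
      induction u' with
      | zero => simp
      | add u v hu hv => simp only [map_add, hu, hv]
      | tmul c d =>
        simp only [TensorProduct.map_tmul, tensorD_tmul, map_add, neRestr_neD, neD_neRestr,
          neRestr_cubeEps]
    have h4 := congrArg (fun u => crossL hwx hwy (TensorProduct.map (neRestr k x) (neRestr k y) u)) h2
    simp only [map_add, map_sum, h3, crossL_tensorD, crossL_map_neRestr, hu,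
      hv.restr_eq, crossL_tmul, ← cross_neRestr] at h4
    rw [h4, add_sub_cancel_right, cubeRestr_apply_of_mem hK]

lemma isCubeCobound_cross_left {c : Cube x} {d : Cube y}
    (hc : IsCubeCobound Fin.val (neSet _) c) (hd : CubeSupp (neSet _) d)
    (hd' : IsCubeCocycle Fin.val (neSet _) d) :
    IsCubeCobound triRk (fam 0 1 1) (cross hwx hwy c d) := by
  obtain ⟨b, hb, hdb⟩ := hc
  refine ⟨cross hwx hwy b d, hb.cross hwx hwy hd, fun K hK => ?_⟩
  rw [cubeD_cross hwx hwy _ _ hK.1, cross_eq_zero_right hwx hwy (hd' _ hK.2.2), add_zero]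
  exact cross_congr hwx hwy (hdb _ hK.2.1) rfl

lemma isCubeCobound_cross_right {c : Cube x} {d : Cube y} (hc : CubeSupp (neSet _) c)
    (hc' : IsCubeCocycle Fin.val (neSet _) c) (hd : IsCubeCobound Fin.val (neSet _) d) :
    IsCubeCobound triRk (fam 0 1 1) (cross hwx hwy c d) := by
  obtain ⟨b, hb, hdb⟩ := hd
  have h1 : CubeSupp (neSet _) (cubeEps k x c) := by
    rw [← hc.neRestr_eq (k := k), ← neRestr_cubeEps]
    exact cubeSupp_neRestr _
  refine ⟨cross hwx hwy (cubeEps k x c) b, h1.cross hwx hwy hb, fun K hK => ?_⟩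
  rw [cubeD_cross hwx hwy _ _ hK.1, cubeEps_cubeEps, cross_eq_zero_left hwx hwy, zero_add]
  · exact cross_congr hwx hwy rfl (hdb _ hK.2.2)
  · have h2 := congrFun (cubeEps_cubeD (k := k) c) (preSet idxX K)
    rw [cubeEps_apply, hc' _ hK.2.1, smul_zero, Pi.neg_apply, eq_comm, neg_eq_zero] at h2
    exact h2

lemma isCubeCocycle_cross {c : Cube x} {d : Cube y}
    (hc' : IsCubeCocycle Fin.val (neSet _) c)
    (hd' : IsCubeCocycle Fin.val (neSet _) d) :
    IsCubeCocycle triRk (fam 0 1 1) (cross hwx hwy c d) := by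
  intro K hK
  rw [cubeD_cross hwx hwy _ _ hK.1, cross_eq_zero_right hwx hwy (hd' _ hK.2.2), add_zero,
    cross_eq_zero_left hwx hwy (hc' _ hK.2.1)]

/-- Detecting coboundaries with a functional on cochains that kills coboundaries. -/
lemma isCubeCobound_of_cross_right {f : Cube x →ₗ[k] k} (hf : f ∘ₗ neD k x = 0) {c : Cube x}
    (hfc : f c = 1) (hc : CubeSupp (neSet _) c) {d : Cube y} (hd : CubeSupp (neSet _) d)
    (h : IsCubeCobound triRk (fam 0 1 1) (cross hwx hwy c d)) :
    IsCubeCobound Fin.val (neSet _) d := by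
  obtain ⟨b, hb, hdb⟩ := h
  obtain ⟨u, hu⟩ := exists_crossL_eq hwx hwy
    (hb.mono fun K hK => (⟨hK.1, trivial, trivial⟩ : K ∈ fam 0 2 2))
  have h1 : tensorD (neD k x) (cubeEps k x) (neD k y)
      (TensorProduct.map (neRestr k x) (neRestr k y) u) = c ⊗ₜ d := by
    refine crossL_injective hwx hwy ?_
    rw [crossL_tensorD, hu, hb.restr_eq, crossL_tmul]
    funext K
    by_cases hK : K ∈ fam 0 1 1
    · rw [cubeRestr_apply_of_mem hK, hdb K hK]
    · rw [cubeRestr_apply_of_notMem hK, (hc.cross hwx hwy hd) K hK]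
  obtain ⟨e, he⟩ := exists_eq_of_tensorD_eq_tmul hf hfc h1
  refine ⟨neRestr k y e, cubeSupp_neRestr e, fun K hK => ?_⟩
  rw [← he]
  exact (neRestr_apply_of_nonempty (k := k) hK _).symm

lemma isCubeCobound_of_cross_left {f : Cube y →ₗ[k] k} (hf : f ∘ₗ neD k y = 0) {c : Cube x}
    (hc : CubeSupp (neSet _) c) {d : Cube y} (hfd : f d = 1) (hd : CubeSupp (neSet _) d)
    (h : IsCubeCobound triRk (fam 0 1 1) (cross hwx hwy c d)) :
    IsCubeCobound Fin.val (neSet _) c := by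
  obtain ⟨b, hb, hdb⟩ := h
  obtain ⟨u, hu⟩ := exists_crossL_eq hwx hwy
    (hb.mono fun K hK => (⟨hK.1, trivial, trivial⟩ : K ∈ fam 0 2 2))
  have h1 : tensorD (neD k x) (cubeEps k x) (neD k y)
      (TensorProduct.map (neRestr k x) (neRestr k y) u) = c ⊗ₜ d := by
    refine crossL_injective hwx hwy ?_
    rw [crossL_tensorD, hu, hb.restr_eq, crossL_tmul]
    funext K
    by_cases hK : K ∈ fam 0 1 1
    · rw [cubeRestr_apply_of_mem hK, hdb K hK]
    · rw [cubeRestr_apply_of_notMem hK, (hc.cross hwx hwy hd) K hK]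
  obtain ⟨e, he⟩ := exists_eq_of_tensorD_eq_tmul_left hf hfd h1
  refine ⟨neRestr k x e, cubeSupp_neRestr e, fun K hK => ?_⟩
  rw [← he]
  exact (neRestr_apply_of_nonempty (k := k) hK _).symm

end Kunneth

end SegreF

end

end

section
open scoped TensorProduct LaurentPolynomial
noncomputable section

set_option linter.unusedSectionVars false

namespace SegreF

/-! ### Push forwards and gradings -/

section PushGraded

variable {k A B : Type*} [Field k] [CommRing A] [Algebra k A] [CommRing B] [Algebra k B]

/-- The coaction that puts everything in degree zero. -/
def trivialCoaction (A : Type*) [CommRing A] : A →+* A[T;T⁻¹] :=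
  AddMonoidAlgebra.singleZeroRingHom

lemma mem_homog_trivialCoaction (a : A) : a ∈ homog (trivialCoaction A) 0 := rfl

lemma mapRingHom_comp_trivialCoaction {f : A →+* B} {σ : B →+* B[T;T⁻¹]}
    (h : ∀ a, f a ∈ homog σ 0) :
    (AddMonoidAlgebra.mapRingHom ℤ f).comp (trivialCoaction A) = σ.comp f := by
  ext1 a
  exact (AddMonoidAlgebra.mapRingHom_single f 0 a).trans (mem_homog.1 (h a)).symm

lemma mapRingHom_comp_gradedCoaction {𝒜 : ℕ → Submodule k A} [GradedAlgebra 𝒜] {f : A →+* B}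
    {σ : B →+* B[T;T⁻¹]} (h : ∀ n, ∀ a ∈ 𝒜 n, f a ∈ homog σ n) :
    (AddMonoidAlgebra.mapRingHom ℤ f).comp (gradedCoaction 𝒜) = σ.comp f := by
  ext1 a
  induction a using DirectSum.Decomposition.inductionOn 𝒜 with
  | zero => simp
  | add a b ha hb => rw [map_add, map_add, ha, hb]
  | @homogeneous i m =>
    rw [RingHom.comp_apply, mem_homog.1 (mem_homog_gradedCoaction m.2),
      AddMonoidAlgebra.mapRingHom_single]
    exact (mem_homog.1 (h i m m.2)).symm

variable {α ι : Type*} [Fintype α] [DecidableEq α] [DecidableEq ι]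
variable {φ : A →ₐ[k] B} {e : α → ι} (he : Function.Injective e) {x : α → A} {w : ι → B}
  (hw : ∀ a, w (e a) = φ (x a)) {ρ : A →+* A[T;T⁻¹]} {σ : B →+* B[T;T⁻¹]}
  (hφ : (AddMonoidAlgebra.mapRingHom ℤ (φ : A →+* B)).comp ρ = σ.comp (φ : A →+* B))
  {δ : α → ℤ} {δ' : ι → ℤ} (hρ : ∀ a, x a ∈ homog ρ (δ a)) (hσ : ∀ i, w i ∈ homog σ (δ' i))

include hφ in
lemma locMap_naturality (K : Finset ι) :
    (AddMonoidAlgebra.mapRingHom ℤ (locMap he hw K).toRingHom).comp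
      (cubeCoaction ρ hρ (preSet e K)) =
      (cubeCoaction σ hσ K).comp (locMap he hw K).toRingHom :=
  locCoaction_naturality _ _ hφ (RingHom.ext fun a => locMap_algebraMap he hw K a)

include hφ in
lemma cubeProj_push (n : ℤ) (c : Cube x) :
    (cubeProj hσ n).map (push he hw c) = push he hw ((cubeProj hρ n).map c) :=
  funext fun K => homogProj_map (locMap_naturality he hw hφ hρ hσ K) n (c (preSet e K))

lemma push_mem_homog_zero (h : ∀ a, φ a ∈ homog σ 0) (c : Cube x) (K : Finset ι) :
    push he hw c K ∈ homog (cubeCoaction σ hσ K) 0 := by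
  refine map_mem_homog (locMap_naturality he hw (mapRingHom_comp_trivialCoaction h)
    (δ := fun _ => 0) (fun a => mem_homog_trivialCoaction _) hσ K) ?_
  obtain ⟨N, a, ha⟩ := IsLocalization.Away.surj (∏ a ∈ preSet e K, x a) (c (preSet e K))
  refine mem_homog_locCoaction _ ha ?_
  simpa using mem_homog_trivialCoaction a

variable (p : ℕ) [Fact p.Prime] [CharP k p]

lemma iterate_frobOp_push (m : ℕ) (c : Cube x) :
    (frobOp k p w).map^[m] (push he hw c) = push he hw ((frobOp k p x).map^[m] c) := by
  funext K
  rw [iterate_frobOp_apply, push_apply, push_apply, iterate_frobOp_apply, map_pow]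

end PushGraded

/-! ### The cochains of a Segre product -/

section Setup

variable {k R S : Type*} [Field k] [CommRing R] [Algebra k R] [CommRing S] [Algebra k S]
  {𝓡 : ℕ → Submodule k R} [GradedAlgebra 𝓡] {𝓢 : ℕ → Submodule k S} [GradedAlgebra 𝓢]
  {r s t : ℕ} (x : Fin r → R) (y : Fin s → S) (z : Fin t → segre 𝓡 𝓢)

/-- The elements `z`, `x ⊗ 1` and `1 ⊗ y` of `R ⊗ S`. -/
def segreTriple : TriIdx t r s → R ⊗[k] S
  | .inl a => (z a : R ⊗[k] S)
  | .inr (.inl b) => x b ⊗ₜ 1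
  | .inr (.inr c) => 1 ⊗ₜ y c

lemma segreTriple_idxZ (a : Fin t) :
    segreTriple x y z (idxZ a) = (segre 𝓡 𝓢).val (z a) := rfl

lemma segreTriple_idxX (b : Fin r) : segreTriple x y z (idxX b) =
    (Algebra.TensorProduct.includeLeft : R →ₐ[k] R ⊗[k] S) (x b) := rfl

lemma segreTriple_idxY (c : Fin s) : segreTriple x y z (idxY c) =
    (Algebra.TensorProduct.includeRight : S →ₐ[k] R ⊗[k] S) (y c) := rfl

/-- The degrees of `z`, `x ⊗ 1` and `1 ⊗ y`. -/
def segreDeg (u v : ℤ) : TriIdx t r s → ℤ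
  | .inl _ => u + v
  | .inr (.inl _) => u
  | .inr (.inr _) => v

variable {x y z}

lemma segreTriple_mem_homog (hx : ∀ i, x i ∈ 𝓡 1) (hy : ∀ i, y i ∈ 𝓢 1)
    (hz : ∀ i, z i ∈ segreGrading 𝓡 𝓢 1) (u v : ℤ) (i : TriIdx t r s) :
    segreTriple x y z i ∈ homog (tensorCoaction 𝓡 𝓢 u v) (segreDeg u v i) := by
  rcases i with a | b | c
  · have := segrePart_le_homog u v (show ((z a : segre 𝓡 𝓢) : R ⊗[k] S) ∈ _ from hz a)
    rwa [Nat.cast_one, mul_one] at this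
  · have := tmul_mem_homog u v (hx b) (SetLike.GradedOne.one_mem (A := 𝓢))
    rwa [Nat.cast_one, Nat.cast_zero, mul_one, mul_zero, add_zero] at this
  · have := tmul_mem_homog u v (SetLike.GradedOne.one_mem (A := 𝓡)) (hy c)
    rwa [Nat.cast_one, Nat.cast_zero, mul_one, mul_zero, zero_add] at this

lemma segrePart_one_le_span_left (hR : IsStandardGraded 𝓡) (hx : IsLinearGenerators x 𝓡)
    {b : R ⊗[k] S} (hb : b ∈ segrePart 𝓡 𝓢 1) :
    b ∈ Ideal.span (segreTriple x y z '' Set.range idxX) := by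
  have h1 : segrePart 𝓡 𝓢 1 ≤
      (Ideal.span (segreTriple x y z '' Set.range idxX)).restrictScalars k := by
    refine segrePart_le fun a ha b _ => ?_
    have h2 := hR.degree_one_le_span hx ha
    clear ha
    induction h2 using Submodule.span_induction with
    | mem a ha =>
      obtain ⟨i, rfl⟩ := ha
      have h3 : x i ⊗ₜ[k] b = (1 ⊗ₜ b) * segreTriple x y z (idxX i) :=
        ((Algebra.TensorProduct.tmul_mul_tmul _ _ _ _).trans (by rw [one_mul, mul_one])).symm
      rw [Submodule.restrictScalars_mem, h3]
      exact Ideal.mul_mem_left _ _ (Ideal.subset_span ⟨_, ⟨i, rfl⟩, rfl⟩)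
    | zero => rw [TensorProduct.zero_tmul]; exact zero_mem _
    | add a a' _ _ h h' => rw [TensorProduct.add_tmul]; exact add_mem h h'
    | smul q a _ h => rw [← TensorProduct.smul_tmul']; exact Submodule.smul_mem _ _ h
  exact h1 hb

lemma segrePart_one_le_span_right (hS : IsStandardGraded 𝓢) (hy : IsLinearGenerators y 𝓢)
    {b : R ⊗[k] S} (hb : b ∈ segrePart 𝓡 𝓢 1) :
    b ∈ Ideal.span (segreTriple x y z '' Set.range idxY) := by
  have h1 : segrePart 𝓡 𝓢 1 ≤
      (Ideal.span (segreTriple x y z '' Set.range idxY)).restrictScalars k := by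
    refine segrePart_le fun a _ b hb => ?_
    have h2 := hS.degree_one_le_span hy hb
    clear hb
    induction h2 using Submodule.span_induction with
    | mem b hb =>
      obtain ⟨i, rfl⟩ := hb
      have h3 : a ⊗ₜ[k] y i = (a ⊗ₜ 1) * segreTriple x y z (idxY i) :=
        ((Algebra.TensorProduct.tmul_mul_tmul _ _ _ _).trans (by rw [one_mul, mul_one])).symm
      rw [Submodule.restrictScalars_mem, h3]
      exact Ideal.mul_mem_left _ _ (Ideal.subset_span ⟨_, ⟨i, rfl⟩, rfl⟩)
    | zero => rw [TensorProduct.tmul_zero]; exact zero_mem _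
    | add a a' _ _ h h' => rw [TensorProduct.tmul_add]; exact add_mem h h'
    | smul q a _ h => rw [TensorProduct.tmul_smul]; exact Submodule.smul_mem _ _ h
  exact h1 hb

lemma tmul_mem_span_idxZ (hx : ∀ i, x i ∈ 𝓡 1) (hy : ∀ i, y i ∈ 𝓢 1)
    (hz : IsLinearGenerators z (segreGrading 𝓡 𝓢)) (b : Fin r) (c : Fin s) :
    x b ⊗ₜ[k] y c ∈ Ideal.span (segreTriple x y z '' Set.range idxZ) := by
  have h1 := tmul_mem_segrePart (hx b) (hy c)
  have h2 : (⟨x b ⊗ₜ[k] y c, segrePart_le_segre 1 h1⟩ : segre 𝓡 𝓢) ∈ Ideal.span (Set.range z) := by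
    rw [hz.2]
    exact degree_one_le_irrelevant (𝒜 := segreGrading 𝓡 𝓢) h1
  have h3 := Ideal.mem_map_of_mem (segre 𝓡 𝓢).val h2
  rw [Ideal.map_span, ← Set.range_comp] at h3
  rw [← Set.range_comp]
  exact h3

lemma isTriple_segreTriple (hR : IsStandardGraded 𝓡) (hS : IsStandardGraded 𝓢)
    (hx : IsLinearGenerators x 𝓡) (hy : IsLinearGenerators y 𝓢)
    (hz : IsLinearGenerators z (segreGrading 𝓡 𝓢)) : IsTriple (segreTriple x y z) where
  memX a := segrePart_one_le_span_left hR hx (hz.1 a)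
  memY a := segrePart_one_le_span_right hS hy (hz.1 a)
  memZ b c := by
    have h1 : segreTriple x y z (idxX b) * segreTriple x y z (idxY c) = x b ⊗ₜ[k] y c :=
      (Algebra.TensorProduct.tmul_mul_tmul _ _ _ _).trans (by rw [one_mul, mul_one])
    rw [h1]
    exact tmul_mem_span_idxZ hx.1 hy.1 hz b c

/-! ### Cross products and gradings -/

/-- The cross product of cochains of `R` and `S`. -/
abbrev segreCross (x : Fin r → R) (y : Fin s → S) (z : Fin t → segre 𝓡 𝓢) (c : Cube x)
    (d : Cube y) : Cube (segreTriple x y z) :=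
  cross (segreTriple_idxX x y z) (segreTriple_idxY x y z) c d

lemma segreCross_apply {K : Finset (TriIdx t r s)} (hK : preSet idxZ K = ∅) (c : Cube x)
    (d : Cube y) : segreCross x y z c d K =
      push idxX_injective (segreTriple_idxX x y z) c K *
        push idxY_injective (segreTriple_idxY x y z) d K := if_pos hK

lemma segreCross_apply_of_ne {K : Finset (TriIdx t r s)} (hK : preSet idxZ K ≠ ∅) (c : Cube x)
    (d : Cube y) : segreCross x y z c d K = 0 := if_neg hK

variable (hx : ∀ i, x i ∈ 𝓡 1) (hy : ∀ i, y i ∈ 𝓢 1) (hz : ∀ i, z i ∈ segreGrading 𝓡 𝓢 1)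

lemma includeLeft_mem_homog (u v : ℤ) {n : ℕ} {a : R} (ha : a ∈ 𝓡 n) :
    (Algebra.TensorProduct.includeLeft : R →ₐ[k] R ⊗[k] S) a ∈
      homog (tensorCoaction 𝓡 𝓢 u v) (u * n) := by
  simpa using tmul_mem_homog u v ha (SetLike.GradedOne.one_mem (A := 𝓢))

lemma includeRight_mem_homog (u v : ℤ) {n : ℕ} {a : S} (ha : a ∈ 𝓢 n) :
    (Algebra.TensorProduct.includeRight : S →ₐ[k] R ⊗[k] S) a ∈
      homog (tensorCoaction 𝓡 𝓢 u v) (v * n) := by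
  simpa using tmul_mem_homog u v (SetLike.GradedOne.one_mem (A := 𝓡)) ha

lemma includeRight_mem_homog_zero (u : ℤ) (a : S) :
    (Algebra.TensorProduct.includeRight : S →ₐ[k] R ⊗[k] S) a ∈
      homog (tensorCoaction 𝓡 𝓢 u 0) 0 := by
  classical
  rw [← DirectSum.sum_support_decompose 𝓢 a, map_sum]
  refine sum_mem fun n _ => ?_
  simpa using includeRight_mem_homog (𝓡 := 𝓡) (𝓢 := 𝓢) u 0 (SetLike.coe_mem (DirectSum.decompose 𝓢 a n))

lemma includeLeft_mem_homog_zero (v : ℤ) (a : R) :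
    (Algebra.TensorProduct.includeLeft : R →ₐ[k] R ⊗[k] S) a ∈
      homog (tensorCoaction 𝓡 𝓢 0 v) 0 := by
  classical
  rw [← DirectSum.sum_support_decompose 𝓡 a, map_sum]
  refine sum_mem fun n _ => ?_
  simpa using includeLeft_mem_homog (𝓡 := 𝓡) (𝓢 := 𝓢) 0 v (SetLike.coe_mem (DirectSum.decompose 𝓡 a n))

lemma cubeProj_segreCross_left (n : ℤ) (c : Cube x) (d : Cube y) :
    (cubeProj (segreTriple_mem_homog hx hy hz 1 0) n).map (segreCross x y z c d) =
      segreCross x y z ((cubeProj (mem_homog_of_linear hx) n).map c) d := by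
  funext K
  change homogProj _ n _ = _
  by_cases hK : preSet idxZ K = ∅
  · rw [segreCross_apply hK, segreCross_apply hK, mul_comm, homogProj_mul_of_mem
      ((isGradedBy_tensorCoaction 1 0).locCoaction _)
      (push_mem_homog_zero idxY_injective _ (segreTriple_mem_homog hx hy hz 1 0)
        (includeRight_mem_homog_zero 1) d K), sub_zero,
      mul_comm]
    refine congrArg (· * _) (congrFun (cubeProj_push idxX_injective _
      (mapRingHom_comp_gradedCoaction fun m a ha => ?_) (mem_homog_of_linear hx)
      (segreTriple_mem_homog hx hy hz 1 0) n c) K)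
    simpa using includeLeft_mem_homog (𝓢 := 𝓢) 1 0 ha
  · rw [segreCross_apply_of_ne hK, segreCross_apply_of_ne hK, map_zero]

lemma cubeProj_segreCross_right (n : ℤ) (c : Cube x) (d : Cube y) :
    (cubeProj (segreTriple_mem_homog hx hy hz 0 1) n).map (segreCross x y z c d) =
      segreCross x y z c ((cubeProj (mem_homog_of_linear hy) n).map d) := by
  funext K
  change homogProj _ n _ = _
  by_cases hK : preSet idxZ K = ∅
  · rw [segreCross_apply hK, segreCross_apply hK, homogProj_mul_of_mem
      ((isGradedBy_tensorCoaction 0 1).locCoaction _)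
      (push_mem_homog_zero idxX_injective _ (segreTriple_mem_homog hx hy hz 0 1)
        (includeLeft_mem_homog_zero 1) c K), sub_zero]
    refine congrArg (_ * ·) (congrFun (cubeProj_push idxY_injective _
      (mapRingHom_comp_gradedCoaction fun m a ha => ?_) (mem_homog_of_linear hy)
      (segreTriple_mem_homog hx hy hz 0 1) n d) K)
    simpa using includeRight_mem_homog (𝓡 := 𝓡) 0 1 ha
  · rw [segreCross_apply_of_ne hK, segreCross_apply_of_ne hK, map_zero]

lemma iterate_frobOp_segreCross (p : ℕ) [Fact p.Prime] [CharP k p] (m : ℕ) (c : Cube x)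
    (d : Cube y) : (frobOp k p (segreTriple x y z)).map^[m] (segreCross x y z c d) =
      segreCross x y z ((frobOp k p x).map^[m] c) ((frobOp k p y).map^[m] d) := by
  funext K
  rw [iterate_frobOp_apply]
  by_cases hK : preSet idxZ K = ∅
  · rw [segreCross_apply hK, segreCross_apply hK, mul_pow, ← iterate_frobOp_push, ← iterate_frobOp_push,
      iterate_frobOp_apply, iterate_frobOp_apply]
  · rw [segreCross_apply_of_ne hK, segreCross_apply_of_ne hK,
      zero_pow (pow_ne_zero _ (Fact.out : p.Prime).ne_zero)]

/-- The parts of a cross product, according to the number of indices. -/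
lemma cubeRestr_card_segreCross (j : ℕ) (c : Cube x) (d : Cube y) :
    cubeRestr _ (cardSet _ j) (segreCross x y z c d) =
      ∑ q ∈ Finset.HasAntidiagonal.antidiagonal j, segreCross x y z (cubeRestr x (cardSet _ q.1) c)
        (cubeRestr y (cardSet _ q.2) d) := by
  funext K
  rw [Finset.sum_apply]
  by_cases hZ : preSet idxZ K = ∅
  · have hcard : K.card = (preSet idxX K).card + (preSet idxY K).card := by
      rw [card_triIdx, hZ, Finset.card_empty, zero_add]
    have h0 : ∀ q : ℕ × ℕ, q ≠ ((preSet idxX K).card, (preSet idxY K).card) →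
        segreCross x y z (cubeRestr x (cardSet _ q.1) c) (cubeRestr y (cardSet _ q.2) d) K = 0 := by
      intro q hq
      by_cases h1 : (preSet idxX K).card = q.1
      · refine cross_eq_zero_right _ _ (cubeRestr_apply_of_notMem (fun h2 => hq ?_) _)
        exact Prod.ext h1.symm (show (preSet idxY K).card = q.2 from h2).symm
      · exact cross_eq_zero_left _ _ (cubeRestr_apply_of_notMem h1 _)
    by_cases hj : K.card = j
    · rw [cubeRestr_apply_of_mem (show K ∈ cardSet _ j from hj),
        Finset.sum_eq_single ((preSet idxX K).card, (preSet idxY K).card) (fun q _ hq => h0 q hq)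
          (fun h => absurd (Finset.HasAntidiagonal.mem_antidiagonal.2 (hcard.symm.trans hj)) h)]
      exact cross_congr _ _ (cubeRestr_apply_of_mem (show _ ∈ cardSet _ _ from rfl) _).symm
        (cubeRestr_apply_of_mem (show _ ∈ cardSet _ _ from rfl) _).symm
    · rw [cubeRestr_apply_of_notMem (show K ∉ cardSet _ j from hj)]
      refine (Finset.sum_eq_zero fun q hq => h0 q ?_).symm
      rintro rfl
      exact hj (hcard.trans (Finset.HasAntidiagonal.mem_antidiagonal.1 hq))
  · rw [Finset.sum_eq_zero fun q _ => segreCross_apply_of_ne hZ _ _]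
    by_cases hj : K ∈ cardSet _ j
    · rw [cubeRestr_apply_of_mem hj, segreCross_apply_of_ne hZ]
    · rw [cubeRestr_apply_of_notMem hj]

end Setup

end SegreF

end

end

section
open scoped TensorProduct LaurentPolynomial
noncomputable section

set_option linter.unusedSectionVars false

namespace SegreF

/-! ### The cochains of the Segre product inside those of the tensor product -/

section SegrePush

variable {k R S : Type*} [Field k] [CommRing R] [Algebra k R] [CommRing S] [Algebra k S]
  {𝓡 : ℕ → Submodule k R} [GradedAlgebra 𝓡] {𝓢 : ℕ → Submodule k S} [GradedAlgebra 𝓢]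
  {r s t : ℕ} (x : Fin r → R) (y : Fin s → S) (z : Fin t → segre 𝓡 𝓢)

/-- The push forward of the cochains of the Segre product to the sets within the first block. -/
def segrePush : Cube z →ₗ[k] Cube (segreTriple x y z) :=
  (cubeRestr (segreTriple x y z) (fam 2 0 0)).restrictScalars k ∘ₗ
    push idxZ_injective (segreTriple_idxZ x y z)

variable {x y z}

lemma segrePush_apply {K : Finset (TriIdx t r s)} (hK : K ∈ fam 2 0 0) (c : Cube z) :
    segrePush x y z c K = push idxZ_injective (segreTriple_idxZ x y z) c K :=
  cubeRestr_apply_of_mem hK _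

lemma segrePush_apply_of_notMem {K : Finset (TriIdx t r s)} (hK : K ∉ fam 2 0 0) (c : Cube z) :
    segrePush x y z c K = 0 :=
  cubeRestr_apply_of_notMem hK _

lemma cubeSupp_segrePush (c : Cube z) : CubeSupp (fam 2 0 0) (segrePush x y z c) :=
  cubeSupp_restr _ _

lemma card_of_mem_fam {K : Finset (TriIdx t r s)} (hK : K ∈ fam 2 0 0) :
    (preSet idxZ K).card = K.card := by
  rw [card_triIdx, partOk_zero.1 hK.2.1, partOk_zero.1 hK.2.2]
  rfl

lemma segrePush_card (j : ℕ) (c : Cube z) :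
    segrePush x y z (cubeRestr z (cardSet _ j) c) =
      cubeRestr _ (cardSet _ j) (segrePush x y z c) := by
  funext K
  by_cases hK : K ∈ fam 2 0 0
  · rw [segrePush_apply hK, push_apply]
    by_cases hj : K.card = j
    · rw [cubeRestr_apply_of_mem (show _ ∈ cardSet _ j from (card_of_mem_fam hK).trans hj),
        cubeRestr_apply_of_mem (show K ∈ cardSet _ j from hj), segrePush_apply hK, push_apply]
    · rw [cubeRestr_apply_of_notMem fun h => hj ((card_of_mem_fam hK).symm.trans h),
        cubeRestr_apply_of_notMem (show K ∉ cardSet _ j from hj), map_zero]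
  · rw [segrePush_apply_of_notMem hK]
    by_cases hj : K ∈ cardSet _ j
    · rw [cubeRestr_apply_of_mem hj, segrePush_apply_of_notMem hK]
    · rw [cubeRestr_apply_of_notMem hj]

lemma mem_fam_erase {K : Finset (TriIdx t r s)} (hK : K ∈ fam 2 0 0) (i : TriIdx t r s) :
    K.erase i ∈ fam 2 0 0 :=
  ⟨trivial, Finset.subset_empty.1 (partOk_zero.1 hK.2.1 ▸ preSet_mono idxX (K.erase_subset i)),
    Finset.subset_empty.1 (partOk_zero.1 hK.2.2 ▸ preSet_mono idxY (K.erase_subset i))⟩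

lemma cubeD_segrePush (c : Cube z) {K : Finset (TriIdx t r s)} (hK : K ∈ fam 2 0 0) :
    cubeD _ triRk (segrePush x y z c) K = segrePush x y z (cubeD z Fin.val c) K := by
  rw [cubeD_apply, sum_triIdx, partOk_zero.1 hK.2.1, partOk_zero.1 hK.2.2, Finset.sum_empty,
    Finset.sum_empty, add_zero, add_zero, segrePush_apply hK, push_cubeD]
  refine Finset.sum_congr rfl fun a _ => ?_
  rw [cubeSign_idxZ, segrePush_apply (mem_fam_erase hK _)]

lemma iterate_frobOp_segrePush (p : ℕ) [Fact p.Prime] [CharP k p] (m : ℕ) (c : Cube z) :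
    (frobOp k p (segreTriple x y z)).map^[m] (segrePush x y z c) =
      segrePush x y z ((frobOp k p z).map^[m] c) := by
  funext K
  rw [iterate_frobOp_apply]
  by_cases hK : K ∈ fam 2 0 0
  · rw [segrePush_apply hK, segrePush_apply hK, ← iterate_frobOp_push, iterate_frobOp_apply]
  · rw [segrePush_apply_of_notMem hK, segrePush_apply_of_notMem hK,
      zero_pow (pow_ne_zero _ (Fact.out : p.Prime).ne_zero)]

lemma cubeProj_segrePush (hx : ∀ i, x i ∈ 𝓡 1) (hy : ∀ i, y i ∈ 𝓢 1)
    (hz : ∀ i, z i ∈ segreGrading 𝓡 𝓢 1) {u v : ℤ} (huv : u + v = 1) (n : ℤ) (c : Cube z) :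
    (cubeProj (segreTriple_mem_homog hx hy hz u v) n).map (segrePush x y z c) =
      segrePush x y z ((cubeProj (mem_homog_of_linear hz) n).map c) := by
  refine (CubeOp.map_restr _ _ _).trans (congrArg _ (cubeProj_push _ _ ?_ _ _ n c))
  refine mapRingHom_comp_gradedCoaction fun m a ha => ?_
  have := segrePart_le_homog u v (show (a : R ⊗[k] S) ∈ segrePart 𝓡 𝓢 m from ha)
  rwa [huv, one_mul] at this

lemma preSet_idxZ_image (K : Finset (Fin t)) :
    preSet idxZ (K.image idxZ : Finset (TriIdx t r s)) = K := by
  ext a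
  simp [mem_preSet, idxZ]

lemma image_idxZ_mem_fam (K : Finset (Fin t)) :
    (K.image idxZ : Finset (TriIdx t r s)) ∈ fam 2 0 0 := by
  refine ⟨trivial, ?_, ?_⟩ <;> rw [partOk_zero] <;> ext a <;> simp [mem_preSet, idxZ, idxX, idxY]

lemma prod_segreTriple {K : Finset (TriIdx t r s)} (hK : K ∈ fam 2 0 0) :
    ∏ i ∈ K, segreTriple x y z i = (segre 𝓡 𝓢).val (∏ a ∈ preSet idxZ K, z a) := by
  rw [prod_triIdx, partOk_zero.1 hK.2.1, partOk_zero.1 hK.2.2, Finset.prod_empty,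
    Finset.prod_empty, mul_one, mul_one, map_prod]
  rfl

lemma locMap_idxZ_injective {K : Finset (TriIdx t r s)} (hK : K ∈ fam 2 0 0) :
    Function.Injective (locMap idxZ_injective (segreTriple_idxZ x y z) K) := by
  rw [injective_iff_map_eq_zero]
  intro m hm
  obtain ⟨N, a, ha⟩ := IsLocalization.Away.surj (∏ a ∈ preSet idxZ K, z a) m
  have h1 := congrArg (locMap idxZ_injective (segreTriple_idxZ x y z) K) ha
  rw [map_mul, hm, zero_mul, locMap_algebraMap, eq_comm, IsLocalization.map_eq_zero_iff
    (Submonoid.powers (∏ i ∈ K, segreTriple x y z i))] at h1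
  obtain ⟨⟨_, l, rfl⟩, h2⟩ := h1
  have h3 : (∏ a ∈ preSet idxZ K, z a) ^ l * a = 0 := by
    refine Subtype.val_injective ?_
    change (∏ i ∈ K, segreTriple x y z i) ^ l * (segre 𝓡 𝓢).val a = 0 at h2
    rw [prod_segreTriple hK, ← map_pow, ← map_mul] at h2
    exact h2
  have h4 : algebraMap _ (CubeLoc z (preSet idxZ K)) a = 0 :=
    (IsLocalization.map_eq_zero_iff (Submonoid.powers (∏ a ∈ preSet idxZ K, z a)) _ _).2
      ⟨⟨_, l, rfl⟩, h3⟩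
  rw [h4] at ha
  exact (IsUnit.mul_left_eq_zero ((IsLocalization.Away.algebraMap_isUnit _).pow N)).1 ha

lemma segrePush_injective : Function.Injective (segrePush x y z) := by
  rw [injective_iff_map_eq_zero]
  intro c hc
  have h1 : ∀ K ∈ (fam 2 0 0 : Set (Finset (TriIdx t r s))), c (preSet idxZ K) = 0 := by
    intro K hK
    have h2 := congrFun hc K
    rw [segrePush_apply hK, push_apply] at h2
    exact (injective_iff_map_eq_zero _).1 (locMap_idxZ_injective hK) _ h2
  funext K
  have h2 := h1 _ (image_idxZ_mem_fam K)
  rwa [preSet_idxZ_image] at h2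

/-- The bihomogeneous elements of the same degree for both gradings lie in the Segre product. -/
lemma homogProj_homogProj_mem_segrePart (n : ℕ) (b : R ⊗[k] S) :
    homogProj (tensorCoaction 𝓡 𝓢 0 1) n (homogProj (tensorCoaction 𝓡 𝓢 1 0) n b) ∈
      segrePart 𝓡 𝓢 n := by
  classical
  induction b with
  | zero => simp
  | add a b ha hb => rw [map_add, map_add]; exact add_mem ha hb
  | tmul a b =>
    rw [← DirectSum.sum_support_decompose 𝓡 a, ← DirectSum.sum_support_decompose 𝓢 b,
      TensorProduct.sum_tmul, map_sum, map_sum]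
    refine sum_mem fun m _ => ?_
    rw [TensorProduct.tmul_sum, map_sum, map_sum]
    refine sum_mem fun l _ => ?_
    rw [homogProj_of_mem (tmul_mem_homog 1 0 (SetLike.coe_mem (DirectSum.decompose 𝓡 a m))
      (SetLike.coe_mem (DirectSum.decompose 𝓢 b l)))]
    split_ifs with h1
    · rw [homogProj_of_mem (tmul_mem_homog 0 1 (SetLike.coe_mem (DirectSum.decompose 𝓡 a m))
        (SetLike.coe_mem (DirectSum.decompose 𝓢 b l)))]
      split_ifs with h2
      · have h3 : m = n := by omega
        have h4 : l = n := by omega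
        subst h3
        subst h4
        exact tmul_mem_segrePart (SetLike.coe_mem _) (SetLike.coe_mem _)
      · exact zero_mem _
    · rw [map_zero]; exact zero_mem _

lemma homogProj_eq_zero_of_neg {n : ℤ} (hn : n < 0) (b : R ⊗[k] S) :
    homogProj (tensorCoaction 𝓡 𝓢 1 0) n b = 0 := by
  classical
  induction b with
  | zero => simp
  | add a b ha hb => rw [map_add, ha, hb, add_zero]
  | tmul a b =>
    rw [← DirectSum.sum_support_decompose 𝓡 a, ← DirectSum.sum_support_decompose 𝓢 b,
      TensorProduct.sum_tmul, map_sum]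
    refine Finset.sum_eq_zero fun m _ => ?_
    rw [TensorProduct.tmul_sum, map_sum]
    refine Finset.sum_eq_zero fun l _ => ?_
    rw [homogProj_of_mem (tmul_mem_homog 1 0 (SetLike.coe_mem (DirectSum.decompose 𝓡 a m))
      (SetLike.coe_mem (DirectSum.decompose 𝓢 b l))), if_neg (by omega)]

/-- The bihomogeneous part of the elements of `R ⊗ S` of the same degree for both gradings is the
homogeneous part of the Segre product. -/
lemma exists_homogProj_homogProj_eq (n : ℤ) (b : R ⊗[k] S) :
    ∃ a ∈ homog (gradedCoaction (segreGrading 𝓡 𝓢)) n, (segre 𝓡 𝓢).val a =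
      homogProj (tensorCoaction 𝓡 𝓢 0 1) n (homogProj (tensorCoaction 𝓡 𝓢 1 0) n b) := by
  obtain hn | hn := lt_or_ge n 0
  · exact ⟨0, zero_mem _, by rw [homogProj_eq_zero_of_neg hn, map_zero, map_zero]⟩
  · lift n to ℕ using hn
    have h := homogProj_homogProj_mem_segrePart (𝓡 := 𝓡) (𝓢 := 𝓢) n b
    exact ⟨⟨_, segrePart_le_segre n h⟩, mem_homog_gradedCoaction (𝒜 := segreGrading 𝓡 𝓢) h, rfl⟩

variable (hx : ∀ i, x i ∈ 𝓡 1) (hy : ∀ i, y i ∈ 𝓢 1) (hz : ∀ i, z i ∈ segreGrading 𝓡 𝓢 1)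

/-- The projection to the cochains that have degree `n` for both gradings. -/
def biProj (n : ℤ) (u : Cube (segreTriple x y z)) : Cube (segreTriple x y z) :=
  (cubeProj (segreTriple_mem_homog hx hy hz 0 1) n).map
    ((cubeProj (segreTriple_mem_homog hx hy hz 1 0) n).map u)

lemma segreDeg_sum {K : Finset (TriIdx t r s)} (hK : K ∈ fam 2 0 0) {u v : ℤ} (huv : u + v = 1) :
    ∑ i ∈ K, segreDeg u v i = (preSet idxZ K).card := by
  rw [sum_triIdx, partOk_zero.1 hK.2.1, partOk_zero.1 hK.2.2, Finset.sum_empty,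
    Finset.sum_empty, add_zero, add_zero]
  refine (Finset.sum_congr rfl fun a _ => (huv : segreDeg u v (idxZ a) = 1)).trans ?_
  simp

lemma exists_locMap_eq {K : Finset (TriIdx t r s)} (hK : K ∈ fam 2 0 0) (n : ℤ)
    (u : Cube (segreTriple x y z)) :
    ∃ m ∈ homog (cubeCoaction (gradedCoaction (segreGrading 𝓡 𝓢)) (mem_homog_of_linear hz)
      (preSet idxZ K)) n,
      locMap idxZ_injective (segreTriple_idxZ x y z) K m = biProj hx hy hz n u K := by
  obtain ⟨N, b, hb⟩ := IsLocalization.Away.surj (∏ i ∈ K, segreTriple x y z i) (u K)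
  have key : ∀ (u v : ℤ) (huv : u + v = 1) (m : CubeLoc (segreTriple x y z) K) (b : R ⊗[k] S),
      m * algebraMap _ (CubeLoc (segreTriple x y z) K) (∏ i ∈ K, segreTriple x y z i) ^ N =
        algebraMap _ _ b →
      homogProj (cubeCoaction _ (segreTriple_mem_homog hx hy hz u v) K) n m *
        algebraMap _ (CubeLoc (segreTriple x y z) K) (∏ i ∈ K, segreTriple x y z i) ^ N =
        algebraMap _ _ (homogProj (tensorCoaction 𝓡 𝓢 u v) (n + N * (preSet idxZ K).card) b) := by
    intro u v huv m b hm
    have h1 := locCoaction_comp (homog_prod_mem (segreTriple_mem_homog hx hy hz u v) K)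
    have h2 := homog_pow_mem (map_mem_homog h1
      (homog_prod_mem (segreTriple_mem_homog hx hy hz u v) K)) N
    rw [← homogProj_map h1, ← hm, mul_comm m, homogProj_mul_of_mem
      ((isGradedBy_tensorCoaction u v).locCoaction _) h2, ← segreDeg_sum hK huv,
      add_sub_cancel_right, mul_comm]
  have h3 := key 0 1 (zero_add 1) _ _ (key 1 0 (add_zero 1) _ _ hb)
  obtain ⟨a, ha, hab⟩ := exists_homogProj_homogProj_eq (𝓡 := 𝓡) (𝓢 := 𝓢)
    (n + N * (preSet idxZ K).card) b
  rw [← hab] at h3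
  obtain ⟨q, hq⟩ := ((IsLocalization.Away.algebraMap_isUnit (S := CubeLoc z (preSet idxZ K))
    (∏ a ∈ preSet idxZ K, z a)).pow N).exists_left_inv
  have h4 : algebraMap _ (CubeLoc z (preSet idxZ K)) a * q *
      algebraMap _ (CubeLoc z (preSet idxZ K)) (∏ a ∈ preSet idxZ K, z a) ^ N =
      algebraMap _ (CubeLoc z (preSet idxZ K)) a := by rw [mul_assoc, hq, mul_one]
  refine ⟨algebraMap _ _ a * q, mem_homog_locCoaction _ h4 ?_, ?_⟩
  · simpa using ha
  · have h5 := congrArg (locMap idxZ_injective (segreTriple_idxZ x y z) K) h4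
    rw [map_mul, map_pow, locMap_algebraMap, locMap_algebraMap, ← h3, ← prod_segreTriple hK] at h5
    exact ((IsLocalization.Away.algebraMap_isUnit (S := CubeLoc (segreTriple x y z) K)
      (∏ i ∈ K, segreTriple x y z i)).pow N).mul_right_cancel h5

lemma exists_segrePush_eq (n : ℤ) {u : Cube (segreTriple x y z)} (hu : CubeSupp (fam 2 0 0) u) :
    ∃ c : Cube z, CubeHomog (mem_homog_of_linear hz) n c ∧
      segrePush x y z c = biProj hx hy hz n u := by
  have h1 : ∀ I : Finset (Fin t), ∃ m ∈ homog (cubeCoaction (gradedCoaction (segreGrading 𝓡 𝓢))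
      (mem_homog_of_linear hz) I) n, ∀ c : Cube z, c I = m → ∀ K ∈ fam 2 0 0, preSet idxZ K = I →
      push idxZ_injective (segreTriple_idxZ x y z) c K = biProj hx hy hz n u K := by
    intro I
    rw [← preSet_idxZ_image (r := r) (s := s) I]
    have hI := image_idxZ_mem_fam (r := r) (s := s) I
    obtain ⟨m, hm, hm'⟩ := exists_locMap_eq hx hy hz hI n u
    refine ⟨m, hm, fun c hc K hK hKI => ?_⟩
    have h2 : K = I.image idxZ := triIdx_ext hKI
      ((partOk_zero.1 hK.2.1).trans (partOk_zero.1 hI.2.1).symm)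
      ((partOk_zero.1 hK.2.2).trans (partOk_zero.1 hI.2.2).symm)
    subst h2
    rw [push_apply, hc, hm']
  choose c hc hc' using h1
  refine ⟨c, hc, funext fun K => ?_⟩
  by_cases hK : K ∈ fam 2 0 0
  · rw [segrePush_apply hK]
    exact hc' _ c rfl K hK rfl
  · rw [segrePush_apply_of_notMem hK]
    exact (((hu.map _).map _) K hK).symm

end SegrePush

end SegreF

end

end

section
open scoped TensorProduct LaurentPolynomial
noncomputable section

set_option linter.unusedSectionVars false

namespace SegreF

/-! ### Cochains and coboundaries on the nonempty sets -/

section NonemptySets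

variable {k A : Type*} [Field k] [CommRing A] [Algebra k A] {r : ℕ} {x : Fin r → A}

lemma cubeD_apply_empty {ι : Type*} [DecidableEq ι] {w : ι → A} {rk : ι → ℕ} (c : Cube w) :
    cubeD w rk c ∅ = 0 := by
  rw [cubeD_apply, Finset.sum_empty]

lemma isCubeCocycle_neSet_iff {c : Cube x} :
    IsCubeCocycle Fin.val (neSet _) c ↔ cubeD x Fin.val c = 0 := by
  refine ⟨fun h => funext fun K => ?_, fun h K _ => congrFun h K⟩
  obtain rfl | hK := K.eq_empty_or_nonempty
  · exact cubeD_apply_empty c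
  · exact h K hK

lemma cardSet_subset_neSet (j : ℕ) : cardSet (Fin r) (j + 1) ⊆ neSet (Fin r) := by
  intro K hK
  refine Finset.card_pos.1 ?_
  rw [show K.card = j + 1 from hK]
  exact Nat.succ_pos j

lemma IsCubeCobound.neSet_of_univ {j : ℕ} {c : Cube x} (hc : CubeSupp (cardSet _ (j + 2)) c)
    (h : IsCubeCobound Fin.val Set.univ c) : IsCubeCobound Fin.val (neSet _) c := by
  obtain ⟨b, hb, -, hdb⟩ := h.card hc
  exact ⟨b, hb.mono (cardSet_subset_neSet j), fun K _ => hdb K trivial⟩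

lemma IsCubeCobound.univ_of_neSet {c : Cube x} (hc : CubeSupp (neSet _) c)
    (h : IsCubeCobound Fin.val (neSet _) c) : IsCubeCobound Fin.val Set.univ c := by
  obtain ⟨b, -, hdb⟩ := h
  refine ⟨b, fun K hK => absurd trivial hK, fun K _ => ?_⟩
  obtain rfl | hK := K.eq_empty_or_nonempty
  · rw [cubeD_apply_empty, hc ∅ Finset.not_nonempty_empty]
  · exact hdb K hK

lemma IsFrobNilp.neSet_of_univ {p : ℕ} [Fact p.Prime] [CharP k p] {j : ℕ} {c : Cube x}
    (hc : CubeSupp (cardSet _ (j + 2)) c) (h : IsFrobNilp k p Fin.val Set.univ c) :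
    IsFrobNilp k p Fin.val (neSet _) c := by
  obtain ⟨e, he⟩ := h
  exact ⟨e, he.neSet_of_univ (hc.iterate _ e)⟩

/-- A cochain of negative degree with a single component, at the empty set, vanishes. -/
lemma eq_zero_of_cubeHomog_neg {𝒜 : ℕ → Submodule k A} [GradedAlgebra 𝒜] (hx : ∀ i, x i ∈ 𝒜 1)
    {n : ℤ} (hn : n < 0) {b : Cube x} (hb : CubeSupp (cardSet _ 0) b)
    (hb' : CubeHomog (mem_homog_of_linear hx) n b) : b = 0 := by
  funext K
  obtain rfl | hK := K.eq_empty_or_nonempty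
  · obtain ⟨N, a, ha, h⟩ := exists_of_mem_homog_locCoaction isGradedBy_gradedCoaction
      (homog_prod_mem (mem_homog_of_linear hx) ∅) (hb' ∅)
    rw [Finset.sum_empty, mul_zero, add_zero] at ha
    rw [eq_zero_of_mem_homog_gradedCoaction hn ha, map_zero] at h
    exact (IsUnit.mul_left_eq_zero ((IsLocalization.Away.algebraMap_isUnit _).pow N)).1 h
  · exact hb K fun h => hK.ne_empty (Finset.card_eq_zero.1 h)

/-- A cocycle of negative degree with components at the singletons vanishes in depth two. -/
lemma eq_zero_of_isCubeCocycle_one_neg {𝒜 : ℕ → Submodule k A} [GradedAlgebra 𝒜]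
    (hd : 2 ≤ depth 𝒜) (hx : IsLinearGenerators x 𝒜) {n : ℤ} (hn : n < 0) {c : Cube x}
    (hc : CubeSupp (cardSet _ 1) c) (hc' : CubeHomog (mem_homog_of_linear hx.1) n c)
    (hdc : cubeD x Fin.val c = 0) : c = 0 := by
  obtain ⟨f, g, hf, hg, hfg⟩ := exists_isRegPair hd
  have hspan : (HomogeneousIdeal.irrelevant 𝒜).toIdeal ≤
      (Ideal.span (x '' Set.univ)).radical := by
    rw [Set.image_univ, hx.2]
    exact Ideal.le_radical
  have h1 : IsCubeCobound Fin.val Set.univ c :=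
    hfg.isCubeCobound Fin.val_injective (X := Set.univ) Set.ordConnected_univ
      (fun _ _ _ => Iff.rfl) (hspan hf) (hspan hg)
      (fun K hK => absurd trivial hK) hc (fun K _ => congrFun hdc K)
  obtain ⟨b, hb, -, hdb⟩ := h1.card hc
  have h2 := eq_zero_of_cubeHomog_neg hx.1 hn (hb.map (cubeProj (mem_homog_of_linear hx.1) n))
    (cubeHomog_cubeProj isGradedBy_gradedCoaction _ n b)
  have h3 : cubeD x Fin.val b = c := funext fun K => hdb K trivial
  rw [← hc'.cubeProj_eq, ← h3, CubeOp.map_cubeD, h2, map_zero]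

end NonemptySets

/-! ### Nilpotence for cross products -/

section CrossNilp

variable {k R S : Type*} [Field k] [CommRing R] [Algebra k R] [CommRing S] [Algebra k S]
  {𝓡 : ℕ → Submodule k R} [GradedAlgebra 𝓡] {𝓢 : ℕ → Submodule k S} [GradedAlgebra 𝓢]
  {r s t : ℕ} {x : Fin r → R} {y : Fin s → S} {z : Fin t → segre 𝓡 𝓢}
  {p : ℕ} [Fact p.Prime] [CharP k p]

lemma IsFrobNilp.segreCross_left {c : Cube x} {d : Cube y}
    (hc : IsFrobNilp k p Fin.val (neSet _) c) (hd : CubeSupp (neSet _) d)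
    (hd' : IsCubeCocycle Fin.val (neSet _) d) :
    IsFrobNilp k p triRk (fam 0 1 1) (segreCross x y z c d) := by
  obtain ⟨e, he⟩ := hc
  refine ⟨e, ?_⟩
  rw [iterate_frobOp_segreCross]
  exact isCubeCobound_cross_left _ _ he (hd.iterate _ e) (hd'.iterate _ e)

lemma IsFrobNilp.segreCross_right {c : Cube x} {d : Cube y}
    (hd : IsFrobNilp k p Fin.val (neSet _) d) (hc : CubeSupp (neSet _) c)
    (hc' : IsCubeCocycle Fin.val (neSet _) c) :
    IsFrobNilp k p triRk (fam 0 1 1) (segreCross x y z c d) := by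
  obtain ⟨e, he⟩ := hd
  refine ⟨e, ?_⟩
  rw [iterate_frobOp_segreCross]
  exact isCubeCobound_cross_right _ _ (hc.iterate _ e) (hc'.iterate _ e) he

/-- Nilpotence of the classes of degree `n` in cohomological degree `j`. -/
def IsNilpAt (k : Type*) [Field k] (p : ℕ) [Fact p.Prime] [CharP k p] {A : Type*} [CommRing A]
    [Algebra k A] {𝒜 : ℕ → Submodule k A} [GradedAlgebra 𝒜] {r : ℕ} {x : Fin r → A}
    (hx : ∀ i, x i ∈ 𝒜 1) (n : ℤ) (j : ℕ) : Prop :=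
  ∀ c : Cube x, CubeSupp (cardSet _ j) c → CubeHomog (mem_homog_of_linear hx) n c →
    cubeD x Fin.val c = 0 → IsFrobNilp k p Fin.val Set.univ c

lemma segreCross_zero_left (d : Cube y) : segreCross x y z 0 d = 0 :=
  funext fun _ => cross_eq_zero_left _ _ rfl

lemma segreCross_zero_right (c : Cube x) : segreCross x y z c 0 = 0 :=
  funext fun _ => cross_eq_zero_right _ _ rfl

lemma eq_zero_of_cubeSupp_card_zero {c : Cube x} (hc : CubeSupp (neSet _) c)
    (h : CubeSupp (cardSet _ 0) c) : c = 0 := by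
  funext K
  obtain rfl | hK := K.eq_empty_or_nonempty
  · exact hc ∅ Finset.not_nonempty_empty
  · exact h K fun h' => hK.ne_empty (Finset.card_eq_zero.1 h')

lemma isFrobNilp_segreCross (hdR : 2 ≤ depth 𝓡) (hdS : 2 ≤ depth 𝓢)
    (hx : IsLinearGenerators x 𝓡) (hy : IsLinearGenerators y 𝓢) {n : ℤ} {j : ℕ} (hj : 2 ≤ j)
    (H : ∀ a b, 2 ≤ a → 2 ≤ b → a + b = j + 1 → IsNilpAt k p hx.1 n a ∨ IsNilpAt k p hy.1 n b)
    (H' : 0 ≤ n → (∀ a, IsNilpAt k p hx.1 n a) ∧ ∀ b, IsNilpAt k p hy.1 n b)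
    {a b : ℕ} (hab : a + b = j + 1) {c : Cube x} {d : Cube y}
    (hc : CubeSupp (neSet _) c) (hca : CubeSupp (cardSet _ a) c)
    (hcn : CubeHomog (mem_homog_of_linear hx.1) n c) (hdc : cubeD x Fin.val c = 0)
    (hd : CubeSupp (neSet _) d) (hdb : CubeSupp (cardSet _ b) d)
    (hdn : CubeHomog (mem_homog_of_linear hy.1) n d) (hdd : cubeD y Fin.val d = 0) :
    IsFrobNilp k p triRk (fam 0 1 1) (segreCross x y z c d) := by
  have hc' : IsCubeCocycle Fin.val (neSet _) c := isCubeCocycle_neSet_iff.2 hdc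
  have hd' : IsCubeCocycle Fin.val (neSet _) d := isCubeCocycle_neSet_iff.2 hdd
  have left : 2 ≤ a → IsNilpAt k p hx.1 n a →
      IsFrobNilp k p triRk (fam 0 1 1) (segreCross x y z c d) := by
    intro ha h
    obtain ⟨a, rfl⟩ := Nat.exists_eq_add_of_le' ha
    exact ((h c hca hcn hdc).neSet_of_univ hca).segreCross_left hd hd'
  have right : 2 ≤ b → IsNilpAt k p hy.1 n b →
      IsFrobNilp k p triRk (fam 0 1 1) (segreCross x y z c d) := by
    intro hb h
    obtain ⟨b, rfl⟩ := Nat.exists_eq_add_of_le' hb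
    exact ((h d hdb hdn hdd).neSet_of_univ hdb).segreCross_right hc hc'
  have zero_left : c = 0 → IsFrobNilp k p triRk (fam 0 1 1) (segreCross x y z c d) := by
    rintro rfl
    rw [segreCross_zero_left]
    exact isFrobNilp_zero
  have zero_right : d = 0 → IsFrobNilp k p triRk (fam 0 1 1) (segreCross x y z c d) := by
    rintro rfl
    rw [segreCross_zero_right]
    exact isFrobNilp_zero
  obtain rfl | ha := Nat.eq_zero_or_pos a
  · exact zero_left (eq_zero_of_cubeSupp_card_zero hc hca)
  obtain rfl | hb := Nat.eq_zero_or_pos b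
  · exact zero_right (eq_zero_of_cubeSupp_card_zero hd hdb)
  obtain hn | hn := lt_or_ge n 0
  · obtain rfl | ha := (Nat.succ_le_of_lt ha).eq_or_lt'
    · exact zero_left (eq_zero_of_isCubeCocycle_one_neg hdR hx hn hca hcn hdc)
    obtain rfl | hb := (Nat.succ_le_of_lt hb).eq_or_lt'
    · exact zero_right (eq_zero_of_isCubeCocycle_one_neg hdS hy hn hdb hdn hdd)
    exact (H a b ha hb hab).elim (left ha) (right hb)
  · obtain ha | ha := Nat.lt_or_ge a 2
    · exact right (by omega) ((H' hn).2 b)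
    · exact left ha ((H' hn).1 a)

end CrossNilp

/-! ### Nilpotence for the Segre product -/

section SegreNilp

variable {k R S : Type*} [Field k] [CommRing R] [Algebra k R] [CommRing S] [Algebra k S]
  {𝓡 : ℕ → Submodule k R} [GradedAlgebra 𝓡] {𝓢 : ℕ → Submodule k S} [GradedAlgebra 𝓢]
  {r s t : ℕ} {x : Fin r → R} {y : Fin s → S} {z : Fin t → segre 𝓡 𝓢}

lemma CubeOp.map_sum {A ι α : Type*} [CommRing A] [DecidableEq ι] {w : ι → A} (φ : CubeOp w)
    (s : Finset α) (f : α → Cube w) : φ.map (∑ a ∈ s, f a) = ∑ a ∈ s, φ.map (f a) :=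
  _root_.map_sum (⟨⟨φ.map, φ.map_zero⟩, φ.map_add⟩ : Cube w →+ Cube w) f s

lemma biProj_segrePush (hx : ∀ i, x i ∈ 𝓡 1) (hy : ∀ i, y i ∈ 𝓢 1)
    (hz : ∀ i, z i ∈ segreGrading 𝓡 𝓢 1) {n : ℤ} {c : Cube z}
    (hc : CubeHomog (mem_homog_of_linear hz) n c) :
    biProj hx hy hz n (segrePush x y z c) = segrePush x y z c := by
  rw [biProj, cubeProj_segrePush hx hy hz (add_zero 1), cubeProj_segrePush hx hy hz (zero_add 1),
    hc.cubeProj_eq, hc.cubeProj_eq]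

lemma biProj_segreCross (hx : ∀ i, x i ∈ 𝓡 1) (hy : ∀ i, y i ∈ 𝓢 1)
    (hz : ∀ i, z i ∈ segreGrading 𝓡 𝓢 1) (n : ℤ) (c : Cube x) (d : Cube y) :
    biProj hx hy hz n (segreCross x y z c d) =
      segreCross x y z ((cubeProj (mem_homog_of_linear hx) n).map c)
        ((cubeProj (mem_homog_of_linear hy) n).map d) := by
  rw [biProj, cubeProj_segreCross_left hx hy hz, cubeProj_segreCross_right hx hy hz]

lemma isCubeCobound_of_segrePush (hx : ∀ i, x i ∈ 𝓡 1) (hy : ∀ i, y i ∈ 𝓢 1)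
    (hz : ∀ i, z i ∈ segreGrading 𝓡 𝓢 1) {n : ℤ} {c : Cube z}
    (hc : CubeHomog (mem_homog_of_linear hz) n c)
    (h : IsCubeCobound triRk (fam 2 0 0) (segrePush x y z c)) :
    IsCubeCobound Fin.val Set.univ c := by
  obtain ⟨b, hb, hdb⟩ := h
  obtain ⟨b', -, hb'⟩ := exists_segrePush_eq hx hy hz n hb
  refine ⟨b', fun K hK => absurd trivial hK, fun K _ => ?_⟩
  refine congrFun (segrePush_injective (x := x) (y := y) (funext fun K => ?_)) K
  by_cases hK : K ∈ fam 2 0 0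
  · rw [← cubeD_segrePush _ hK, hb', ← biProj_segrePush hx hy hz hc, biProj, ← CubeOp.map_cubeD,
      ← CubeOp.map_cubeD]
    exact congrArg (fun m => homogProj _ n (homogProj _ n m)) (hdb K hK)
  · rw [segrePush_apply_of_notMem hK, segrePush_apply_of_notMem hK]

lemma isCubeCobound_segrePush {j : ℕ} {c : Cube z} (hc : CubeSupp (cardSet _ (j + 2)) c)
    (h : IsCubeCobound Fin.val Set.univ c) :
    IsCubeCobound triRk (fam 1 0 0) (segrePush x y z c) := by
  obtain ⟨b, hb, hdb⟩ := h.neSet_of_univ hc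
  refine ⟨segrePush x y z b, fun K hK => ?_, fun K hK => ?_⟩
  · by_cases hK' : K ∈ fam 2 0 0
    · rw [segrePush_apply hK', push_apply, hb _ fun h => hK ⟨h, hK'.2⟩, map_zero]
    · exact segrePush_apply_of_notMem hK' _
  · have hK' : K ∈ fam 2 0 0 := ⟨trivial, hK.2⟩
    rw [cubeD_segrePush _ hK', segrePush_apply hK', segrePush_apply hK', push_apply, push_apply,
      hdb _ hK.1]

lemma cubeSupp_segrePush_of_neSet {c : Cube z} (hc : CubeSupp (neSet _) c) :
    CubeSupp (fam 1 0 0) (segrePush x y z c) := by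
  intro K hK
  by_cases hK' : K ∈ fam 2 0 0
  · rw [segrePush_apply hK', push_apply, hc _ fun h => hK ⟨h, hK'.2⟩, map_zero]
  · exact segrePush_apply_of_notMem hK' _

lemma isCubeCocycle_segrePush_iff {c : Cube z} :
    IsCubeCocycle triRk (fam 1 0 0) (segrePush x y z c) ↔ cubeD z Fin.val c = 0 := by
  constructor
  · intro h
    refine segrePush_injective (x := x) (y := y) (funext fun K => ?_)
    rw [map_zero]
    by_cases hK : K ∈ fam 2 0 0
    · rw [← cubeD_segrePush _ hK]
      obtain hZ | hZ := (preSet idxZ K).eq_empty_or_nonempty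
      · rw [Finset.card_eq_zero.1 ((card_of_mem_fam hK).symm.trans (Finset.card_eq_zero.2 hZ)),
          cubeD_apply_empty]
        rfl
      · exact h K ⟨hZ, hK.2⟩
    · exact segrePush_apply_of_notMem hK _
  · intro h K hK
    rw [cubeD_segrePush _ ⟨trivial, hK.2⟩, h, map_zero]
    rfl

lemma tmul_mem_span_idxZ_of_mem (hx : IsLinearGenerators x 𝓡) (hy : IsLinearGenerators y 𝓢)
    (hz : IsLinearGenerators z (segreGrading 𝓡 𝓢)) {f : R} {g : S}
    (hf : f ∈ HomogeneousIdeal.irrelevant 𝓡) (hg : g ∈ HomogeneousIdeal.irrelevant 𝓢) :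
    f ⊗ₜ[k] g ∈ Ideal.span (segreTriple x y z '' Set.range idxZ) := by
  have hf' : f ∈ Ideal.span (Set.range x) := hx.2.symm ▸ hf
  have hg' : g ∈ Ideal.span (Set.range y) := hy.2.symm ▸ hg
  clear hf hg
  induction hf' using Submodule.span_induction with
  | zero => rw [TensorProduct.zero_tmul]; exact zero_mem _
  | add a a' _ _ h h' => rw [TensorProduct.add_tmul]; exact add_mem h h'
  | smul q a _ h =>
    have : (q • a) ⊗ₜ[k] g = (q ⊗ₜ 1) * a ⊗ₜ[k] g :=
      ((Algebra.TensorProduct.tmul_mul_tmul _ _ _ _).trans (by rw [one_mul]; rfl)).symm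
    rw [this]
    exact Ideal.mul_mem_left _ _ h
  | mem a ha =>
    obtain ⟨i, rfl⟩ := ha
    induction hg' using Submodule.span_induction with
    | zero => rw [TensorProduct.tmul_zero]; exact zero_mem _
    | add b b' _ _ h h' => rw [TensorProduct.tmul_add]; exact add_mem h h'
    | smul q b _ h =>
      have : x i ⊗ₜ[k] (q • b) = (1 ⊗ₜ q) * x i ⊗ₜ[k] b :=
        ((Algebra.TensorProduct.tmul_mul_tmul _ _ _ _).trans (by rw [one_mul]; rfl)).symm
      rw [this]
      exact Ideal.mul_mem_left _ _ h
    | mem b hb =>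
      obtain ⟨l, rfl⟩ := hb
      exact tmul_mem_span_idxZ hx.1 hy.1 hz i l

lemma cubeSupp_card_segrePush {j : ℕ} {c : Cube z} (hc : CubeSupp (cardSet _ j) c) :
    CubeSupp (cardSet _ j) (segrePush x y z c) := by
  rw [← hc.restr_eq, segrePush_card]
  exact cubeSupp_restr _ _

/-- Local cohomology of the Segre product vanishes in cohomological degrees zero and one. -/
lemma segre_isCubeCobound_of_lt_two (hdR : 2 ≤ depth 𝓡) (hdS : 2 ≤ depth 𝓢)
    (hx : IsLinearGenerators x 𝓡) (hy : IsLinearGenerators y 𝓢)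
    (hz : IsLinearGenerators z (segreGrading 𝓡 𝓢)) {j : ℕ} (hj : j < 2) {n : ℤ} {c : Cube z}
    (hc : CubeSupp (cardSet _ j) c) (hcn : CubeHomog (mem_homog_of_linear hz.1) n c)
    (hdc : cubeD z Fin.val c = 0) : IsCubeCobound Fin.val Set.univ c := by
  refine isCubeCobound_of_segrePush hx.1 hy.1 hz.1 hcn ?_
  obtain ⟨f, g, hf, hg, hfg⟩ := exists_isRegPair hdR
  obtain ⟨f', g', hf', hg', hfg'⟩ := exists_isRegPair hdS
  have hF := Ideal.le_radical (tmul_mem_span_idxZ_of_mem hx hy hz hf hf')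
  have hG := Ideal.le_radical (add_mem (tmul_mem_span_idxZ_of_mem hx hy hz hg hf')
    (tmul_mem_span_idxZ_of_mem hx hy hz hf hg'))
  have hX : ∀ i ∈ Set.range idxZ, ∀ K : Finset (TriIdx t r s),
      K ∈ fam 2 0 0 ↔ insert i K ∈ fam 2 0 0 := by
    rintro _ ⟨a, rfl⟩ K
    exact mem_fam_insert_idxZ a K
  have hcoc : IsCubeCocycle triRk (fam 2 0 0) (segrePush x y z c) := by
    intro K hK
    rw [cubeD_segrePush _ hK, hdc, map_zero]
    rfl
  have hcard := cubeSupp_card_segrePush (x := x) (y := y) hc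
  interval_cases j
  · rw [eq_zero_of_isCubeCocycle triRk_injective (fam_ordConnected _ _ _) hX hF
      (tmul_regular hfg.left hfg'.left) (cubeSupp_segrePush c) hcard hcoc]
    exact ⟨0, fun _ _ => rfl, fun K _ => by rw [map_zero]⟩
  · exact (hfg.tmul hfg').isCubeCobound triRk_injective (fam_ordConnected _ _ _) hX hF hG
      (cubeSupp_segrePush c) hcard hcoc

variable {p : ℕ} [Fact p.Prime] [CharP k p]

/-- Nilpotence of local cohomology for the Segre product from nilpotence for the factors. -/
lemma segre_isNilpAt (hR : IsStandardGraded 𝓡) (hS : IsStandardGraded 𝓢) (hdR : 2 ≤ depth 𝓡)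
    (hdS : 2 ≤ depth 𝓢) (hx : IsLinearGenerators x 𝓡) (hy : IsLinearGenerators y 𝓢)
    (hz : IsLinearGenerators z (segreGrading 𝓡 𝓢)) {n : ℤ} {j : ℕ}
    (H : ∀ a b, 2 ≤ a → 2 ≤ b → a + b = j + 1 → IsNilpAt k p hx.1 n a ∨ IsNilpAt k p hy.1 n b)
    (H' : 0 ≤ n → (∀ a, IsNilpAt k p hx.1 n a) ∧ ∀ b, IsNilpAt k p hy.1 n b) :
    IsNilpAt k p hz.1 n j := by
  intro c hc hcn hdc
  obtain hj | hj := Nat.lt_or_ge j 2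
  · exact isFrobNilp_of_isCubeCobound
      (segre_isCubeCobound_of_lt_two hdR hdS hx hy hz hj hc hcn hdc)
  have htri := isTriple_segreTriple hR hS hx hy hz
  obtain ⟨j', rfl⟩ := Nat.exists_eq_add_of_le' hj
  have hne := hc.mono (cardSet_subset_neSet (j' + 1))
  have hu := cubeSupp_segrePush_of_neSet (x := x) (y := y) hne
  have hu' := (isCubeCocycle_segrePush_iff (x := x) (y := y)).2 hdc
  obtain ⟨v, hv, hv', huv⟩ := htri.exists_linked_right hu hu'
  let w := cubeRestr _ (cardSet _ (j' + 2 + 1)) (biProj hx.1 hy.1 hz.1 n v)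
  have huw : IsLinked (segrePush x y z c) w := by
    have h1 := ((huv.map (cubeProj (segreTriple_mem_homog hx.1 hy.1 hz.1 1 0) n)).map
      (cubeProj (segreTriple_mem_homog hx.1 hy.1 hz.1 0 1) n)).restr_card (j' + 2)
    change IsLinked (cubeRestr _ _ (biProj hx.1 hy.1 hz.1 n (segrePush x y z c))) _ at h1
    rwa [biProj_segrePush hx.1 hy.1 hz.1 hcn, (cubeSupp_card_segrePush hc).restr_eq] at h1
  have hwn : IsFrobNilp k p triRk (fam 0 1 1) w := by
    obtain ⟨m, c', d', hc', hd', hcc', hdd', h⟩ := exists_sum_cross (segreTriple_idxX x y z)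
      (segreTriple_idxY x y z) hv hv'
    have h1 := ((h.map (cubeProj (segreTriple_mem_homog hx.1 hy.1 hz.1 1 0) n)).map
      (cubeProj (segreTriple_mem_homog hx.1 hy.1 hz.1 0 1) n)).restr_card (j' + 2)
    rw [CubeOp.map_sub, CubeOp.map_sub, map_sub, CubeOp.map_sum, CubeOp.map_sum, map_sum] at h1
    rw [← sub_add_cancel w (∑ i, cubeRestr _ (cardSet _ (j' + 2 + 1))
      (biProj hx.1 hy.1 hz.1 n (segreCross x y z (c' i) (d' i))))]
    refine (isFrobNilp_of_isCubeCobound h1).add (isFrobNilp_sum fun i _ => ?_)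
    rw [biProj_segreCross, cubeRestr_card_segreCross]
    refine isFrobNilp_sum fun q hq => ?_
    refine isFrobNilp_segreCross hdR hdS hx hy hj H H' (Finset.HasAntidiagonal.mem_antidiagonal.1 hq)
      ?_ (cubeSupp_restr _ _) ((cubeHomog_cubeProj isGradedBy_gradedCoaction _ n _).restr _)
      (isCubeCocycle_neSet_iff.1 (((hcc' i).map _).restr_card _))
      ?_ (cubeSupp_restr _ _) ((cubeHomog_cubeProj isGradedBy_gradedCoaction _ n _).restr _)
      (isCubeCocycle_neSet_iff.1 (((hdd' i).map _).restr_card _))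
    · rw [← ((hc' i).map _).restr_eq, cubeRestr_comm]
      exact cubeSupp_restr _ _
    · rw [← ((hd' i).map _).restr_eq, cubeRestr_comm]
      exact cubeSupp_restr _ _
  obtain ⟨e, he⟩ := hwn
  refine ⟨e, isCubeCobound_of_segrePush hx.1 hy.1 hz.1 (hcn.iterate_frobOp p e) ?_⟩
  have hw : CubeSupp (fam 0 1 1) w := by
    have h1 : CubeSupp (fam 0 1 1) (biProj hx.1 hy.1 hz.1 n v) := (hv.map _).map _
    change CubeSupp _ (cubeRestr _ _ _)
    rw [← h1.restr_eq, cubeRestr_comm]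
    exact cubeSupp_restr _ _
  obtain ⟨b, hb, hdb⟩ := htri.isCubeCobound_of_right (hu.iterate _ e) (hu'.iterate _ e)
    (hw.iterate _ e) (huw.iterate (frobOp k p _) e) he
  rw [← iterate_frobOp_segrePush]
  refine ⟨b, hb.mono fun K hK => ⟨trivial, hK.2⟩, fun K hK => ?_⟩
  obtain hZ | hZ := (preSet idxZ K).eq_empty_or_nonempty
  · rw [(hu.iterate _ e) K fun h => h.1.ne_empty hZ,
      Finset.card_eq_zero.1 ((card_of_mem_fam hK).symm.trans (Finset.card_eq_zero.2 hZ)),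
      cubeD_apply_empty]
  · exact hdb K ⟨hZ, hK.2⟩

end SegreNilp

end SegreF

end

end

section
open scoped TensorProduct LaurentPolynomial
noncomputable section

set_option linter.unusedSectionVars false

namespace SegreF

/-! ### The unit cocycle -/

section UnitCocycle

variable {k A : Type*} [Field k] [CommRing A] [Algebra k A] {r : ℕ} {x : Fin r → A}

/-- The cocycle on the nonempty sets given by the unit elements at the singletons. -/
def unitCocycle (x : Fin r → A) : Cube x := cubeD x Fin.val (Pi.single ∅ 1)

lemma cubeSupp_single : CubeSupp (cardSet _ 0) (Pi.single ∅ 1 : Cube x) := fun _ hK =>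
  Pi.single_eq_of_ne (fun h => hK (Finset.card_eq_zero.2 h)) _

lemma cubeSupp_card_unitCocycle : CubeSupp (cardSet _ 1) (unitCocycle x) :=
  cubeSupp_single.cubeD_card

lemma cubeSupp_unitCocycle : CubeSupp (neSet _) (unitCocycle x) :=
  cubeSupp_card_unitCocycle.mono (cardSet_subset_neSet 0)

lemma cubeD_unitCocycle : cubeD x Fin.val (unitCocycle x) = 0 :=
  cubeD_cubeD Fin.val_injective _

lemma unitCocycle_singleton (i : Fin r) : unitCocycle x {i} = 1 := by
  rw [unitCocycle, cubeD_apply, Finset.sum_singleton]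
  have h : ∀ (J : Finset (Fin r)) (hJ : J = ∅) (h : J ⊆ {i}),
      cubeRes x h ((Pi.single ∅ 1 : Cube x) J) = 1 := by
    rintro _ rfl h
    rw [Pi.single_eq_same, map_one]
  have h1 : ({i} : Finset (Fin r)).filter (fun l => l.val < i.val) = ∅ := by
    simp [Finset.filter_singleton]
  rw [h _ (Finset.erase_singleton i), cubeSign, h1, Finset.card_empty, pow_zero, one_smul]

lemma cubeHomog_unitCocycle {ρ : A →+* A[T;T⁻¹]} {δ : Fin r → ℤ} (hρ : IsGradedBy ρ)
    (hx : ∀ i, x i ∈ homog ρ (δ i)) : CubeHomog hx 0 (unitCocycle x) := by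
  have h1 : (cubeProj hx 0).map (Pi.single ∅ 1 : Cube x) = Pi.single ∅ 1 := by
    funext K
    change homogProj _ 0 _ = _
    by_cases hK : K = ∅
    · subst hK
      rw [Pi.single_eq_same, homogProj_of_mem one_mem_homog, if_pos rfl]
    · rw [Pi.single_eq_of_ne hK, map_zero]
  rw [unitCocycle, ← h1, ← CubeOp.map_cubeD]
  exact cubeHomog_cubeProj hρ hx 0 _

lemma exists_not_isNilpotent {𝒜 : ℕ → Submodule k A} [GradedAlgebra 𝒜] [Nontrivial A]
    (hd : 2 ≤ depth 𝒜) (hx : IsLinearGenerators x 𝒜) : ∃ i, ¬ IsNilpotent (x i) := by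
  obtain ⟨a, g, ha, -, hreg⟩ := exists_isRegPair hd
  by_contra! hcon
  have h1 : Ideal.span (Set.range x) ≤ nilradical A := by
    rw [Ideal.span_le]
    rintro _ ⟨i, rfl⟩
    exact hcon i
  obtain ⟨N, hN⟩ : IsNilpotent a := h1 (hx.2.symm ▸ ha)
  have h3 : ∀ m : ℕ, a ^ m ≠ 0 := by
    intro m
    induction m with
    | zero => rw [pow_zero]; exact one_ne_zero
    | succ m ih => rw [pow_succ']; exact fun h => ih (hreg.left _ h)
  exact h3 N hN

lemma one_ne_zero_cubeLoc {i : Fin r} (hi : ¬ IsNilpotent (x i)) : (1 : CubeLoc x {i}) ≠ 0 := by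
  intro h
  rw [← map_one (algebraMap A (CubeLoc x {i})),
    IsLocalization.map_eq_zero_iff (Submonoid.powers (∏ i ∈ {i}, x i))] at h
  obtain ⟨⟨_, N, rfl⟩, hN⟩ := h
  refine hi ⟨N, ?_⟩
  simpa using hN

lemma neD_apply_of_erase_eq_empty (b : Cube x) {K : Finset (Fin r)} (hK : K.Nonempty)
    (h : ∀ l ∈ K, K.erase l = ∅) : neD k x b K = 0 := by
  refine (neRestr_apply_of_nonempty (k := k) hK _).trans ?_
  refine cubeD_apply_eq_zero fun l hl => ?_
  rw [h l hl]
  exact neRestr_apply_empty b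

/-- There is a functional that kills the coboundaries and takes the value one at the unit cocycle
and its Frobenius powers. -/
lemma exists_functional {𝒜 : ℕ → Submodule k A} [GradedAlgebra 𝒜] [Nontrivial A]
    (hd : 2 ≤ depth 𝒜) (hx : IsLinearGenerators x 𝒜) (p : ℕ) [Fact p.Prime] [CharP k p] :
    ∃ f : Cube x →ₗ[k] k, f ∘ₗ neD k x = 0 ∧
      ∀ e, f ((frobOp k p x).map^[e] (unitCocycle x)) = 1 := by
  obtain ⟨K, hK, herase, h1, hunit⟩ : ∃ K : Finset (Fin r), K.Nonempty ∧
      (∀ l ∈ K, K.erase l = ∅) ∧ (1 : CubeLoc x K) ≠ 0 ∧ unitCocycle x K = 1 := by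
    obtain ⟨i, hi⟩ := exists_not_isNilpotent hd hx
    refine ⟨{i}, Finset.singleton_nonempty i, fun l hl => ?_, one_ne_zero_cubeLoc hi,
      unitCocycle_singleton i⟩
    rw [Finset.mem_singleton.1 hl, Finset.erase_singleton]
  obtain ⟨φ, hφ⟩ := Module.Projective.exists_dual_eq_one k h1
  refine ⟨φ ∘ₗ LinearMap.proj K, LinearMap.ext fun b => ?_, fun e => ?_⟩
  · exact (congrArg φ (neD_apply_of_erase_eq_empty b hK herase)).trans (map_zero φ)
  · refine (congrArg φ ?_).trans hφ
    exact (iterate_frobOp_apply e _ K).trans (by rw [hunit, one_pow])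

end UnitCocycle

/-! ### Nilpotence for the factors -/

section Factors

variable {k R S : Type*} [Field k] [CommRing R] [Algebra k R] [CommRing S] [Algebra k S]
  {𝓡 : ℕ → Submodule k R} [GradedAlgebra 𝓡] {𝓢 : ℕ → Submodule k S} [GradedAlgebra 𝓢]
  {r s t : ℕ} {x : Fin r → R} {y : Fin s → S} {z : Fin t → segre 𝓡 𝓢}
  {p : ℕ} [Fact p.Prime] [CharP k p]

/-- A cross product of cocycles of degree zero becomes a coboundary after applying a power of the
Frobenius map, if the corresponding local cohomology of the Segre product is nilpotent. -/
lemma isFrobNilp_segreCross_of_isNilpAt (hR : IsStandardGraded 𝓡) (hS : IsStandardGraded 𝓢)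
    (hx : IsLinearGenerators x 𝓡) (hy : IsLinearGenerators y 𝓢)
    (hz : IsLinearGenerators z (segreGrading 𝓡 𝓢)) {n : ℤ} {j : ℕ} (hj : 2 ≤ j)
    (H : IsNilpAt k p hz.1 n j) {v : Cube (segreTriple x y z)}
    (hv : CubeSupp (fam 0 1 1) v) (hvj : CubeSupp (cardSet _ (j + 1)) v)
    (hv' : IsCubeCocycle triRk (fam 0 1 1) v) (hvn : biProj hx.1 hy.1 hz.1 n v = v) :
    IsFrobNilp k p triRk (fam 0 1 1) v := by
  have htri := isTriple_segreTriple hR hS hx hy hz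
  obtain ⟨j, rfl⟩ := Nat.exists_eq_add_of_le' hj
  obtain ⟨u, hu, hu', huv⟩ := htri.exists_linked_left hv hv'
  obtain ⟨c, hcn, hc⟩ := exists_segrePush_eq hx.1 hy.1 hz.1 n
    (hu.mono fun K hK => (⟨trivial, hK.2⟩ : K ∈ fam 2 0 0))
  have h1 := ((huv.map (cubeProj (segreTriple_mem_homog hx.1 hy.1 hz.1 1 0) n)).map
    (cubeProj (segreTriple_mem_homog hx.1 hy.1 hz.1 0 1) n)).restr_card (j + 2)
  change IsLinked (cubeRestr _ _ (biProj hx.1 hy.1 hz.1 n u))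
    (cubeRestr _ _ (biProj hx.1 hy.1 hz.1 n v)) at h1
  rw [hvn, hvj.restr_eq, ← hc, ← segrePush_card] at h1
  have h2 : IsCubeCocycle triRk (fam 1 0 0)
      (segrePush x y z (cubeRestr z (cardSet _ (j + 2)) c)) := by
    rw [segrePush_card, hc]
    exact ((hu'.map _).map _).restr_card _
  have h3 : CubeSupp (fam 1 0 0) (segrePush x y z (cubeRestr z (cardSet _ (j + 2)) c)) :=
    cubeSupp_segrePush_of_neSet ((cubeSupp_restr _ _).mono (cardSet_subset_neSet (j + 1)))
  obtain ⟨e, he⟩ := H _ (cubeSupp_restr _ _) (hcn.restr _) (isCubeCocycle_segrePush_iff.1 h2)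
  refine ⟨e, htri.isCubeCobound_of_left (h3.iterate _ e) (hv.iterate _ e) (hv'.iterate _ e)
    (h1.iterate (frobOp k p _) e) ?_⟩
  rw [iterate_frobOp_segrePush]
  exact isCubeCobound_segrePush ((cubeSupp_restr _ _).iterate _ e) he

lemma cubeSupp_card_segreCross {a b j : ℕ} (hab : a + b = j) {c : Cube x} {d : Cube y}
    (hc : CubeSupp (cardSet _ a) c) (hd : CubeSupp (cardSet _ b) d) :
    CubeSupp (cardSet _ j) (segreCross x y z c d) := by
  intro K hK
  by_cases hZ : preSet idxZ K = ∅
  · by_cases h1 : (preSet idxX K).card = a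
    · refine cross_eq_zero_right _ _ (hd _ fun h2 => hK ?_)
      change K.card = j
      rw [card_triIdx, hZ, h1, show (preSet idxY K).card = b from h2, Finset.card_empty, zero_add,
        hab]
    · exact cross_eq_zero_left _ _ (hc _ h1)
  · exact segreCross_apply_of_ne hZ _ _

lemma isNilpAt_right_of_segre (hR : IsStandardGraded 𝓡) (hS : IsStandardGraded 𝓢)
    (hdR : 2 ≤ depth 𝓡) (hx : IsLinearGenerators x 𝓡) (hy : IsLinearGenerators y 𝓢)
    (hz : IsLinearGenerators z (segreGrading 𝓡 𝓢)) {j : ℕ} (hj : 2 ≤ j)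
    (H : IsNilpAt k p hz.1 0 j) : IsNilpAt k p hy.1 0 j := by
  intro d hd hdn hdd
  have := hR.nontrivial
  obtain ⟨i, rfl⟩ := Nat.exists_eq_add_of_le' hj
  obtain ⟨f, hf, hf'⟩ := exists_functional hdR hx p
  have hd1 := hd.mono (cardSet_subset_neSet (i + 1))
  have hu : IsCubeCocycle Fin.val (neSet _) (unitCocycle x) :=
    isCubeCocycle_neSet_iff.2 cubeD_unitCocycle
  have hd2 : IsCubeCocycle Fin.val (neSet _) d := isCubeCocycle_neSet_iff.2 hdd
  obtain ⟨e, he⟩ := isFrobNilp_segreCross_of_isNilpAt hR hS hx hy hz hj H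
    (v := segreCross x y z (unitCocycle x) d) (CubeSupp.cross _ _ cubeSupp_unitCocycle hd1)
    (cubeSupp_card_segreCross (add_comm 1 _) cubeSupp_card_unitCocycle hd)
    (isCubeCocycle_cross _ _ hu hd2) (by
      rw [biProj_segreCross, hdn.cubeProj_eq,
        (cubeHomog_unitCocycle isGradedBy_gradedCoaction _).cubeProj_eq])
  rw [iterate_frobOp_segreCross] at he
  exact ⟨e, (isCubeCobound_of_cross_right _ _ hf (hf' e) (cubeSupp_unitCocycle.iterate _ e)
    (hd1.iterate _ e) he).univ_of_neSet (hd1.iterate _ e)⟩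

lemma isNilpAt_left_of_segre (hR : IsStandardGraded 𝓡) (hS : IsStandardGraded 𝓢)
    (hdS : 2 ≤ depth 𝓢) (hx : IsLinearGenerators x 𝓡) (hy : IsLinearGenerators y 𝓢)
    (hz : IsLinearGenerators z (segreGrading 𝓡 𝓢)) {j : ℕ} (hj : 2 ≤ j)
    (H : IsNilpAt k p hz.1 0 j) : IsNilpAt k p hx.1 0 j := by
  intro c hc hcn hdc
  have := hS.nontrivial
  obtain ⟨i, rfl⟩ := Nat.exists_eq_add_of_le' hj
  obtain ⟨f, hf, hf'⟩ := exists_functional hdS hy p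
  have hc1 := hc.mono (cardSet_subset_neSet (i + 1))
  have hu : IsCubeCocycle Fin.val (neSet _) (unitCocycle y) :=
    isCubeCocycle_neSet_iff.2 cubeD_unitCocycle
  have hc2 : IsCubeCocycle Fin.val (neSet _) c := isCubeCocycle_neSet_iff.2 hdc
  obtain ⟨e, he⟩ := isFrobNilp_segreCross_of_isNilpAt hR hS hx hy hz hj H
    (v := segreCross x y z c (unitCocycle y)) (CubeSupp.cross _ _ hc1 cubeSupp_unitCocycle)
    (cubeSupp_card_segreCross rfl hc cubeSupp_card_unitCocycle)
    (isCubeCocycle_cross _ _ hc2 hu) (by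
      rw [biProj_segreCross, hcn.cubeProj_eq,
        (cubeHomog_unitCocycle isGradedBy_gradedCoaction _).cubeProj_eq])
  rw [iterate_frobOp_segreCross] at he
  exact ⟨e, (isCubeCobound_of_cross_left _ _ hf (hc1.iterate _ e) (hf' e)
    (cubeSupp_unitCocycle.iterate _ e) he).univ_of_neSet (hc1.iterate _ e)⟩

end Factors

/-! ### The criterion -/

section Criterion

variable {k A : Type*} [Field k] [CommRing A] [Algebra k A] {𝒜 : ℕ → Submodule k A}
  [GradedAlgebra 𝒜] {r : ℕ} {x : Fin r → A} {p : ℕ} [Fact p.Prime] [CharP k p]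

lemma succ_le_of_natCast_lt {j : ℕ} {n : WithBot ℕ∞} (h : (j : WithBot ℕ∞) < n) :
    ((j + 1 : ℕ) : WithBot ℕ∞) ≤ n := by
  induction n using WithBot.recBotCoe with
  | bot => exact absurd h not_lt_bot
  | coe n =>
    have h1 : (j : ℕ∞) < n := WithBot.coe_lt_coe.1 h
    exact WithBot.coe_le_coe.2 (by exact_mod_cast Order.add_one_le_of_lt h1)

lemma isNilp_locCohFrob_iff_forall_isNilpAt (hx : ∀ i, x i ∈ 𝒜 1) {j : ℕ} :
    IsNilp (locCohFrob x k p j) ↔ ∀ n, IsNilpAt k p hx n j := by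
  rw [isNilp_locCohFrob_iff]
  refine ⟨fun h n c hc _ hdc => h c hc hdc, fun h c hc hdc => ?_⟩
  obtain ⟨S, hS⟩ := exists_sum_cubeProj_eq isGradedBy_gradedCoaction (mem_homog_of_linear hx) c
  rw [hS]
  refine isFrobNilp_sum fun n _ => h n _ (hc.map _)
    (cubeHomog_cubeProj isGradedBy_gradedCoaction _ n c) ?_
  rw [← CubeOp.map_cubeD, hdc, CubeOp.map_zero]

lemma IsStandardGraded.exists_ringKrullDim_eq (hA : IsStandardGraded 𝒜)
    (hx : IsLinearGenerators x 𝒜) : ∃ d : ℕ, ringKrullDim A = d := by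
  have := hA.nontrivial
  have := hA.finiteType hx
  obtain ⟨d, -, -, -, h⟩ := exists_algebraicIndependent_isIntegral k A
  exact ⟨d, h⟩

lemma bInv_eq_top_of_forall_isNilpAt (hx : ∀ i, x i ∈ 𝒜 1) (h : ∀ j, IsNilpAt k p hx 0 j) :
    bInv x 𝒜 p = ⊤ :=
  (SegreF.bInv_eq_top_iff p).2 fun j hj =>
    not_isNilpInDegree_zero_of_bIndex_eq_zero p hj ((isNilpInDegree_locCohFrob_iff p hx).2 (h j))

lemma IsStandardGraded.bInv_eq_top_iff (hA : IsStandardGraded 𝒜) (hx : IsLinearGenerators x 𝒜) :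
    bInv x 𝒜 p = ⊤ ↔ ∀ j, IsNilpAt k p hx.1 0 j :=
  ⟨fun h j => (isNilpInDegree_locCohFrob_iff p hx.1).1
    (hA.isNilpInDegree_zero_of_bInv_eq_top p hx h j), bInv_eq_top_of_forall_isNilpAt hx.1⟩

/-- For a weakly `F`-nilpotent ring of dimension `d`, the only obstruction to nilpotence in degree
zero lies in the top local cohomology. -/
lemma IsStandardGraded.bInv_eq_top_of_isNilpAt (hA : IsStandardGraded 𝒜)
    (hx : IsLinearGenerators x 𝒜) (hw : IsWeaklyFNilpotent x k p) {d : ℕ}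
    (hd : ringKrullDim A = d) (h : IsNilpAt k p hx.1 0 d) : bInv x 𝒜 p = ⊤ := by
  refine bInv_eq_top_of_forall_isNilpAt hx.1 fun j => ?_
  obtain hj | rfl | hj := lt_trichotomy j d
  · exact (isNilp_locCohFrob_iff_forall_isNilpAt hx.1).1
      (hw j (by rw [hd]; exact_mod_cast hj)) 0
  · exact h
  · exact fun c hc _ hdc => isFrobNilp_of_isCubeCobound
      (hA.isCubeCobound_of_ringKrullDim_lt hx (by rw [hd]; exact_mod_cast hj) hc hdc)

end Criterion

end SegreF

end

end

theorem mainTheorem4 {k : Type*} [Field k] (p : ℕ) [Fact p.Prime] [CharP k p]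
    {R : Type*} [CommRing R] [Algebra k R] (𝓡 : ℕ → Submodule k R) [GradedAlgebra 𝓡]
    {S : Type*} [CommRing S] [Algebra k S] (𝓢 : ℕ → Submodule k S) [GradedAlgebra 𝓢]
    (hR : SegreF.IsStandardGraded 𝓡) (hS : SegreF.IsStandardGraded 𝓢)
    (hdR : 2 ≤ SegreF.depth 𝓡) (hdS : 2 ≤ SegreF.depth 𝓢)
    {r s t : ℕ} (x : Fin r → R) (y : Fin s → S) (z : Fin t → SegreF.segre 𝓡 𝓢)
    (hx : SegreF.IsLinearGenerators x 𝓡) (hy : SegreF.IsLinearGenerators y 𝓢)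
    (hz : SegreF.IsLinearGenerators z (SegreF.segreGrading 𝓡 𝓢))
    (hRw : SegreF.IsWeaklyFNilpotent x k p) (hSw : SegreF.IsWeaklyFNilpotent y k p) :
    (SegreF.IsWeaklyFNilpotent z k p ↔
      SegreF.bInv x 𝓡 p = ⊤ ∧ SegreF.bInv y 𝓢 p = ⊤) ∧
    (SegreF.bInv x 𝓡 p = ⊤ ∧ SegreF.bInv y 𝓢 p = ⊤ →
      SegreF.bInv z (SegreF.segreGrading 𝓡 𝓢) p = ⊤) := by
  obtain ⟨d, hd⟩ := hR.exists_ringKrullDim_eq hx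
  obtain ⟨e, he⟩ := hS.exists_ringKrullDim_eq hy
  have hdimR := SegreF.two_le_ringKrullDim hR.nontrivial hdR
  have hdimS := SegreF.two_le_ringKrullDim hS.nontrivial hdS
  have hd2 : 2 ≤ d := by rw [hd] at hdimR; exact_mod_cast hdimR
  have he2 : 2 ≤ e := by rw [he] at hdimS; exact_mod_cast hdimS
  have hnz : SegreF.bInv x 𝓡 p = ⊤ ∧ SegreF.bInv y 𝓢 p = ⊤ → ∀ n : ℤ, 0 ≤ n →
      (∀ a, SegreF.IsNilpAt k p hx.1 n a) ∧ ∀ b, SegreF.IsNilpAt k p hy.1 n b := by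
    rintro ⟨hbR, hbS⟩ n hn
    obtain rfl | hn := hn.eq_or_lt
    · exact ⟨(hR.bInv_eq_top_iff hx).1 hbR, (hS.bInv_eq_top_iff hy).1 hbS⟩
    · exact ⟨fun a c hc hcn hdc => hR.isFrobNilp_of_pos p hx hn hc hcn hdc,
        fun b c hc hcn hdc => hS.isFrobNilp_of_pos p hy hn hc hcn hdc⟩
  refine ⟨⟨fun hT => ⟨?_, ?_⟩, fun hb j hj => ?_⟩, fun hb => ?_⟩
  · refine hR.bInv_eq_top_of_isNilpAt hx hRw hd
      (SegreF.isNilpAt_left_of_segre hR hS hdS hx hy hz hd2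
        ((SegreF.isNilp_locCohFrob_iff_forall_isNilpAt hz.1).1 (hT d ?_) 0))
    exact lt_of_lt_of_le (by exact_mod_cast Nat.lt_succ_self d)
      (SegreF.succ_le_ringKrullDim_segre_left hR hS hx hy (by omega) hd.ge hdimS)
  · refine hS.bInv_eq_top_of_isNilpAt hy hSw he
      (SegreF.isNilpAt_right_of_segre hR hS hdR hx hy hz he2
        ((SegreF.isNilp_locCohFrob_iff_forall_isNilpAt hz.1).1 (hT e ?_) 0))
    exact lt_of_lt_of_le (by exact_mod_cast Nat.lt_succ_self e)
      (SegreF.succ_le_ringKrullDim_segre_right hR hS hx hy (by omega) hdimR he.ge)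
  · refine (SegreF.isNilp_locCohFrob_iff_forall_isNilpAt hz.1).2 fun n =>
      SegreF.segre_isNilpAt hR hS hdR hdS hx hy hz (fun a b _ _ hab => ?_) (hnz hb n)
    have := hR.noetherian
    have hj' : ((j + 1 : ℕ) : WithBot ℕ∞) ≤ ringKrullDim (SegreF.segre 𝓡 𝓢) :=
      SegreF.succ_le_of_natCast_lt hj
    have hlt := SegreF.ringKrullDim_segre_lt hR hS hx hy hdR hd he hj'
    obtain ha | ha := Nat.lt_or_ge a d
    · exact Or.inl ((SegreF.isNilp_locCohFrob_iff_forall_isNilpAt hx.1).1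
        (hRw a (by rw [hd]; exact_mod_cast ha)) n)
    · exact Or.inr ((SegreF.isNilp_locCohFrob_iff_forall_isNilpAt hy.1).1
        (hSw b (by rw [he]; exact_mod_cast (by omega : b < e))) n)
  · exact SegreF.bInv_eq_top_of_forall_isNilpAt hz.1 fun j =>
      SegreF.segre_isNilpAt hR hS hdR hdS hx hy hz
        (fun a b _ _ _ => Or.inl ((hnz hb 0 le_rfl).1 a)) (hnz hb 0)
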